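/- **Setting.** Let $\mathbb A=\{1,\dots,n\}$ be the set of agents. A *piece* is a finite (possibly empty) union of closed subintervals of the cake $[0,1]$; two pieces are disjoint if their interiors are. A *valuation* is a function $V$ from pieces to $\mathbb R$ that is non-negative, monotone under inclusion, additive on disjoint pieces, normalized by $V([0,1])=1$, and such that $V([l,r])$ is continuous in $(l,r)$ for $0\le l\le r\le 1$. A *valuation set* is a family $\overline V=(V_a)_{a\in\mathbb A}$ of valuations. For $r<l$ the set $[l,r]=\{x: l\le x\le r\}$ is empty and has value $0$. **Slice.** The values are booleans, points $r\in\mathbb R$, intervals $[l,r]$ with $l\le r$, pieces (finite lists of intervals), read-only copies of intervals and pieces, formal linear combinations $\sum_i r_iV_{a_i}(P_i)$ with $P_i$ an interval or a piece, and tuples of values; one-component tuples are identified with their component. The expressions are $$e ::= v \mid x \mid w \mid \mathrm{rd}\,w \mid (e_1,\dots,e_k) \mid \mathtt{let}\ \bar x,\bar w=\mathtt{split}\ e_1\ \mathtt{in}\ e_2 \mid \mathtt{if}\ e_1\ \mathtt{then}\ e_2\ \mathtt{else}\ e_3 \mid o(e_1,\dots,e_k) \mid \mathtt{cake} \mid \mathtt{divide}(e_1,e_2)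 \mid \mathtt{piece}(e_1,\dots,e_k) \mid \mathtt{mark}^s_a(e_1,e_2) \mid \mathtt{eval}_a(e),$$ where $x$ is an ordinary and $w$ an affine variable, $\mathrm{rd}\,w$ is the read-only copy of $w$, $a\in\mathbb A$, and $s$ is the identifier of the mark. The operations $o$ are: and, or, not; $\ge$ on points; $\ge$, $=$ and $+$ on valuation values; multiplication of a valuation value by a real constant. The types are $\mathsf{Bool}$, $\mathsf{Point}$, $\mathsf{Vltn}$, read-only intervals and read-only pieces (all non-affine), and $\mathsf{Intvl}$, $\mathsf{Piece}$ and products (affine). In an affinely typed expression each affine variable is used at most once (the branches of a conditional share their affine variables), while ordinary variables, which have non-affine types, and read-only copies may be used freely. The expression $\mathtt{cake}$ is an interval, $\mathtt{divide}$ takes an interval and a point to a pair of intervals, $\mathtt{piece}$ takes intervals to a piece, $\mathtt{mark}$ takes a read-only interval and a valuation value to a point, and $\mathtt{eval}$ takes a read-only interval or piece to a valuation value. The evaluation relation $e\Downarrow_{\overline V}v$ is the evident call-by-value big-step relation, with these rules: $\mathtt{cake}$ yields $[0,1]$; $\mathtt{split}$ substitutes the components of a tuple for $\bar x,\bar w$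 and their read-only copies for the $\mathrm{rd}\,w$; $\mathtt{divide}([l,h],r)$ yields $([l,r],[r,h])$ if $l\le r\le h$ (otherwise it has no value); $\mathtt{piece}$ collects its intervals; $\mathtt{eval}_a(P)$ yields $V_a(P)$; and $\mathtt{mark}_a([l,h],q)$ yields any $r\in[0,1]$ for which $V_a([l,r])$ equals the number denoted by $q$ under $\overline V$. Comparisons of valuation values compare the numbers they denote under $\overline V$. An expression $e$ is *well-formed* if it is closed and well-typed, its intervals (those in its interval and piece values, not read-only, together with one copy of $[0,1]$ for each $\mathtt{cake}$) have pairwise disjoint interiors, no point other than $0$ and $1$ occurs in its values, and its mark identifiers are distinct. Write $\mathsf{Piece}^{\mathbb A}$ for the $n$-fold product of $\mathsf{Piece}$. For $e$ with $\vdash e:\mathsf{Piece}^{\mathbb A}$, $e$ is *envy-free for all valuation sets* if for every $\overline V$, whenever $e\Downarrow_{\overline V}(P_1,\dots,P_n)$, one has $V_a(P_a)\ge V_a(P_{a'})$ for all $a,a'\in\mathbb A$. **Paths and constraints.** A *path* of $e$ is obtained by replacing every conditional $\mathtt{if}\ e_1\ \mathtt{then}\ e_2\ \mathtt{else}\ e_3$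 in $e$ by $\mathtt{assert}\ b_1\ \mathtt{in}\ b_2$ or by $\mathtt{assert}\ \neg b_1\ \mathtt{in}\ b_3$, with $b_i$ a path of $e_i$. Logical terms and formulas are built from the values, the operations, one real variable $y_s$ per mark identifier $s$, left and right endpoints $\ell(t),r(t)$, intervals $[t,t']$, unions, tuples, projections $\pi_i$, and function symbols $\mathrm{val}_a$. The term $\rho(b)$ describes the result of $b$. It is defined homomorphically, with $\rho(\mathtt{cake})=[0,1]$, $\rho(\mathtt{mark}^s_a(b_1,b_2))=y_s$, $\rho(\mathtt{eval}_a(b))=\mathrm{val}_a(\rho(b))$, $\rho(\mathtt{piece}(b_1,\dots,b_k))=\bigcup_i\rho(b_i)$, $\rho(\mathtt{divide}(b_1,b_2))=([\ell(\rho(b_1)),\rho(b_2)],[\rho(b_2),r(\rho(b_1))])$, $\rho(\mathtt{assert}\ b_1\ \mathtt{in}\ b_2)=\rho(b_2)$, and $\rho(\mathtt{let}\ \bar x,\bar w=\mathtt{split}\ b_1\ \mathtt{in}\ b_2)=\rho(b_2)\theta$, where $\theta$ substitutes the terms $\pi_i(\rho(b_1))$ for $\bar x,\bar w$ and for the copies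 $\mathrm{rd}\,w$. The constraint $c(b)$ is the conjunction of the constraints of the immediate subpaths (with $\theta$ applied to that of the body of a $\mathtt{split}$) and of * $\rho(b_1)$, if $b=\mathtt{assert}\ b_1\ \mathtt{in}\ b_2$; * $\ell(\rho(b_1))\le\rho(b_2)\le r(\rho(b_1))$, if $b=\mathtt{divide}(b_1,b_2)$; * $\mathrm{val}_a([\ell(\rho(b_1)),y_s])=\rho(b_2)$, if $b=\mathtt{mark}^s_a(b_1,b_2)$. Let $Y_b$ be the set of variables $y_s$ occurring in $c(b)$ or $\rho(b)$, and let $$E(t)=\bigwedge_{a,a'\in\mathbb A}\mathrm{val}_a(\pi_a t)\ge\mathrm{val}_a(\pi_{a'}t).$$ The simplification $R$ computes all projections of tuples and endpoints of intervals in a formula, and turns boolean terms into formulas. **Replacements.** A *piecewise uniform replacement* for $b$ is a total order $S$ on $Y_b\cup\{0,1\}$ with least element $0$ and greatest element $1$. For each agent $a$ and each element $p\ne0$ of $S$ there is a real variable $z_{a,p}$. For an interval term $t=[p,p']$ with $p,p'\in S$ let $S|_t=\{q\in S: p<_Sq\le_Sp'\}$, and for a union of such terms let $S|_t$ be the union of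 these sets. Applying $S$ to a simplified formula replaces every $\mathrm{val}_a(t)$ by $\sum_{p\in S|_t}(p-z_{a,p})$. If $p_1<_S\dots<_Sp_k$ are the elements of $S$ other than $0$, then $$\psi(S)=\bigwedge_{a,a'\in\mathbb A}\Big(0\le z_{a,p_1}\le p_1\le z_{a,p_2}\le p_2\le\dots\le z_{a,p_k}\le p_k\le1\ \wedge\ \sum_{i=1}^k(p_i-z_{a,p_i})=\sum_{i=1}^k(p_i-z_{a',p_i})\Big).$$ **Theorem.** Let $e$ be a well-formed Slice expression with $\vdash e:\mathsf{Piece}^{\mathbb A}$. Then $e$ is envy-free for all valuation sets if and only if the formula $$\Phi(e)=\bigwedge_{b}\ \bigwedge_{S}\ \forall Y_b.\ S\big(R\big(c(b)\wedge\psi(S)\Rightarrow E(\rho(b))\big)\big)$$ is valid, i.e. true for all real values of its free variables $z_{a,p}$. Here $b$ ranges over the paths of $e$ and $S$ over the piecewise uniform replacements for $b$. Moreover, $\Phi(e)$ contains no symbols $\mathrm{val}_a$ and is a formula of linear real arithmetic (all its atoms compare linear terms in the variables $y_s$ and $z_{a,p}$), and none of the variables $y_s$ is free in it. -/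

import Mathlib

namespace Slice

open Set

noncomputable section

/-! ### Pieces of cake and valuations

The cake is the interval `[0,1]` and the agents are the elements of `Fin n`. -/

/-- A finite (possibly empty) union of closed subintervals of the cake. -/
def IsPiece (P : Set ℝ) : Prop :=
  ∃ l : List (ℝ × ℝ), (∀ p ∈ l, 0 ≤ p.1 ∧ p.1 ≤ p.2 ∧ p.2 ≤ 1) ∧ P = ⋃ p ∈ l, Icc p.1 p.2

/-- A valuation. Only its values on pieces matter. Two pieces are disjoint when they share at most
boundary points, i.e. when their interiors are disjoint. -/
structure Valuation where
  toFun : Set ℝ → ℝ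
  additive : ∀ P Q, IsPiece P → IsPiece Q → Disjoint (interior P) (interior Q) →
    toFun (P ∪ Q) = toFun P + toFun Q
  nonneg : ∀ P, IsPiece P → 0 ≤ toFun P
  continuous : ContinuousOn (fun p : ℝ × ℝ => toFun (Icc p.1 p.2))
    {p | 0 ≤ p.1 ∧ p.1 ≤ p.2 ∧ p.2 ≤ 1}
  mono : ∀ P Q, IsPiece P → IsPiece Q → Q ⊆ P → toFun Q ≤ toFun P
  normalized : toFun (Icc 0 1) = 1

/-! ### Values -/

/-- An interval `[lo, hi]` with `lo ≤ hi`. -/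
structure Intvl where
  lo : ℝ
  hi : ℝ
  le : lo ≤ hi

def Intvl.toSet (I : Intvl) : Set ℝ := Icc I.lo I.hi

/-- An interval or a piece, as it occurs inside a valuation value. -/
inductive Region where
  | intvl (I : Intvl)
  | piece (Is : List Intvl)

def Region.toSet : Region → Set ℝ
  | .intvl I => I.toSet
  | .piece Is => ⋃ I ∈ Is, I.toSet

def Region.intvls : Region → List Intvl
  | .intvl I => [I]
  | .piece Is => Is

/-- Values of the language. `vltn l` is the formal sum `∑ r • V_a(P)` over `(r, a, P) ∈ l`;
`rdIntvl` and `rdPiece` are the read-only intervals and pieces. -/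
inductive Val (n : ℕ) where
  | bool (b : Bool)
  | pt (r : ℝ)
  | intvl (I : Intvl)
  | piece (Is : List Intvl)
  | vltn (l : List (ℝ × Fin n × Region))
  | rdIntvl (I : Intvl)
  | rdPiece (Is : List Intvl)
  | tup (vs : List (Val n))

variable {n : ℕ}

/-- The real number denoted by a formal sum, for a given valuation set. -/
def vltnEval (V : Fin n → Valuation) (l : List (ℝ × Fin n × Region)) : ℝ :=
  (l.map fun q => q.1 * (V q.2.1).toFun q.2.2.toSet).sum

/-- A one-component tuple is identified with its component. -/
def Val.mkTup : List (Val n) → Val n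
  | [v] => v
  | vs => .tup vs

mutual
/-- The read operation on values. -/
def Val.rd : Val n → Val n
  | .intvl I => .rdIntvl I
  | .piece Is => .rdPiece Is
  | .tup vs => .tup (Val.rdL vs)
  | v => v
def Val.rdL : List (Val n) → List (Val n)
  | [] => []
  | v :: vs => v.rd :: Val.rdL vs
end

mutual
/-- The interval list `I(v)` of a value; read-only values do not contribute. -/
def Val.intvls : Val n → List Intvl
  | .intvl I => [I]
  | .piece Is => Is
  | .tup vs => Val.intvlsL vs
  | _ => []
def Val.intvlsL : List (Val n) → List Intvl
  | [] => []
  | v :: vs => v.intvls ++ Val.intvlsL vs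
end

def Intvl.ends (I : Intvl) : List ℝ := [I.lo, I.hi]

mutual
/-- All points occurring in a value, including the endpoints of intervals. -/
def Val.points : Val n → List ℝ
  | .bool _ => []
  | .pt r => [r]
  | .intvl I => I.ends
  | .piece Is => Is.flatMap Intvl.ends
  | .vltn l => l.flatMap fun q => q.2.2.intvls.flatMap Intvl.ends
  | .rdIntvl I => I.ends
  | .rdPiece Is => Is.flatMap Intvl.ends
  | .tup vs => Val.pointsL vs
def Val.pointsL : List (Val n) → List ℝ
  | [] => []
  | v :: vs => v.points ++ Val.pointsL vs
end

/-! ### Expressions -/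

/-- Non-affine variables: ordinary variables `x` and the read-only copies `rd w` of affine
variables `w`. Variables of each kind are named by natural numbers. -/
inductive NVar where
  | x (i : ℕ)
  | rd (w : ℕ)
  deriving DecidableEq

/-- The primitive operations: boolean connectives, comparison of points, comparison of valuations,
addition of valuations, and multiplication of a valuation by a constant. -/
inductive Op where
  | and | or | not
  | ptGe | vGe | vEq
  | add
  | smul (r : ℝ)

/-- Expressions. In `split xs ws e₁ e₂` the ordinary variables `xs` and the affine variables `ws`
(with their read-only copies) are bound in `e₂`; in `mark s a e₁ e₂` the number `s` is the
identifier of the mark. -/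
inductive Expr (n : ℕ) where
  | val (v : Val n)
  | nvar (x : NVar)
  | avar (w : ℕ)
  | tup (es : List (Expr n))
  | split (xs ws : List ℕ) (e₁ e₂ : Expr n)
  | ite (e₁ e₂ e₃ : Expr n)
  | op (o : Op) (es : List (Expr n))
  | cake
  | div (e₁ e₂ : Expr n)
  | piece (es : List (Expr n))
  | mark (s : ℕ) (a : Fin n) (e₁ e₂ : Expr n)
  | eval (a : Fin n) (e : Expr n)

/-- The component of `vs` bound to the ordinary variable `i` by `xs, ws = split vs`. -/
def bindX {β : Type} (xs : List ℕ) (vs : List β) (i : ℕ) : Option β := (xs.zip vs).lookup i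

/-- The component of `vs` bound to the affine variable `w` by `xs, ws = split vs`. -/
def bindW {β : Type} (xs ws : List ℕ) (vs : List β) (w : ℕ) : Option β :=
  (ws.zip (vs.drop xs.length)).lookup w

/-- Is the non-affine variable bound by a `split` with binders `xs, ws`? -/
def bindsN (xs ws : List ℕ) : NVar → Bool
  | .x i => xs.contains i
  | .rd w => ws.contains w

mutual
/-- Substitution of values for variables, respecting the binders of `split`. -/
def Expr.subst (σ : NVar → Option (Val n)) (δ : ℕ → Option (Val n)) : Expr n → Expr n
  | .val v => .val v
  | .nvar x => match σ x with
    | some v => .val v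
    | none => .nvar x
  | .avar w => match δ w with
    | some v => .val v
    | none => .avar w
  | .tup es => .tup (Expr.substL σ δ es)
  | .split xs ws e₁ e₂ => .split xs ws (e₁.subst σ δ)
      (e₂.subst (fun x => if bindsN xs ws x then none else σ x)
        (fun w => if ws.contains w then none else δ w))
  | .ite e₁ e₂ e₃ => .ite (e₁.subst σ δ) (e₂.subst σ δ) (e₃.subst σ δ)
  | .op o es => .op o (Expr.substL σ δ es)
  | .cake => .cake
  | .div e₁ e₂ => .div (e₁.subst σ δ) (e₂.subst σ δ)
  | .piece es => .piece (Expr.substL σ δ es)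
  | .mark s a e₁ e₂ => .mark s a (e₁.subst σ δ) (e₂.subst σ δ)
  | .eval a e => .eval a (e.subst σ δ)
def Expr.substL (σ : NVar → Option (Val n)) (δ : ℕ → Option (Val n)) :
    List (Expr n) → List (Expr n)
  | [] => []
  | e :: es => e.subst σ δ :: Expr.substL σ δ es
end

mutual
/-- Concatenates a contribution `f` of the values, `c` of each `cake` and `m` of the mark
identifiers over all subexpressions. -/
def Expr.collect {β : Type} (f : Val n → List β) (c : List β) (m : ℕ → List β) :
    Expr n → List β
  | .val v => f v
  | .nvar _ => []
  | .avar _ => []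
  | .tup es => Expr.collectL f c m es
  | .split _ _ e₁ e₂ => e₁.collect f c m ++ e₂.collect f c m
  | .ite e₁ e₂ e₃ => e₁.collect f c m ++ e₂.collect f c m ++ e₃.collect f c m
  | .op _ es => Expr.collectL f c m es
  | .cake => c
  | .div e₁ e₂ => e₁.collect f c m ++ e₂.collect f c m
  | .piece es => Expr.collectL f c m es
  | .mark s _ e₁ e₂ => m s ++ e₁.collect f c m ++ e₂.collect f c m
  | .eval _ e => e.collect f c m
def Expr.collectL {β : Type} (f : Val n → List β) (c : List β) (m : ℕ → List β) :
    List (Expr n) → List β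
  | [] => []
  | e :: es => e.collect f c m ++ Expr.collectL f c m es
end

/-- The interval list `I(e)`. -/
def Expr.intvls (e : Expr n) : List Intvl :=
  e.collect Val.intvls [⟨0, 1, zero_le_one⟩] (fun _ => [])

/-- The points occurring in values of `e`. -/
def Expr.points (e : Expr n) : List ℝ := e.collect Val.points [] (fun _ => [])

/-- The mark identifiers of `e`, with multiplicity. -/
def Expr.ids (e : Expr n) : List ℕ := e.collect (fun _ => []) [] (fun s => [s])

/-! ### Types -/

inductive Ty where
  | bool | point | vltn | rdIntvl | rdPiece
  | intvl | piece
  | prod (τs : List Ty)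

/-- The non-affine types. -/
def Ty.NonAffine : Ty → Prop
  | .intvl | .piece | .prod _ => False
  | _ => True

/-- A unary product is identified with its component. -/
def Ty.mkProd : List Ty → Ty
  | [τ] => τ
  | τs => .prod τs

mutual
/-- The read-only version of a type. -/
def Ty.rd : Ty → Ty
  | .intvl => .rdIntvl
  | .piece => .rdPiece
  | .prod τs => .prod (Ty.rdL τs)
  | τ => τ
def Ty.rdL : List Ty → List Ty
  | [] => []
  | τ :: τs => τ.rd :: Ty.rdL τs
end

mutual
/-- The type of a value. -/
def Val.ty : Val n → Ty
  | .bool _ => .bool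
  | .pt _ => .point
  | .intvl _ => .intvl
  | .piece _ => .piece
  | .vltn _ => .vltn
  | .rdIntvl _ => .rdIntvl
  | .rdPiece _ => .rdPiece
  | .tup vs => .prod (Val.tyL vs)
def Val.tyL : List (Val n) → List Ty
  | [] => []
  | v :: vs => v.ty :: Val.tyL vs
end

/-- Signatures of the operations. -/
def Op.dom : Op → List Ty
  | .and | .or => [.bool, .bool]
  | .not => [.bool]
  | .ptGe => [.point, .point]
  | .vGe | .vEq | .add => [.vltn, .vltn]
  | .smul _ => [.vltn]

def Op.cod : Op → Ty
  | .add | .smul _ => .vltn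
  | _ => .bool

/-- `Δ₁` and `Δ₂` are parts of the affine context `Δ` with disjoint domains. Affine variables may
be left unused. -/
def Splits (Δ Δ₁ Δ₂ : ℕ → Option Ty) : Prop :=
  (∀ w τ, Δ₁ w = some τ → Δ w = some τ) ∧ (∀ w τ, Δ₂ w = some τ → Δ w = some τ) ∧
    ∀ w, Δ₁ w = none ∨ Δ₂ w = none

/-- Extension of the non-affine context by the variables of a `split` binder. -/
def extN (Γ : NVar → Option Ty) (xs ws : List ℕ) (τs : List Ty) : NVar → Option Ty
  | .x i => (bindX xs τs i).or (Γ (.x i))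
  | .rd w => ((bindW xs ws τs w).map Ty.rd).or (Γ (.rd w))

/-- Extension of the affine context by the variables of a `split` binder. -/
def extA (Δ : ℕ → Option Ty) (xs ws : List ℕ) (τs : List Ty) (w : ℕ) : Option Ty :=
  (bindW xs ws τs w).or (Δ w)

mutual
/-- The affine typing judgement `Γ; Δ ⊢ e : τ`. -/
inductive HasTy : (NVar → Option Ty) → (ℕ → Option Ty) → Expr n → Ty → Prop where
  | val (Γ Δ v) : HasTy Γ Δ (.val v) v.ty
  | nvar {Γ Δ x τ} : Γ x = some τ → HasTy Γ Δ (.nvar x) τ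
  | avar {Γ Δ w τ} : Δ w = some τ → HasTy Γ Δ (.avar w) τ
  | tup {Γ Δ es τs} : HasTys Γ Δ es τs → HasTy Γ Δ (.tup es) (Ty.mkProd τs)
  | split {Γ Δ Δ₁ Δ₂ xs ws e₁ e₂ τs τ} :
      Splits Δ Δ₁ Δ₂ → xs.Nodup → ws.Nodup → τs.length = xs.length + ws.length →
      (∀ σ ∈ τs.take xs.length, σ.NonAffine) →
      HasTy Γ Δ₁ e₁ (Ty.mkProd τs) → HasTy (extN Γ xs ws τs) (extA Δ₂ xs ws τs) e₂ τ →
      HasTy Γ Δ (.split xs ws e₁ e₂) τ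
  | ite {Γ Δ Δ₁ Δ₂ e₁ e₂ e₃ τ} :
      Splits Δ Δ₁ Δ₂ → HasTy Γ Δ₁ e₁ .bool → HasTy Γ Δ₂ e₂ τ → HasTy Γ Δ₂ e₃ τ →
      HasTy Γ Δ (.ite e₁ e₂ e₃) τ
  | op {Γ Δ o es} : HasTys Γ Δ es o.dom → HasTy Γ Δ (.op o es) o.cod
  | cake (Γ Δ) : HasTy Γ Δ .cake .intvl
  | div {Γ Δ e₁ e₂} : HasTys Γ Δ [e₁, e₂] [.intvl, .point] →
      HasTy Γ Δ (.div e₁ e₂) (.prod [.intvl, .intvl])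
  | piece {Γ Δ es} : HasTys Γ Δ es (List.replicate es.length .intvl) →
      HasTy Γ Δ (.piece es) .piece
  | mark {Γ Δ s a e₁ e₂} : HasTys Γ Δ [e₁, e₂] [.rdIntvl, .vltn] →
      HasTy Γ Δ (.mark s a e₁ e₂) .point
  | evalIntvl {Γ Δ a e} : HasTy Γ Δ e .rdIntvl → HasTy Γ Δ (.eval a e) .vltn
  | evalPiece {Γ Δ a e} : HasTy Γ Δ e .rdPiece → HasTy Γ Δ (.eval a e) .vltn
/-- Typing of a list of expressions, with the affine context distributed over them. -/
inductive HasTys : (NVar → Option Ty) → (ℕ → Option Ty) → List (Expr n) → List Ty → Prop where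
  | nil (Γ Δ) : HasTys Γ Δ [] []
  | cons {Γ Δ Δ₁ Δ₂ e es τ τs} : Splits Δ Δ₁ Δ₂ → HasTy Γ Δ₁ e τ → HasTys Γ Δ₂ es τs →
      HasTys Γ Δ (e :: es) (τ :: τs)
end

/-- Typing in the empty contexts; in particular the expression is closed. -/
def Expr.HasType (e : Expr n) (τ : Ty) : Prop := HasTy (fun _ => none) (fun _ => none) e τ

/-- The type `Piece^𝔸` of allocations. -/
def Ty.alloc (n : ℕ) : Ty := Ty.mkProd (List.replicate n .piece)

/-- Well-formed expressions: closed and well-typed, disjoint, without points other than `0` and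
`1`, and with a unique identifier for each mark. -/
structure Expr.WellFormed (e : Expr n) : Prop where
  typed : ∃ τ, e.HasType τ
  disjoint : e.intvls.Pairwise fun I J => Disjoint (interior I.toSet) (interior J.toSet)
  points : ∀ r ∈ e.points, r = 0 ∨ r = 1
  ids : e.ids.Nodup

/-! ### Big-step semantics -/

open Classical in
/-- The operations on values. -/
def Op.run (V : Fin n → Valuation) : Op → List (Val n) → Option (Val n)
  | .and, [.bool p, .bool q] => some (.bool (p && q))
  | .or, [.bool p, .bool q] => some (.bool (p || q))
  | .not, [.bool p] => some (.bool (!p))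
  | .ptGe, [.pt r, .pt s] => some (.bool (decide (r ≥ s)))
  | .vGe, [.vltn k, .vltn l] => some (.bool (decide (vltnEval V k ≥ vltnEval V l)))
  | .vEq, [.vltn k, .vltn l] => some (.bool (decide (vltnEval V k = vltnEval V l)))
  | .add, [.vltn k, .vltn l] => some (.vltn (k ++ l))
  | .smul r, [.vltn l] => some (.vltn (l.map fun q => (r * q.1, q.2)))
  | _, _ => none

/-- The value substituted for a non-affine variable by `xs, ws = split vs`. -/
def bindN (xs ws : List ℕ) (vs : List (Val n)) : NVar → Option (Val n)
  | .x i => bindX xs vs i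
  | .rd w => (bindW xs ws vs w).map Val.rd

mutual
/-- The evaluation relation `e ⇓_V v`. A mark reports any point `r` of the cake for which the set
`[I.lo, r]` (empty if `r < I.lo`) has the required value. -/
inductive Eval (V : Fin n → Valuation) : Expr n → Val n → Prop where
  | val (v) : Eval V (.val v) v
  | cake : Eval V .cake (.intvl ⟨0, 1, zero_le_one⟩)
  | op {o es vs v} : Evals V es vs → o.run V vs = some v → Eval V (.op o es) v
  | tup {es vs} : Evals V es vs → Eval V (.tup es) (Val.mkTup vs)
  | iteTrue {e₁ e₂ e₃ v} : Eval V e₁ (.bool true) → Eval V e₂ v → Eval V (.ite e₁ e₂ e₃) v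
  | iteFalse {e₁ e₂ e₃ v} : Eval V e₁ (.bool false) → Eval V e₃ v → Eval V (.ite e₁ e₂ e₃) v
  | split {xs ws e₁ e₂ vs v} : Eval V e₁ (Val.mkTup vs) → vs.length = xs.length + ws.length →
      Eval V (e₂.subst (bindN xs ws vs) (bindW xs ws vs)) v → Eval V (.split xs ws e₁ e₂) v
  | div {e₁ e₂ r} {I : Intvl} : Eval V e₁ (.intvl I) → Eval V e₂ (.pt r) →
      (h₁ : I.lo ≤ r) → (h₂ : r ≤ I.hi) →
      Eval V (.div e₁ e₂) (.tup [.intvl ⟨I.lo, r, h₁⟩, .intvl ⟨r, I.hi, h₂⟩])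
  | mark {s a e₁ e₂ l r} {I : Intvl} : Eval V e₁ (.rdIntvl I) → Eval V e₂ (.vltn l) →
      r ∈ Icc (0 : ℝ) 1 → (V a).toFun (Icc I.lo r) = vltnEval V l →
      Eval V (.mark s a e₁ e₂) (.pt r)
  | evalIntvl {a e I} : Eval V e (.rdIntvl I) →
      Eval V (.eval a e) (.vltn [(1, a, .intvl I)])
  | evalPiece {a e Is} : Eval V e (.rdPiece Is) →
      Eval V (.eval a e) (.vltn [(1, a, .piece Is)])
  | piece {es} {Is : List Intvl} : Evals V es (Is.map Val.intvl) →
      Eval V (.piece es) (.piece Is)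
inductive Evals (V : Fin n → Valuation) : List (Expr n) → List (Val n) → Prop where
  | nil : Evals V [] []
  | cons {e es v vs} : Eval V e v → Evals V es vs → Evals V (e :: es) (v :: vs)
end

/-! ### Paths -/

/-- Paths: expressions with `assert` in place of `ite`. -/
inductive Path (n : ℕ) where
  | val (v : Val n)
  | nvar (x : NVar)
  | avar (w : ℕ)
  | tup (bs : List (Path n))
  | split (xs ws : List ℕ) (b₁ b₂ : Path n)
  | assert (b₁ b₂ : Path n)
  | op (o : Op) (bs : List (Path n))
  | cake
  | div (b₁ b₂ : Path n)
  | piece (bs : List (Path n))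
  | mark (s : ℕ) (a : Fin n) (b₁ b₂ : Path n)
  | eval (a : Fin n) (b : Path n)

/-- All combinations of an entry of the first list with an entry of the second. -/
def combine {α β γ : Type} (f : α → β → γ) (as : List α) (bs : List β) : List γ :=
  as.flatMap fun a => bs.map (f a)

mutual
/-- The paths `B(e)` of an expression. -/
def Expr.paths : Expr n → List (Path n)
  | .val v => [.val v]
  | .nvar x => [.nvar x]
  | .avar w => [.avar w]
  | .tup es => (Expr.pathsL es).map .tup
  | .split xs ws e₁ e₂ => combine (.split xs ws) e₁.paths e₂.paths
  | .ite e₁ e₂ e₃ =>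
      combine .assert e₁.paths e₂.paths ++
        combine (fun b₁ b₃ => .assert (.op .not [b₁]) b₃) e₁.paths e₃.paths
  | .op o es => (Expr.pathsL es).map (.op o)
  | .cake => [.cake]
  | .div e₁ e₂ => combine .div e₁.paths e₂.paths
  | .piece es => (Expr.pathsL es).map .piece
  | .mark s a e₁ e₂ => combine (.mark s a) e₁.paths e₂.paths
  | .eval a e => e.paths.map (.eval a)
def Expr.pathsL : List (Expr n) → List (List (Path n))
  | [] => [[]]
  | e :: es => combine List.cons e.paths (Expr.pathsL es)
end

/-! ### The logic -/

/-- The elements `0`, `1` and `y_s` that a piecewise uniform replacement orders. -/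
inductive PtAtom where
  | zero | one
  | y (s : ℕ)
  deriving DecidableEq

/-- Logical variables: program variables, the point variables `y_s` standing for marks, and the
real variables `z_{a,p}`. -/
inductive LVar (n : ℕ) where
  | nvar (x : NVar)
  | avar (w : ℕ)
  | y (s : ℕ)
  | z (a : Fin n) (p : PtAtom)

/-- Logical terms. The symbols `op .add` and `op (.smul r)` also serve as addition and
multiplication by a constant on reals. -/
inductive Term (n : ℕ) where
  | var (v : LVar n)
  | bool (b : Bool)
  | pt (r : ℝ)
  | real (r : ℝ)
  | op (o : Op) (ts : List (Term n))
  | lft (t : Term n)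
  | rgt (t : Term n)
  | intvl (t u : Term n)
  | union (ts : List (Term n))
  | val (a : Fin n) (t : Term n)
  | tup (ts : List (Term n))
  | proj (k : ℕ) (t : Term n)

/-- Formulas; `isTrue t` is `t = true` and `all s φ` is `∀ y_s. φ`. -/
inductive Formula (n : ℕ) where
  | tru
  | fls
  | isTrue (t : Term n)
  | ge (t u : Term n)
  | eq (t u : Term n)
  | not (φ : Formula n)
  | and (φ χ : Formula n)
  | or (φ χ : Formula n)
  | imp (φ χ : Formula n)
  | all (s : ℕ) (φ : Formula n)

def Formula.conj : List (Formula n) → Formula n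
  | [] => .tru
  | φ :: φs => .and φ (Formula.conj φs)

/-- A one-component tuple is identified with its component. -/
def Term.mkTup : List (Term n) → Term n
  | [t] => t
  | ts => .tup ts

/-- The `i`-th component of a term regarded as a `k`-tuple. -/
def Term.comp (k i : ℕ) (t : Term n) : Term n := if k = 1 then t else .proj i t

def Term.add (t u : Term n) : Term n := .op .add [t, u]

def Term.smul (r : ℝ) (t : Term n) : Term n := .op (.smul r) [t]

def Term.sum : List (Term n) → Term n
  | [] => .real 0
  | t :: ts => t.add (Term.sum ts)

/-! #### Semantics of the logic -/

/-- Elements of the interpreted sorts. Points, reals and valuations are numbers, an interval is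
given by its two endpoints, a piece by a list of intervals. `err` is the denotation of ill-sorted
terms. -/
inductive Den where
  | bool (b : Bool)
  | num (r : ℝ)
  | intvl (l r : ℝ)
  | piece (l : List (ℝ × ℝ))
  | tup (ds : List Den)
  | err

def Den.getIntvl : Den → ℝ × ℝ
  | .intvl l r => (l, r)
  | _ => (0, 0)

open Classical in
def Op.den : Op → List Den → Den
  | .and, [.bool p, .bool q] => .bool (p && q)
  | .or, [.bool p, .bool q] => .bool (p || q)
  | .not, [.bool p] => .bool (!p)
  | .ptGe, [.num r, .num s] => .bool (decide (r ≥ s))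
  | .vGe, [.num r, .num s] => .bool (decide (r ≥ s))
  | .vEq, [.num r, .num s] => .bool (decide (r = s))
  | .add, [.num r, .num s] => .num (r + s)
  | .smul r, [.num s] => .num (r * s)
  | _, _ => .err

def Den.lft : Den → Den
  | .intvl l _ => .num l
  | _ => .err

def Den.rgt : Den → Den
  | .intvl _ r => .num r
  | _ => .err

def Den.mkIntvl : Den → Den → Den
  | .num l, .num r => .intvl l r
  | _, _ => .err

/-- Application of the interpretation of a symbol `val_a` to an interval or piece. -/
def Den.val (f : Set ℝ → ℝ) : Den → Den
  | .intvl l r => .num (f (Icc l r))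
  | .piece l => .num (f (⋃ p ∈ l, Icc p.1 p.2))
  | _ => .err

def Den.proj (k : ℕ) : Den → Den
  | .tup ds => ds.getD k .err
  | _ => .err

/-- Variable assignments. -/
structure Assn (n : ℕ) where
  nvar : NVar → Den
  avar : ℕ → Den
  y : ℕ → ℝ
  z : Fin n → PtAtom → ℝ

def Assn.get (α : Assn n) : LVar n → Den
  | .nvar x => α.nvar x
  | .avar w => α.avar w
  | .y s => .num (α.y s)
  | .z a p => .num (α.z a p)

mutual
/-- Denotation of a term, where `J a` interprets the symbol `val_a`. -/
def Term.den (J : Fin n → Set ℝ → ℝ) (α : Assn n) : Term n → Den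
  | .var v => α.get v
  | .bool b => .bool b
  | .pt r => .num r
  | .real r => .num r
  | .op o ts => o.den (Term.denL J α ts)
  | .lft t => (t.den J α).lft
  | .rgt t => (t.den J α).rgt
  | .intvl t u => Den.mkIntvl (t.den J α) (u.den J α)
  | .union ts => .piece ((Term.denL J α ts).map Den.getIntvl)
  | .val a t => (t.den J α).val (J a)
  | .tup ts => .tup (Term.denL J α ts)
  | .proj k t => (t.den J α).proj k
def Term.denL (J : Fin n → Set ℝ → ℝ) (α : Assn n) : List (Term n) → List Den
  | [] => []
  | t :: ts => t.den J α :: Term.denL J α ts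
end

/-- Satisfaction of a formula. -/
def Formula.Holds (J : Fin n → Set ℝ → ℝ) : Assn n → Formula n → Prop
  | _, .tru => True
  | _, .fls => False
  | α, .isTrue t => t.den J α = .bool true
  | α, .ge t u => ∃ r s : ℝ, t.den J α = .num r ∧ u.den J α = .num s ∧ r ≥ s
  | α, .eq t u => ∃ r s : ℝ, t.den J α = .num r ∧ u.den J α = .num s ∧ r = s
  | α, .not φ => ¬ φ.Holds J α
  | α, .and φ χ => φ.Holds J α ∧ χ.Holds J α
  | α, .or φ χ => φ.Holds J α ∨ χ.Holds J α
  | α, .imp φ χ => φ.Holds J α → χ.Holds J α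
  | α, .all s φ => ∀ r : ℝ, φ.Holds J { α with y := Function.update α.y s r }

/-- Truth under every interpretation of the symbols `val_a` and every assignment. -/
def Formula.Valid (φ : Formula n) : Prop := ∀ J α, φ.Holds J α

/-! #### Free variables and linear real arithmetic -/

mutual
/-- The variables `y_s` of a term. -/
def Term.ys : Term n → Finset ℕ
  | .var (.y s) => {s}
  | .var _ => ∅
  | .bool _ => ∅
  | .pt _ => ∅
  | .real _ => ∅
  | .op _ ts => Term.ysL ts
  | .lft t => t.ys
  | .rgt t => t.ys
  | .intvl t u => t.ys ∪ u.ys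
  | .union ts => Term.ysL ts
  | .val _ t => t.ys
  | .tup ts => Term.ysL ts
  | .proj _ t => t.ys
def Term.ysL : List (Term n) → Finset ℕ
  | [] => ∅
  | t :: ts => t.ys ∪ Term.ysL ts
end

/-- The free variables `y_s` of a formula. -/
def Formula.ys : Formula n → Finset ℕ
  | .tru => ∅
  | .fls => ∅
  | .isTrue t => t.ys
  | .ge t u => t.ys ∪ u.ys
  | .eq t u => t.ys ∪ u.ys
  | .not φ => φ.ys
  | .and φ χ => φ.ys ∪ χ.ys
  | .or φ χ => φ.ys ∪ χ.ys
  | .imp φ χ => φ.ys ∪ χ.ys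
  | .all s φ => φ.ys.erase s

/-- Linear terms in the variables `y_s` and `z_{a,p}`. -/
inductive Term.IsLinear : Term n → Prop where
  | y (s) : IsLinear (.var (.y s))
  | z (a p) : IsLinear (.var (.z a p))
  | pt (r) : IsLinear (.pt r)
  | real (r) : IsLinear (.real r)
  | add {t u} : IsLinear t → IsLinear u → IsLinear (.op .add [t, u])
  | smul (r) {t} : IsLinear t → IsLinear (.op (.smul r) [t])

/-- Formulas of linear real arithmetic: all atoms are comparisons of linear terms. In particular
there are no symbols `val_a` and no program variables. -/
def Formula.IsLRA : Formula n → Prop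
  | .tru => True
  | .fls => True
  | .isTrue _ => False
  | .ge t u => t.IsLinear ∧ u.IsLinear
  | .eq t u => t.IsLinear ∧ u.IsLinear
  | .not φ => φ.IsLRA
  | .and φ χ => φ.IsLRA ∧ χ.IsLRA
  | .or φ χ => φ.IsLRA ∧ χ.IsLRA
  | .imp φ χ => φ.IsLRA ∧ χ.IsLRA
  | .all _ φ => φ.IsLRA

/-! ### Constraints -/

def Intvl.toTerm (I : Intvl) : Term n := .intvl (.pt I.lo) (.pt I.hi)

def Region.toTerm : Region → Term n
  | .intvl I => I.toTerm
  | .piece Is => .union (Is.map Intvl.toTerm)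

mutual
/-- The logical term encoding a value; read-only values are encoded like the underlying values. -/
def Val.toTerm : Val n → Term n
  | .bool b => .bool b
  | .pt r => .pt r
  | .intvl I => I.toTerm
  | .piece Is => .union (Is.map Intvl.toTerm)
  | .vltn l => Term.sum (l.map fun q => (Term.val q.2.1 q.2.2.toTerm).smul q.1)
  | .rdIntvl I => I.toTerm
  | .rdPiece Is => .union (Is.map Intvl.toTerm)
  | .tup vs => .tup (Val.toTermL vs)
def Val.toTermL : List (Val n) → List (Term n)
  | [] => []
  | v :: vs => v.toTerm :: Val.toTermL vs
end

mutual
/-- Simultaneous substitution of terms for variables. -/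
def Term.subst (θ : LVar n → Option (Term n)) : Term n → Term n
  | .var v => (θ v).getD (.var v)
  | .bool b => .bool b
  | .pt r => .pt r
  | .real r => .real r
  | .op o ts => .op o (Term.substL θ ts)
  | .lft t => .lft (t.subst θ)
  | .rgt t => .rgt (t.subst θ)
  | .intvl t u => .intvl (t.subst θ) (u.subst θ)
  | .union ts => .union (Term.substL θ ts)
  | .val a t => .val a (t.subst θ)
  | .tup ts => .tup (Term.substL θ ts)
  | .proj k t => .proj k (t.subst θ)
def Term.substL (θ : LVar n → Option (Term n)) : List (Term n) → List (Term n)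
  | [] => []
  | t :: ts => t.subst θ :: Term.substL θ ts
end

/-- Applies a map to all terms of a formula. -/
def Formula.mapTerms (f : Term n → Term n) : Formula n → Formula n
  | .tru => .tru
  | .fls => .fls
  | .isTrue t => .isTrue (f t)
  | .ge t u => .ge (f t) (f u)
  | .eq t u => .eq (f t) (f u)
  | .not φ => .not (φ.mapTerms f)
  | .and φ χ => .and (φ.mapTerms f) (χ.mapTerms f)
  | .or φ χ => .or (φ.mapTerms f) (χ.mapTerms f)
  | .imp φ χ => .imp (φ.mapTerms f) (χ.mapTerms f)
  | .all s φ => .all s (φ.mapTerms f)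

/-- The substitution of the components of `t` for the variables of a `split` binder. -/
def splitSubst (xs ws : List ℕ) (t : Term n) : LVar n → Option (Term n) :=
  let k := xs.length + ws.length
  let ts := (List.range k).map fun i => t.comp k i
  fun
    | .nvar (.x i) => bindX xs ts i
    | .nvar (.rd w) => bindW xs ws ts w
    | .avar w => bindW xs ws ts w
    | _ => none

mutual
/-- The term `ρ(b)` describing the result of a path. -/
def Path.rho : Path n → Term n
  | .val v => v.toTerm
  | .nvar x => .var (.nvar x)
  | .avar w => .var (.avar w)
  | .tup bs => Term.mkTup (Path.rhoL bs)
  | .split xs ws b₁ b₂ => b₂.rho.subst (splitSubst xs ws b₁.rho)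
  | .assert _ b₂ => b₂.rho
  | .op o bs => .op o (Path.rhoL bs)
  | .cake => .intvl (.pt 0) (.pt 1)
  | .div b₁ b₂ => .tup [.intvl (.lft b₁.rho) b₂.rho, .intvl b₂.rho (.rgt b₁.rho)]
  | .piece bs => .union (Path.rhoL bs)
  | .mark s _ _ _ => .var (.y s)
  | .eval a b => .val a b.rho
def Path.rhoL : List (Path n) → List (Term n)
  | [] => []
  | b :: bs => b.rho :: Path.rhoL bs
end

mutual
/-- The constraint `c(b)` of a path. -/
def Path.constr : Path n → Formula n
  | .val _ => .tru
  | .nvar _ => .tru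
  | .avar _ => .tru
  | .tup bs => Path.constrL bs
  | .split xs ws b₁ b₂ =>
      .and b₁.constr (b₂.constr.mapTerms (Term.subst (splitSubst xs ws b₁.rho)))
  | .assert b₁ b₂ => .and (.isTrue b₁.rho) (.and b₁.constr b₂.constr)
  | .op _ bs => Path.constrL bs
  | .cake => .tru
  | .div b₁ b₂ => .and b₁.constr (.and b₂.constr
      (.and (.ge b₂.rho (.lft b₁.rho)) (.ge (.rgt b₁.rho) b₂.rho)))
  | .piece bs => Path.constrL bs
  | .mark s a b₁ b₂ => .and b₁.constr (.and b₂.constr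
      (.eq (.val a (.intvl (.lft b₁.rho) (.var (.y s)))) b₂.rho))
  | .eval _ b => b.constr
def Path.constrL : List (Path n) → Formula n
  | [] => .tru
  | b :: bs => .and b.constr (Path.constrL bs)
end

/-- The set `Y_b` of variables `y_s` of a path. -/
def Path.ys (b : Path n) : Finset ℕ := b.constr.ys ∪ b.rho.ys

/-- The formula `E(t)`: no agent `a` values the component of any `a'` above its own. -/
def envyFormula (t : Term n) : Formula n :=
  .conj ((List.finRange n).flatMap fun a => (List.finRange n).map fun a' =>
    .ge (.val a (t.comp n a)) (.val a (t.comp n a')))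

/-- `e ⊨ E(x)`: for every valuation set, every value of `e` is an envy-free allocation. -/
def Expr.EnvyFree (e : Expr n) : Prop :=
  ∀ (V : Fin n → Valuation) (v : Val n), Eval V e v →
    ∀ α : Assn n, (envyFormula v.toTerm).Holds (fun a => (V a).toFun) α

/-! ### Simplification -/

mutual
/-- The simplification `R(t)`, which computes projections of tuples and endpoints of intervals. -/
def Term.simpl : Term n → Term n
  | .var v => .var v
  | .bool b => .bool b
  | .pt r => .pt r
  | .real r => .real r
  | .op o ts => .op o (Term.simplL ts)
  | .lft t => match t.simpl with
    | .intvl u _ => u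
    | u => .lft u
  | .rgt t => match t.simpl with
    | .intvl _ u => u
    | u => .rgt u
  | .intvl t u => .intvl t.simpl u.simpl
  | .union ts => .union (Term.simplL ts)
  | .val a t => .val a t.simpl
  | .tup ts => .tup (Term.simplL ts)
  | .proj k t => match t.simpl with
    | .tup us => us.getD k (.proj k (.tup us))
    | u => .proj k u
def Term.simplL : List (Term n) → List (Term n)
  | [] => []
  | t :: ts => t.simpl :: Term.simplL ts
end

/-- The formula expressing that a simplified boolean term is true. -/
def Term.toFormula : Term n → Formula n
  | .bool true => .tru
  | .bool false => .fls
  | .op .and [t, u] => .and t.toFormula u.toFormula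
  | .op .or [t, u] => .or t.toFormula u.toFormula
  | .op .not [t] => .not t.toFormula
  | .op .ptGe [t, u] => .ge t u
  | .op .vGe [t, u] => .ge t u
  | .op .vEq [t, u] => .eq t u
  | t => .isTrue t

/-- The simplification `R(φ)`. -/
def Formula.simpl : Formula n → Formula n
  | .tru => .tru
  | .fls => .fls
  | .isTrue t => t.simpl.toFormula
  | .ge t u => .ge t.simpl u.simpl
  | .eq t u => .eq t.simpl u.simpl
  | .not φ => .not φ.simpl
  | .and φ χ => .and φ.simpl χ.simpl
  | .or φ χ => .or φ.simpl χ.simpl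
  | .imp φ χ => .imp φ.simpl χ.simpl
  | .all s φ => .all s φ.simpl

/-! ### Piecewise uniform replacements

A piecewise uniform replacement is a finite total order on a set of atoms `0`, `1`, `y_s` with
least element `0` and greatest element `1`; it is represented by the increasing list of its
elements. -/

def PtAtom.toTerm : PtAtom → Term n
  | .zero => .pt 0
  | .one => .pt 1
  | .y s => .var (.y s)

open Classical in
/-- The atom that a point term is, if any. -/
def Term.atom? : Term n → Option PtAtom
  | .pt r => if r = 0 then some .zero else if r = 1 then some .one else none
  | .var (.y s) => some (.y s)
  | _ => none

/-- Is `p` in `{p ∈ S | y < p ≤ y'}`, where `t` is the interval term `[y, y']`? -/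
def inSub (S : List PtAtom) (p : PtAtom) : Term n → Bool
  | .intvl t u => match t.atom?, u.atom? with
    | some q, some q' => decide (S.idxOf q < S.idxOf p) && decide (S.idxOf p ≤ S.idxOf q')
    | _, _ => false
  | _ => false

/-- The elements of `S|_t`, for an interval term or a union of interval terms. -/
def restrict (S : List PtAtom) : Term n → List PtAtom
  | .union ts => S.filter fun p => ts.any (inSub S p)
  | t => S.filter fun p => inSub S p t

/-- The term `p - z_{a,p}`. -/
def gap (a : Fin n) (p : PtAtom) : Term n := p.toTerm.add (Term.smul (-1) (.var (.z a p)))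

mutual
/-- Application of a piecewise uniform replacement to a simplified term: `val_a(t)` becomes the sum
of `p - z_{a,p}` over the elements `p` of `S|_t`. -/
def Term.repl (S : List PtAtom) : Term n → Term n
  | .val a t => Term.sum ((restrict S t).map (gap a))
  | .op o ts => .op o (Term.replL S ts)
  | t => t
def Term.replL (S : List PtAtom) : List (Term n) → List (Term n)
  | [] => []
  | t :: ts => t.repl S :: Term.replL S ts
end

/-- Application of a piecewise uniform replacement to a formula. -/
def Formula.repl (S : List PtAtom) (φ : Formula n) : Formula n := φ.mapTerms (Term.repl S)

/-- The conjunction `t₁ ≤ t₂ ≤ ⋯`. -/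
def chain : List (Term n) → Formula n
  | t :: u :: ts => .and (.ge u t) (chain (u :: ts))
  | _ => .tru

/-- The formula `ψ(S)`: for all agents `a, a'`, with `p₁ < ⋯ < pₖ` the elements of `S` other than
`0`, one has `0 ≤ z_{a,p₁} ≤ p₁ ≤ ⋯ ≤ z_{a,pₖ} ≤ pₖ ≤ 1` and
`∑ i, (pᵢ - z_{a,pᵢ}) = ∑ i, (pᵢ - z_{a',pᵢ})`. -/
def psi (n : ℕ) (S : List PtAtom) : Formula n :=
  let ps := S.filter fun p => p ≠ .zero
  .conj ((List.finRange n).flatMap fun a => (List.finRange n).map fun a' => .and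
    (chain (.pt 0 :: (ps.flatMap fun p => [.var (.z a p), p.toTerm]) ++ [.pt 1]))
    (.eq (Term.sum (ps.map (gap a))) (Term.sum (ps.map (gap a')))))

/-- All piecewise uniform replacements on `Y ∪ {0, 1}`. -/
def replacements (Y : Finset ℕ) : List (List PtAtom) :=
  (Y.sort (· ≤ ·)).permutations.map fun l => .zero :: l.map .y ++ [.one]

/-- `∀ y_s (s ∈ Y). φ`. -/
def Formula.allOver (Y : Finset ℕ) (φ : Formula n) : Formula n :=
  (Y.sort (· ≤ ·)).foldr .all φ

/-- The conjunction over all paths `b` of `e` and all piecewise uniform replacements `S` on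
`Y_b ∪ {0, 1}` of `∀ Y_b. S(R(c(b) ∧ ψ(S) ⇒ E(ρ(b))))`. -/
def Expr.reduced (e : Expr n) : Formula n :=
  .conj (e.paths.flatMap fun b => (replacements b.ys).map fun S =>
    .allOver b.ys
      (Formula.repl S (Formula.simpl (.imp (.and b.constr (psi n S)) (envyFormula b.rho)))))

end

end Slice

namespace Slice

open Set

variable {n : ℕ}

/-! ### Lists, binders and substitutions -/

-- A run of `e` follows a single path: the outcomes of the conditionals choose it, and the points
-- reported by the marks give values to the variables y_s. Conversely, since `e` is well typed, any
-- mark values in [0,1] that satisfy c(b) come from a run whose result is described by ρ(b). These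
-- two facts, `Expr.exists_path` and `HasTy.exists_eval`, turn envy-freeness into a statement about
-- paths: for every valuation set and all marks in [0,1], c(b) implies E(ρ(b))
-- (`Expr.EnvyFree.holds_envyFormula`, `Expr.envyFree_of_paths`).
--
-- Because 0 and 1 are the only points written in `e`, the simplification reduces every endpoint to
-- an atom 0, 1 or y_s (`Path.simplifies`). Valuations are then applied only to unions of intervals
-- between atoms, and they enter only through comparisons of homogeneous linear combinations. Fix an
-- order S of the atoms that is compatible with their values. Up to finitely many points, such a
-- union consists of cells between consecutive atoms, and finite sets have value 0, so its value is
-- a sum of values of cells (`IsGrid.value_biUnion`). Thus only the numbers V_a(cell of p) matter,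
-- and multiplying all of them by one constant c > 0, the same for all agents, changes no
-- comparison. If p - z_{a,p} equals c times the value of the cell of p, then applying S preserves
-- the truth of every formula in normal form (`Scales.holds_repl`).
--
-- It remains to match solutions of ψ(S) with valuation sets. Given valuations and marks, sort the
-- marks to obtain S, choose c so small that c V_a(cell of p) never exceeds the length of the cell,
-- and set z_{a,p} = p - c V_a(cell of p). The gaps of each agent then add up to c, so ψ(S) holds
-- (`Path.exists_holds_envyFormula`). Given a solution of ψ(S), let V_a have constant density on the
-- intervals [z_{a,p}, p]; their total length c does not depend on the agent (`Path.holds_matrix`).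
-- If c = 0 there is no such valuation, but then all gaps vanish and every envy comparison becomes 0
-- ≥ 0.
--
-- Linearity and closedness of the reduced formula are read off from the normal forms: after
-- replacement, the atoms compare points or linear combinations of gaps, and every mark that occurs
-- belongs to the quantified set Y_b.

theorem mem_combine {α β γ : Type} {f : α → β → γ} {as : List α} {bs : List β} {c : γ} :
    c ∈ combine f as bs ↔ ∃ a ∈ as, ∃ b ∈ bs, f a b = c := by
  simp [combine]

/-- The position found by a lookup depends on the keys alone. Hence a pointwise relation between two
lists of components (terms and values, types and values, types and terms) passes to whatever a
`split` binds to a given variable. -/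
theorem rel_lookup_zip {α β : Type} {R : α → β → Prop} (xs : List ℕ) {as : List α} {bs : List β}
    (h : List.Forall₂ R as bs) (i : ℕ) :
    Option.Rel R ((xs.zip as).lookup i) ((xs.zip bs).lookup i) := by
  induction h generalizing xs with
  | nil => simp
  | cons hab _ ih =>
    cases xs with
    | nil => simp
    | cons x xs =>
      by_cases hx : i = x
      · simpa [hx] using Option.Rel.some hab
      · have : (i == x) = false := by simpa using hx
        simpa [List.lookup_cons, this] using ih xs

theorem mem_of_lookup_zip {β : Type} {xs : List ℕ} {vs : List β} {i : ℕ} {v : β}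
    (h : (xs.zip vs).lookup i = some v) : i ∈ xs := by
  induction xs generalizing vs with
  | nil => simp at h
  | cons x xs ih =>
    cases vs with
    | nil => simp at h
    | cons w vs =>
      by_cases hx : i = x
      · simp [hx]
      · have hx' : (i == x) = false := by simpa using hx
        simp only [List.zip_cons_cons, List.lookup_cons, hx'] at h
        exact List.mem_cons_of_mem _ (ih h)

theorem exists_lookup_zip {β : Type} {xs : List ℕ} {vs : List β} {i : ℕ}
    (hi : i ∈ xs) (hl : xs.length ≤ vs.length) : ∃ v, (xs.zip vs).lookup i = some v := by
  induction xs generalizing vs with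
  | nil => simp at hi
  | cons x xs ih =>
    cases vs with
    | nil => simp at hl
    | cons w vs =>
      by_cases hx : i = x
      · exact ⟨w, by simp [hx]⟩
      · have hx' : (i == x) = false := by simpa using hx
        simp only [List.zip_cons_cons, List.lookup_cons, hx']
        exact ih (by simpa [hx] using hi) (by simpa using hl)

theorem bindX_rel {α β : Type} {R : α → β → Prop} (xs : List ℕ) {as : List α} {bs : List β}
    (h : List.Forall₂ R as bs) (i : ℕ) : Option.Rel R (bindX xs as i) (bindX xs bs i) :=
  rel_lookup_zip xs h i

theorem bindW_rel {α β : Type} {R : α → β → Prop} (xs ws : List ℕ) {as : List α} {bs : List β}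
    (h : List.Forall₂ R as bs) (w : ℕ) : Option.Rel R (bindW xs ws as w) (bindW xs ws bs w) :=
  rel_lookup_zip ws (List.forall₂_drop xs.length h) w

theorem bindX_eq_none {β : Type} {xs : List ℕ} {vs : List β} {i : ℕ} (hi : i ∉ xs) :
    bindX xs vs i = none :=
  Option.eq_none_iff_forall_ne_some.2 fun _ h => hi (mem_of_lookup_zip h)

theorem bindW_eq_none {β : Type} {xs ws : List ℕ} {vs : List β} {w : ℕ} (hw : w ∉ ws) :
    bindW xs ws vs w = none :=
  Option.eq_none_iff_forall_ne_some.2 fun _ h => hw (mem_of_lookup_zip h)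

theorem exists_bindX {β : Type} {xs ws : List ℕ} {vs : List β} {i : ℕ} (hi : i ∈ xs)
    (hl : vs.length = xs.length + ws.length) : ∃ v, bindX xs vs i = some v :=
  exists_lookup_zip hi (by omega)

theorem exists_bindW {β : Type} {xs ws : List ℕ} {vs : List β} {w : ℕ} (hw : w ∈ ws)
    (hl : vs.length = xs.length + ws.length) : ∃ v, bindW xs ws vs w = some v :=
  exists_lookup_zip hw (by simp; omega)

mutual
-- The first substitution takes precedence, and nothing is captured because values contain no
-- variables. Evaluating a `split` substitutes into a body that already carries an outer
-- substitution; merging the two lets inductions run over unsubstituted expressions.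
theorem Expr.subst_subst (σ σ' : NVar → Option (Val n)) (δ δ' : ℕ → Option (Val n)) :
    ∀ e : Expr n, (e.subst σ δ).subst σ' δ' =
      e.subst (fun x => (σ x).or (σ' x)) (fun w => (δ w).or (δ' w))
  | .val v => by simp [Expr.subst]
  | .nvar x => by
    simp only [Expr.subst]
    cases h : σ x <;> simp [Expr.subst]
  | .avar w => by
    simp only [Expr.subst]
    cases h : δ w <;> simp [Expr.subst]
  | .tup es => by simp [Expr.subst, Expr.substL_substL σ σ' δ δ' es]
  | .split xs ws e₁ e₂ => by
    simp only [Expr.subst, Expr.subst_subst _ _ _ _ e₁, Expr.subst_subst _ _ _ _ e₂]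
    congr 2
    · ext1 x; split_ifs <;> simp
    · ext1 x; split_ifs <;> simp
  | .ite e₁ e₂ e₃ => by
    simp [Expr.subst, Expr.subst_subst _ _ _ _ e₁, Expr.subst_subst _ _ _ _ e₂,
      Expr.subst_subst _ _ _ _ e₃]
  | .op o es => by simp [Expr.subst, Expr.substL_substL σ σ' δ δ' es]
  | .cake => by simp [Expr.subst]
  | .div e₁ e₂ => by
    simp [Expr.subst, Expr.subst_subst _ _ _ _ e₁, Expr.subst_subst _ _ _ _ e₂]
  | .piece es => by simp [Expr.subst, Expr.substL_substL σ σ' δ δ' es]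
  | .mark s a e₁ e₂ => by
    simp [Expr.subst, Expr.subst_subst _ _ _ _ e₁, Expr.subst_subst _ _ _ _ e₂]
  | .eval a e => by simp [Expr.subst, Expr.subst_subst _ _ _ _ e]
theorem Expr.substL_substL (σ σ' : NVar → Option (Val n)) (δ δ' : ℕ → Option (Val n)) :
    ∀ es : List (Expr n), Expr.substL σ' δ' (Expr.substL σ δ es) =
      Expr.substL (fun x => (σ x).or (σ' x)) (fun w => (δ w).or (δ' w)) es
  | [] => rfl
  | e :: es => by
    simp [Expr.substL, Expr.subst_subst σ σ' δ δ' e, Expr.substL_substL σ σ' δ δ' es]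
end

mutual
theorem Expr.subst_none : ∀ e : Expr n, e.subst (fun _ => none) (fun _ => none) = e
  | .val v => by simp [Expr.subst]
  | .nvar x => by simp [Expr.subst]
  | .avar w => by simp [Expr.subst]
  | .tup es => by simp [Expr.subst, Expr.substL_none es]
  | .split xs ws e₁ e₂ => by simp [Expr.subst, Expr.subst_none e₁, Expr.subst_none e₂]
  | .ite e₁ e₂ e₃ => by
    simp [Expr.subst, Expr.subst_none e₁, Expr.subst_none e₂, Expr.subst_none e₃]
  | .op o es => by simp [Expr.subst, Expr.substL_none es]
  | .cake => by simp [Expr.subst]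
  | .div e₁ e₂ => by simp [Expr.subst, Expr.subst_none e₁, Expr.subst_none e₂]
  | .piece es => by simp [Expr.subst, Expr.substL_none es]
  | .mark s a e₁ e₂ => by simp [Expr.subst, Expr.subst_none e₁, Expr.subst_none e₂]
  | .eval a e => by simp [Expr.subst, Expr.subst_none e]
theorem Expr.substL_none :
    ∀ es : List (Expr n), Expr.substL (fun _ => none) (fun _ => none) es = es
  | [] => rfl
  | e :: es => by simp [Expr.substL, Expr.subst_none e, Expr.substL_none es]
end

/-! ### Denotations of values -/

mutual
/-- The denotation of a value. -/
noncomputable def Val.den (J : Fin n → Set ℝ → ℝ) : Val n → Den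
  | .bool b => .bool b
  | .pt r => .num r
  | .intvl I => .intvl I.lo I.hi
  | .piece Is => .piece (Is.map fun I => (I.lo, I.hi))
  | .vltn l => .num (l.map fun q => q.1 * J q.2.1 q.2.2.toSet).sum
  | .rdIntvl I => .intvl I.lo I.hi
  | .rdPiece Is => .piece (Is.map fun I => (I.lo, I.hi))
  | .tup vs => .tup (Val.denL J vs)
noncomputable def Val.denL (J : Fin n → Set ℝ → ℝ) : List (Val n) → List Den
  | [] => []
  | v :: vs => v.den J :: Val.denL J vs
end

theorem Val.denL_eq_map (J : Fin n → Set ℝ → ℝ) (vs : List (Val n)) :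
    Val.denL J vs = vs.map (Val.den J) := by
  induction vs with
  | nil => rfl
  | cons v vs ih => simp [Val.denL, ih]

theorem Term.denL_eq_map (J : Fin n → Set ℝ → ℝ) (α : Assn n) (ts : List (Term n)) :
    Term.denL J α ts = ts.map (Term.den J α) := by
  induction ts with
  | nil => rfl
  | cons v vs ih => simp [Term.denL, ih]

theorem Term.den_add {J : Fin n → Set ℝ → ℝ} {α : Assn n} {t u : Term n} {r s : ℝ}
    (ht : t.den J α = .num r) (hu : u.den J α = .num s) : (t.add u).den J α = .num (r + s) := by
  simp [Term.add, Term.den, Term.denL, ht, hu, Op.den]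

theorem Term.den_smul {J : Fin n → Set ℝ → ℝ} {α : Assn n} {t : Term n} {r : ℝ} (q : ℝ)
    (ht : t.den J α = .num r) : (t.smul q).den J α = .num (q * r) := by
  simp [Term.smul, Term.den, Term.denL, ht, Op.den]

theorem den_intvl_terms (J : Fin n → Set ℝ → ℝ) (α : Assn n) (Is : List Intvl) :
    (Term.denL J α (Is.map Intvl.toTerm)).map Den.getIntvl = Is.map fun I => (I.lo, I.hi) := by
  induction Is with
  | nil => rfl
  | cons I Is ih => simpa [Term.denL, Intvl.toTerm, Term.den, Den.mkIntvl, Den.getIntvl] using ih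

theorem Region.den_val (J : Fin n → Set ℝ → ℝ) (α : Assn n) (a : Fin n) (P : Region) :
    (Term.val a P.toTerm).den J α = .num (J a P.toSet) := by
  cases P with
  | intvl I => simp [Region.toTerm, Intvl.toTerm, Term.den, Den.mkIntvl, Den.val, Region.toSet,
      Intvl.toSet]
  | piece Is =>
    simp only [Region.toTerm, Term.den, den_intvl_terms, Den.val, Region.toSet, Intvl.toSet]
    congr 2
    simp

mutual
theorem Val.den_toTerm (J : Fin n → Set ℝ → ℝ) (α : Assn n) :
    ∀ v : Val n, v.toTerm.den J α = v.den J
  | .bool _ => rfl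
  | .pt _ => rfl
  | .intvl I => by simp [Val.toTerm, Intvl.toTerm, Term.den, Val.den, Den.mkIntvl]
  | .piece Is => by simp [Val.toTerm, Term.den, Val.den, den_intvl_terms]
  | .vltn l => by
    simp only [Val.toTerm, Val.den]
    induction l with
    | nil => rfl
    | cons q l ih =>
      simpa [Term.sum] using Term.den_add (Term.den_smul q.1 (Region.den_val J α q.2.1 q.2.2)) ih
  | .rdIntvl I => by simp [Val.toTerm, Intvl.toTerm, Term.den, Val.den, Den.mkIntvl]
  | .rdPiece Is => by simp [Val.toTerm, Term.den, Val.den, den_intvl_terms]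
  | .tup vs => by simp [Val.toTerm, Term.den, Val.den, Val.denL_toTermL J α vs]
theorem Val.denL_toTermL (J : Fin n → Set ℝ → ℝ) (α : Assn n) :
    ∀ vs : List (Val n), Term.denL J α (Val.toTermL vs) = Val.denL J vs
  | [] => rfl
  | v :: vs => by simp [Val.toTermL, Term.denL, Val.denL, Val.den_toTerm J α v,
      Val.denL_toTermL J α vs]
end

mutual
theorem Val.den_rd (J : Fin n → Set ℝ → ℝ) : ∀ v : Val n, v.rd.den J = v.den J
  | .bool _ => rfl
  | .pt _ => rfl
  | .intvl _ => rfl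
  | .piece _ => rfl
  | .vltn _ => rfl
  | .rdIntvl _ => rfl
  | .rdPiece _ => rfl
  | .tup vs => by simp [Val.rd, Val.den, Val.denL_rdL J vs]
theorem Val.denL_rdL (J : Fin n → Set ℝ → ℝ) :
    ∀ vs : List (Val n), Val.denL J (Val.rdL vs) = Val.denL J vs
  | [] => rfl
  | v :: vs => by simp [Val.rdL, Val.denL, Val.den_rd J v, Val.denL_rdL J vs]
end

mutual
theorem Val.ty_rd : ∀ v : Val n, v.rd.ty = v.ty.rd
  | .bool _ => rfl
  | .pt _ => rfl
  | .intvl _ => rfl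
  | .piece _ => rfl
  | .vltn _ => rfl
  | .rdIntvl _ => rfl
  | .rdPiece _ => rfl
  | .tup vs => by simp [Val.rd, Val.ty, Ty.rd, Val.tyL_rdL vs]
theorem Val.tyL_rdL : ∀ vs : List (Val n), Val.tyL (Val.rdL vs) = Ty.rdL (Val.tyL vs)
  | [] => rfl
  | v :: vs => by simp [Val.rdL, Val.tyL, Ty.rdL, Val.ty_rd v, Val.tyL_rdL vs]
end

theorem Val.tyL_eq_map (vs : List (Val n)) : Val.tyL vs = vs.map Val.ty := by
  induction vs with
  | nil => rfl
  | cons v vs ih => simp [Val.tyL, ih]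

/-- Concatenation of formal sums becomes addition of numbers, and a constant factor is pulled out of
the sum. -/
theorem Op.den_of_run {V : Fin n → Valuation} {o : Op} {vs : List (Val n)} {v : Val n}
    (h : o.run V vs = some v) :
    o.den (Val.denL (fun a => (V a).toFun) vs) = v.den fun a => (V a).toFun := by
  unfold Op.run at h
  split at h <;> simp only [Option.some.injEq, reduceCtorEq] at h <;> subst h <;>
    simp [Val.denL, Val.den, Op.den, vltnEval, List.map_map, Function.comp_def, mul_assoc,
      List.sum_map_mul_left]
  exact decide_eq_decide.2 Iff.rfl

/-- Progress for the operations: the type of a value determines its constructor. -/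
theorem Op.exists_run (V : Fin n → Valuation) {o : Op} {vs : List (Val n)}
    (h : Val.tyL vs = o.dom) : ∃ v, o.run V vs = some v ∧ v.ty = o.cod := by
  have canon_bool : ∀ v : Val n, v.ty = .bool → ∃ b, v = .bool b := by
    intro v; cases v <;> simp [Val.ty]
  have canon_pt : ∀ v : Val n, v.ty = .point → ∃ b, v = .pt b := by
    intro v; cases v <;> simp [Val.ty]
  have canon_vltn : ∀ v : Val n, v.ty = .vltn → ∃ b, v = .vltn b := by
    intro v; cases v <;> simp [Val.ty]
  rw [Val.tyL_eq_map] at h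
  rcases vs with _ | ⟨v, _ | ⟨w, _ | ⟨u, vs⟩⟩⟩ <;> cases o <;> simp [Op.dom] at h
  case cons.nil.not => 
    obtain ⟨b, rfl⟩ := canon_bool _ h; exact ⟨_, rfl, rfl⟩
  case cons.nil.smul => 
    obtain ⟨b, rfl⟩ := canon_vltn _ h; exact ⟨_, rfl, rfl⟩
  all_goals 
    obtain ⟨h₁, h₂⟩ := h
    first
    | obtain ⟨b, rfl⟩ := canon_bool _ h₁; obtain ⟨c, rfl⟩ := canon_bool _ h₂; exact ⟨_, rfl, rfl⟩
    | obtain ⟨b, rfl⟩ := canon_pt _ h₁; obtain ⟨c, rfl⟩ := canon_pt _ h₂; exact ⟨_, rfl, rfl⟩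
    | obtain ⟨b, rfl⟩ := canon_vltn _ h₁; obtain ⟨c, rfl⟩ := canon_vltn _ h₂; exact ⟨_, rfl, rfl⟩

/-! ### Substitution in the logic -/

/-- The assignment that gives each variable the denotation of the term substituted for it. -/
noncomputable def Assn.extend (J : Fin n → Set ℝ → ℝ) (θ : LVar n → Option (Term n)) (α : Assn n) : Assn n where
  nvar x := ((θ (.nvar x)).map (Term.den J α)).getD (α.nvar x)
  avar w := ((θ (.avar w)).map (Term.den J α)).getD (α.avar w)
  y := α.y
  z := α.z

mutual
-- Syntactic substitution amounts to a change of assignment. The hypotheses on `θ` are there because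
-- `Assn.extend` leaves the marks and the variables `z` as they are.
theorem Term.den_subst (J : Fin n → Set ℝ → ℝ) (α : Assn n) {θ : LVar n → Option (Term n)}
    (hy : ∀ s, θ (.y s) = none) (hz : ∀ a p, θ (.z a p) = none) :
    ∀ t : Term n, (t.subst θ).den J α = t.den J (α.extend J θ)
  | .var (.nvar x) => by
    simp only [Term.subst, Term.den, Assn.get, Assn.extend]; cases θ (.nvar x) <;> rfl
  | .var (.avar x) => by
    simp only [Term.subst, Term.den, Assn.get, Assn.extend]; cases θ (.avar x) <;> rfl
  | .var (.y s) => by simp [Term.subst, Term.den, Assn.get, Assn.extend, hy]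
  | .var (.z a p) => by simp [Term.subst, Term.den, Assn.get, Assn.extend, hz]
  | .bool _ => rfl
  | .pt _ => rfl
  | .real _ => rfl
  | .op o ts => by simp [Term.subst, Term.den, Term.denL_substL J α hy hz ts]
  | .lft t => by simp [Term.subst, Term.den, Term.den_subst J α hy hz t]
  | .rgt t => by simp [Term.subst, Term.den, Term.den_subst J α hy hz t]
  | .intvl t u => by
    simp [Term.subst, Term.den, Term.den_subst J α hy hz t, Term.den_subst J α hy hz u]
  | .union ts => by simp [Term.subst, Term.den, Term.denL_substL J α hy hz ts]
  | .val a t => by simp [Term.subst, Term.den, Term.den_subst J α hy hz t]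
  | .tup ts => by simp [Term.subst, Term.den, Term.denL_substL J α hy hz ts]
  | .proj k t => by simp [Term.subst, Term.den, Term.den_subst J α hy hz t]
theorem Term.denL_substL (J : Fin n → Set ℝ → ℝ) (α : Assn n) {θ : LVar n → Option (Term n)}
    (hy : ∀ s, θ (.y s) = none) (hz : ∀ a p, θ (.z a p) = none) :
    ∀ ts : List (Term n), Term.denL J α (Term.substL θ ts) = Term.denL J (α.extend J θ) ts
  | [] => rfl
  | t :: ts => by
    simp [Term.substL, Term.denL, Term.den_subst J α hy hz t, Term.denL_substL J α hy hz ts]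
end

/-- Quantifier-free formulas. -/
def Formula.IsQF : Formula n → Prop
  | .not φ => φ.IsQF
  | .and φ χ => φ.IsQF ∧ χ.IsQF
  | .or φ χ => φ.IsQF ∧ χ.IsQF
  | .imp φ χ => φ.IsQF ∧ χ.IsQF
  | .all _ _ => False
  | _ => True

theorem Formula.IsQF.mapTerms {f : Term n → Term n} {φ : Formula n} (h : φ.IsQF) :
    (φ.mapTerms f).IsQF := by
  induction φ <;> simp_all [Formula.IsQF, Formula.mapTerms]

/-- Restricted to quantifier-free formulas, since `mapTerms` does not rename bound marks and could
capture one occurring in a substituted term. -/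
theorem Formula.holds_subst (J : Fin n → Set ℝ → ℝ) (α : Assn n) {θ : LVar n → Option (Term n)}
    (hy : ∀ s, θ (.y s) = none) (hz : ∀ a p, θ (.z a p) = none) {φ : Formula n} (h : φ.IsQF) :
    (φ.mapTerms (Term.subst θ)).Holds J α ↔ φ.Holds J (α.extend J θ) := by
  induction φ <;> simp_all [Formula.IsQF, Formula.mapTerms, Formula.Holds, Term.den_subst J α hy hz]

mutual
theorem Path.isQF_constr : ∀ b : Path n, b.constr.IsQF
  | .val _ => by simp [Path.constr, Formula.IsQF]
  | .nvar _ => by simp [Path.constr, Formula.IsQF]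
  | .avar _ => by simp [Path.constr, Formula.IsQF]
  | .tup bs => by simp [Path.constr, Path.isQF_constrL bs]
  | .split xs ws b₁ b₂ => by
    simp [Path.constr, Formula.IsQF, Path.isQF_constr b₁, (Path.isQF_constr b₂).mapTerms]
  | .assert b₁ b₂ => by
    simp [Path.constr, Formula.IsQF, Path.isQF_constr b₁, Path.isQF_constr b₂]
  | .op _ bs => by simp [Path.constr, Path.isQF_constrL bs]
  | .cake => by simp [Path.constr, Formula.IsQF]
  | .div b₁ b₂ => by
    simp [Path.constr, Formula.IsQF, Path.isQF_constr b₁, Path.isQF_constr b₂]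
  | .piece bs => by simp [Path.constr, Path.isQF_constrL bs]
  | .mark s a b₁ b₂ => by
    simp [Path.constr, Formula.IsQF, Path.isQF_constr b₁, Path.isQF_constr b₂]
  | .eval _ b => by simp [Path.constr, Path.isQF_constr b]
theorem Path.isQF_constrL : ∀ bs : List (Path n), (Path.constrL bs).IsQF
  | [] => by simp [Path.constrL, Formula.IsQF]
  | b :: bs => by simp [Path.constrL, Formula.IsQF, Path.isQF_constr b, Path.isQF_constrL bs]
end

@[simp] theorem splitSubst_y (xs ws : List ℕ) (t : Term n) (s : ℕ) :
    splitSubst xs ws t (.y s) = none := rfl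

@[simp] theorem splitSubst_z (xs ws : List ℕ) (t : Term n) (a : Fin n) (p : PtAtom) :
    splitSubst xs ws t (.z a p) = none := rfl

/-- The terms substituted for the variables of a `split` binder. -/
def Term.comps (k : ℕ) (t : Term n) : List (Term n) := (List.range k).map fun i => t.comp k i

/-- The case of length one is separate because a one-component tuple is its component: `comp` is
then the identity, and otherwise a genuine projection. -/
theorem Term.den_comps (J : Fin n → Set ℝ → ℝ) (α : Assn n) {t : Term n} {vs : List (Val n)}
    (h : t.den J α = (Val.mkTup vs).den J) :
    List.Forall₂ (fun u v => Term.den J α u = Val.den J v) (t.comps vs.length) vs := by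
  by_cases hk : vs.length = 1
  · obtain ⟨v, rfl⟩ := List.length_eq_one_iff.1 hk
    simpa [Term.comps, Term.comp, Val.mkTup] using h
  · have : Val.mkTup vs = .tup vs := by
      unfold Val.mkTup; split
      · simp at hk
      · rfl
    rw [this, Val.den, Val.denL_eq_map] at h
    rw [List.forall₂_iff_get]
    refine ⟨by simp [Term.comps], fun i h₁ h₂ => ?_⟩
    simp [Term.comps, Term.comp, hk, Term.den, h, Den.proj, h₂]

theorem Path.holds_constr_split (J : Fin n → Set ℝ → ℝ) (α : Assn n) (xs ws : List ℕ)
    (b₁ b₂ : Path n) :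
    (Path.split xs ws b₁ b₂).constr.Holds J α ↔ b₁.constr.Holds J α ∧
      b₂.constr.Holds J (α.extend J (splitSubst xs ws b₁.rho)) := by
  simp only [Path.constr, Formula.Holds]
  rw [Formula.holds_subst J α (fun _ => rfl) (fun _ _ => rfl) b₂.isQF_constr]

theorem Path.den_rho_split (J : Fin n → Set ℝ → ℝ) (α : Assn n) (xs ws : List ℕ)
    (b₁ b₂ : Path n) :
    (Path.split xs ws b₁ b₂).rho.den J α =
      b₂.rho.den J (α.extend J (splitSubst xs ws b₁.rho)) := by
  rw [Path.rho, Term.den_subst J α (fun _ => rfl) (fun _ _ => rfl)]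

/-! ### Evaluations follow paths -/

/-- The interpretation of the symbols `val_a` by a valuation set. -/
def interp (V : Fin n → Valuation) (a : Fin n) : Set ℝ → ℝ := (V a).toFun

/-- The assignment gives the substituted variables their values. -/
def Assn.Agrees (J : Fin n → Set ℝ → ℝ) (σ : NVar → Option (Val n)) (δ : ℕ → Option (Val n))
    (α : Assn n) : Prop :=
  (∀ x v, σ x = some v → α.nvar x = v.den J) ∧ ∀ w v, δ w = some v → α.avar w = v.den J

/-- `P` holds for all marks that agree with some fixed points of the cake on the identifiers
in `l`. -/
def Realizes (l : List ℕ) (P : (ℕ → ℝ) → Prop) : Prop :=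
  ∃ f : ℕ → ℝ, (∀ s, f s ∈ Icc (0 : ℝ) 1) ∧ ∀ y, (∀ s ∈ l, y s = f s) → P y

theorem Realizes.of_forall {l : List ℕ} {P : (ℕ → ℝ) → Prop} (h : ∀ y, P y) : Realizes l P :=
  ⟨fun _ => 0, fun _ => by simp, fun y _ => h y⟩

theorem Realizes.imp {l : List ℕ} {P Q : (ℕ → ℝ) → Prop} (h : Realizes l P)
    (hPQ : ∀ y, P y → Q y) : Realizes l Q :=
  Exists.imp (fun _ hf => ⟨hf.1, fun y hy => hPQ y (hf.2 y hy)⟩) h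

theorem Realizes.mono {l l' : List ℕ} {P : (ℕ → ℝ) → Prop} (h : Realizes l P) (hl : l ⊆ l') :
    Realizes l' P :=
  Exists.imp (fun _ hf => ⟨hf.1, fun y hy => hf.2 y fun s hs => hy s (hl hs)⟩) h

/-- Marks found separately for two subexpressions are glued along their identifiers. This is the
point where distinctness of the identifiers is used. -/
theorem Realizes.and {l l' : List ℕ} {P Q : (ℕ → ℝ) → Prop} (h : Realizes l P)
    (h' : Realizes l' Q) (hl : l.Disjoint l') : Realizes (l ++ l') fun y => P y ∧ Q y := by
  obtain ⟨f, hf, hP⟩ := h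
  obtain ⟨g, hg, hQ⟩ := h'
  refine ⟨fun s => if s ∈ l then f s else g s, fun s => ?_, fun y hy => ⟨hP y fun s hs => ?_,
    hQ y fun s hs => ?_⟩⟩
  · dsimp only; split_ifs
    exacts [hf s, hg s]
  · rw [hy s (by simp [hs])]
    exact if_pos hs
  · rw [hy s (by simp [hs])]
    exact if_neg fun h => hl h hs

/-- The result of the path `b` is `v`, whatever the other variables are. -/
def Path.Yields (V : Fin n → Valuation) (σ : NVar → Option (Val n)) (δ : ℕ → Option (Val n))
    (b : Path n) (v : Val n) (y : ℕ → ℝ) : Prop :=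
  ∀ α : Assn n, α.y = y → α.Agrees (interp V) σ δ →
    b.constr.Holds (interp V) α ∧ b.rho.den (interp V) α = v.den (interp V)

/-- The results of the paths `bs` are `vs`, whatever the other variables are. -/
def Path.YieldsL (V : Fin n → Valuation) (σ : NVar → Option (Val n)) (δ : ℕ → Option (Val n))
    (bs : List (Path n)) (vs : List (Val n)) (y : ℕ → ℝ) : Prop :=
  ∀ α : Assn n, α.y = y → α.Agrees (interp V) σ δ →
    (Path.constrL bs).Holds (interp V) α ∧
      Term.denL (interp V) α (Path.rhoL bs) = Val.denL (interp V) vs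

/-- The mark identifiers of a list of expressions. -/
def Expr.idsL (es : List (Expr n)) : List ℕ :=
  Expr.collectL (fun _ => []) [] (fun s => [s]) es

theorem Term.den_mkTup {J : Fin n → Set ℝ → ℝ} {α : Assn n} {ts : List (Term n)}
    {vs : List (Val n)} (h : Term.denL J α ts = Val.denL J vs) :
    (Term.mkTup ts).den J α = (Val.mkTup vs).den J := by
  rcases ts with _ | ⟨t, _ | ⟨u, ts⟩⟩ <;> rcases vs with _ | ⟨v, _ | ⟨w, vs⟩⟩ <;>
    simp_all [Term.denL, Val.denL, Term.mkTup, Val.mkTup, Term.den, Val.den]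

/-- Bound variables are removed from the outer substitution and receive the components instead. The
copy `rd w` is replaced by the same term as `w` although its value is a read-only one; this is
consistent because both values have the same denotation. -/
theorem Assn.Agrees.split {J : Fin n → Set ℝ → ℝ} {σ : NVar → Option (Val n)}
    {δ : ℕ → Option (Val n)} {α : Assn n} (h : α.Agrees J σ δ) {xs ws : List ℕ}
    {vs : List (Val n)} (hl : vs.length = xs.length + ws.length) {t : Term n}
    (ht : t.den J α = (Val.mkTup vs).den J) :
    (α.extend J (splitSubst xs ws t)).Agrees J
      (fun x => (if bindsN xs ws x then none else σ x).or (bindN xs ws vs x))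
      (fun w => (if ws.contains w then none else δ w).or (bindW xs ws vs w)) := by
  have hcomps := Term.den_comps J α ht
  rw [hl] at hcomps
  have hW := bindW_rel xs ws hcomps
  have hX := bindX_rel xs hcomps
  constructor
  · rintro (i | w) v hv
    · by_cases hi : i ∈ xs
      · simp only [bindsN, List.contains_eq_mem, hi, decide_true, if_true, Option.none_or,
          bindN] at hv
        have := hX i
        rw [hv] at this
        simp only [Assn.extend, splitSubst]
        rcases hb : bindX xs (Term.comps (xs.length + ws.length) t) i with _ | u
        · rw [hb] at this; cases this
        · rw [hb] at this
          cases this with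
          | some h' => simpa [Term.comps] using by rw [Term.comps] at hb; simp [hb, h']
      · simp only [bindsN, List.contains_eq_mem, hi, decide_false, bindN,
          bindX_eq_none hi, Option.or_none] at hv
        simpa [Assn.extend, splitSubst, bindX_eq_none hi] using h.1 _ v hv
    · by_cases hi : w ∈ ws
      · simp only [bindsN, List.contains_eq_mem, hi, decide_true, if_true, Option.none_or,
          bindN] at hv
        have := hW w
        simp only [Assn.extend, splitSubst]
        rcases hb : bindW xs ws (Term.comps (xs.length + ws.length) t) w with _ | u
        · rw [hb] at this
          cases hc : bindW xs ws vs w with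
          | none => simp [hc] at hv
          | some _ => rw [hc] at this; cases this
        · rw [hb] at this
          cases hc : bindW xs ws vs w with
          | none => simp [hc] at hv
          | some v' =>
            rw [hc] at this hv
            obtain rfl : v'.rd = v := by simpa using hv
            cases this with
            | some h' => rw [Term.comps] at hb; simp [hb, h', Val.den_rd]
      · simp only [bindsN, List.contains_eq_mem, hi, decide_false, bindN,
          bindW_eq_none hi, Option.map_none, Option.or_none] at hv
        simpa [Assn.extend, splitSubst, bindW_eq_none hi] using h.1 _ v hv
  · intro w v hv
    by_cases hi : w ∈ ws
    · simp only [List.contains_eq_mem, hi, decide_true, if_true, Option.none_or] at hv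
      have := hW w
      rw [hv] at this
      simp only [Assn.extend, splitSubst]
      rcases hb : bindW xs ws (Term.comps (xs.length + ws.length) t) w with _ | u
      · rw [hb] at this; cases this
      · rw [hb] at this
        cases this with
        | some h' => rw [Term.comps] at hb; simp [hb, h']
    · simp only [List.contains_eq_mem, hi, decide_false, bindW_eq_none hi, Option.or_none] at hv
      simpa [Assn.extend, splitSubst, bindW_eq_none hi] using h.2 _ v hv

mutual
-- The branches taken by the evaluation select the path, and the points reported by its marks
-- realize the variables y_s. The claim concerns all `y` that agree with these points on the
-- identifiers of `e`, so that the marks chosen for several subexpressions can be combined. It is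
-- stated for substituted expressions to get through the body of a `split`.
theorem Expr.exists_path (V : Fin n → Valuation) : ∀ (e : Expr n) (σ : NVar → Option (Val n))
    (δ : ℕ → Option (Val n)) (v : Val n), e.ids.Nodup → Eval V (e.subst σ δ) v →
    ∃ b ∈ e.paths, Realizes e.ids (b.Yields V σ δ v)
  | .val v, σ, δ, _, _, h => by
    rw [Expr.subst] at h
    cases h
    exact ⟨.val v, by simp [Expr.paths], .of_forall fun y α _ _ =>
      ⟨trivial, Val.den_toTerm _ _ _⟩⟩
  | .nvar x, σ, δ, v, _, h => by
    rw [Expr.subst] at h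
    cases hx : σ x with
    | none => rw [hx] at h; cases h
    | some v' =>
      rw [hx] at h
      cases h
      exact ⟨.nvar x, by simp [Expr.paths], .of_forall fun y α _ hα => ⟨trivial, hα.1 _ _ hx⟩⟩
  | .avar w, σ, δ, v, _, h => by
    rw [Expr.subst] at h
    cases hx : δ w with
    | none => rw [hx] at h; cases h
    | some v' =>
      rw [hx] at h
      cases h
      exact ⟨.avar w, by simp [Expr.paths], .of_forall fun y α _ hα => ⟨trivial, hα.2 _ _ hx⟩⟩
  | .tup es, σ, δ, v, hn, h => by
    rw [Expr.subst] at h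
    cases h with
    | tup h =>
      obtain ⟨bs, hbs, hr⟩ := Expr.exists_pathL V es σ δ _ hn h
      exact ⟨.tup bs, by simpa [Expr.paths] using hbs, hr.imp fun y hy α hα hα' =>
        ⟨(hy α hα hα').1, Term.den_mkTup (hy α hα hα').2⟩⟩
  | .split xs ws e₁ e₂, σ, δ, v, hn, h => by
    rw [Expr.subst] at h
    cases h with
    | split h₁ hl h₂ =>
      -- With the two substitutions merged, the induction hypothesis applies to `e₂` itself.
      rw [Expr.subst_subst] at h₂
      obtain ⟨hn₁, hn₂, hd⟩ := List.nodup_append'.1 hn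
      obtain ⟨b₁, hb₁, hr₁⟩ := Expr.exists_path V e₁ σ δ _ hn₁ h₁
      obtain ⟨b₂, hb₂, hr₂⟩ := Expr.exists_path V e₂ _ _ _ hn₂ h₂
      refine ⟨.split xs ws b₁ b₂, by simp [Expr.paths, mem_combine, hb₁, hb₂],
        (hr₁.and hr₂ hd).imp fun y hy α hα hα' => ?_⟩
      obtain ⟨hc₁, hv₁⟩ := hy.1 α hα hα'
      rw [Path.holds_constr_split, Path.den_rho_split]
      obtain ⟨hc₂, hv₂⟩ := hy.2 (α.extend (interp V) (splitSubst xs ws b₁.rho)) hα (hα'.split hl hv₁)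
      exact ⟨⟨hc₁, hc₂⟩, hv₂⟩
  | .ite e₁ e₂ e₃, σ, δ, v, hn, h => by
    rw [Expr.subst] at h
    obtain ⟨hn₁₂, hn₃, hd₃⟩ := List.nodup_append'.1 hn
    obtain ⟨hn₁, hn₂, hd₂⟩ := List.nodup_append'.1 hn₁₂
    cases h with
    | iteTrue h₁ h₂ =>
      obtain ⟨b₁, hb₁, hr₁⟩ := Expr.exists_path V e₁ σ δ _ hn₁ h₁
      obtain ⟨b₂, hb₂, hr₂⟩ := Expr.exists_path V e₂ _ _ _ hn₂ h₂
      refine ⟨.assert b₁ b₂, by simp [Expr.paths, mem_combine, hb₁, hb₂],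
        ((hr₁.and hr₂ hd₂).mono (List.subset_append_left _ _)).imp fun y hy α hα hα' => ?_⟩
      obtain ⟨hc₁, hv₁⟩ := hy.1 α hα hα'
      obtain ⟨hc₂, hv₂⟩ := hy.2 α hα hα'
      exact ⟨⟨hv₁, hc₁, hc₂⟩, hv₂⟩
    | iteFalse h₁ h₂ =>
      obtain ⟨b₁, hb₁, hr₁⟩ := Expr.exists_path V e₁ σ δ _ hn₁ h₁
      obtain ⟨b₂, hb₂, hr₂⟩ := Expr.exists_path V e₃ _ _ _ hn₃ h₂
      refine ⟨.assert (.op .not [b₁]) b₂, by simp [Expr.paths, mem_combine, hb₁, hb₂],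
        ((hr₁.and hr₂ fun s hs hs' => hd₃ (List.mem_append_left _ hs) hs').mono ?_).imp
          fun y hy α hα hα' => ?_⟩
      -- The identifiers of the branch not taken lie between those used; they remain unconstrained.
      · exact List.append_subset.2 ⟨fun s hs => List.mem_append_left _ (List.mem_append_left _ hs),
          List.subset_append_right _ _⟩
      obtain ⟨hc₁, hv₁⟩ := hy.1 α hα hα'
      obtain ⟨hc₂, hv₂⟩ := hy.2 α hα hα'
      refine ⟨⟨?_, ⟨hc₁, trivial⟩, hc₂⟩, hv₂⟩
      simp [Formula.Holds, Path.rho, Path.rhoL, Term.den, Term.denL, hv₁, Val.den, Op.den]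
  | .op o es, σ, δ, v, hn, h => by
    rw [Expr.subst] at h
    cases h with
    | op h ho =>
      obtain ⟨bs, hbs, hr⟩ := Expr.exists_pathL V es σ δ _ hn h
      refine ⟨.op o bs, by simpa [Expr.paths] using hbs, hr.imp fun y hy α hα hα' =>
        ⟨(hy α hα hα').1, ?_⟩⟩
      rw [Path.rho, Term.den, (hy α hα hα').2]
      exact Op.den_of_run ho
  | .cake, σ, δ, v, _, h => by
    rw [Expr.subst] at h
    cases h
    exact ⟨.cake, by simp [Expr.paths], .of_forall fun y α _ _ => ⟨trivial, rfl⟩⟩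
  | .div e₁ e₂, σ, δ, v, hn, h => by
    rw [Expr.subst] at h
    obtain ⟨hn₁, hn₂, hd⟩ := List.nodup_append'.1 hn
    cases h with
    | div h₁ h₂ hle hle' =>
      obtain ⟨b₁, hb₁, hr₁⟩ := Expr.exists_path V e₁ σ δ _ hn₁ h₁
      obtain ⟨b₂, hb₂, hr₂⟩ := Expr.exists_path V e₂ _ _ _ hn₂ h₂
      refine ⟨.div b₁ b₂, by simp [Expr.paths, mem_combine, hb₁, hb₂],
        (hr₁.and hr₂ hd).imp fun y hy α hα hα' => ?_⟩
      obtain ⟨hc₁, hv₁⟩ := hy.1 α hα hα'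
      obtain ⟨hc₂, hv₂⟩ := hy.2 α hα hα'
      refine ⟨⟨hc₁, hc₂, ?_, ?_⟩, ?_⟩
      · simpa [Formula.Holds, Term.den, hv₁, hv₂, Val.den, Den.lft] using hle
      · simpa [Formula.Holds, Term.den, hv₁, hv₂, Val.den, Den.rgt] using hle'
      · simp [Path.rho, Term.den, Term.denL, hv₁, hv₂, Val.den, Val.denL, Den.lft, Den.rgt,
          Den.mkIntvl]
  | .piece es, σ, δ, v, hn, h => by
    rw [Expr.subst] at h
    cases h with
    | @piece _ Is h =>
      obtain ⟨bs, hbs, hr⟩ := Expr.exists_pathL V es σ δ _ hn h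
      refine ⟨.piece bs, by simpa [Expr.paths] using hbs, hr.imp fun y hy α hα hα' =>
        ⟨(hy α hα hα').1, ?_⟩⟩
      rw [Path.rho, Term.den, (hy α hα hα').2]
      simp [Val.denL_eq_map, Val.den, Function.comp_def, Den.getIntvl]
  | .mark s a e₁ e₂, σ, δ, v, hn, h => by
    rw [Expr.subst] at h
    obtain ⟨hns, hn₂, hd₂⟩ := List.nodup_append'.1 hn
    obtain ⟨-, hn₁, hd₁⟩ := List.nodup_append'.1 hns
    cases h with
    | @mark _ _ _ _ l r I h₁ h₂ hr hval =>
      obtain ⟨b₁, hb₁, hr₁⟩ := Expr.exists_path V e₁ σ δ _ hn₁ h₁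
      obtain ⟨b₂, hb₂, hr₂⟩ := Expr.exists_path V e₂ _ _ _ hn₂ h₂
      -- The reported point is the value of y_s; it lies in the cake by the evaluation rule for
      -- marks.
      have hr₀ : Realizes [s] fun y => y s = r :=
        ⟨fun _ => r, fun _ => hr, fun y hy => hy s (by simp)⟩
      refine ⟨.mark s a b₁ b₂, by simp [Expr.paths, mem_combine, hb₁, hb₂],
        ((hr₀.and hr₁ hd₁).and hr₂ hd₂).imp fun y hy α hα hα' => ?_⟩
      obtain ⟨⟨hy₀, hy₁⟩, hy₂⟩ := hy
      obtain ⟨hc₁, hv₁⟩ := hy₁ α hα hα'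
      obtain ⟨hc₂, hv₂⟩ := hy₂ α hα hα'
      subst hα
      refine ⟨⟨hc₁, hc₂, ?_⟩, ?_⟩
      · simp only [Formula.Holds, Term.den, hv₁, hv₂, Val.den, Den.lft, Assn.get, hy₀,
          Den.mkIntvl, Den.val]
        exact ⟨_, _, rfl, rfl, hval⟩
      · simp [Path.rho, Term.den, Assn.get, hy₀, Val.den]
  | .eval a e, σ, δ, v, hn, h => by
    rw [Expr.subst] at h
    cases h with
    | evalIntvl h =>
      obtain ⟨b, hb, hr⟩ := Expr.exists_path V e σ δ _ hn h
      refine ⟨.eval a b, by simpa [Expr.paths] using hb, hr.imp fun y hy α hα hα' =>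
        ⟨(hy α hα hα').1, ?_⟩⟩
      rw [Path.rho, Term.den, (hy α hα hα').2]
      simp [Val.den, Den.val, Region.toSet, Intvl.toSet]
    | evalPiece h =>
      obtain ⟨b, hb, hr⟩ := Expr.exists_path V e σ δ _ hn h
      refine ⟨.eval a b, by simpa [Expr.paths] using hb, hr.imp fun y hy α hα hα' =>
        ⟨(hy α hα hα').1, ?_⟩⟩
      rw [Path.rho, Term.den, (hy α hα hα').2]
      simp [Val.den, Den.val, Region.toSet, Intvl.toSet]
theorem Expr.exists_pathL (V : Fin n → Valuation) :
    ∀ (es : List (Expr n)) (σ : NVar → Option (Val n))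
    (δ : ℕ → Option (Val n)) (vs : List (Val n)), (Expr.idsL es).Nodup →
    Evals V (Expr.substL σ δ es) vs →
    ∃ bs ∈ Expr.pathsL es, Realizes (Expr.idsL es) (Path.YieldsL V σ δ bs vs)
  | [], σ, δ, vs, _, h => by
    rw [Expr.substL] at h
    cases h
    exact ⟨[], by simp [Expr.pathsL], .of_forall fun y α _ _ => ⟨trivial, rfl⟩⟩
  | e :: es, σ, δ, vs, hn, h => by
    rw [Expr.substL] at h
    cases h with
    | cons h₁ h₂ =>
      obtain ⟨hn₁, hn₂, hd⟩ := List.nodup_append'.1 hn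
      obtain ⟨b, hb, hr₁⟩ := Expr.exists_path V e σ δ _ hn₁ h₁
      obtain ⟨bs, hbs, hr₂⟩ := Expr.exists_pathL V es _ _ _ hn₂ h₂
      refine ⟨b :: bs, by simp [Expr.pathsL, mem_combine, hb, hbs],
        (hr₁.and hr₂ hd).imp fun y hy α hα hα' => ?_⟩
      obtain ⟨hc₁, hv₁⟩ := hy.1 α hα hα'
      obtain ⟨hc₂, hv₂⟩ := hy.2 α hα hα'
      exact ⟨⟨hc₁, hc₂⟩, by simp [Path.rhoL, Term.denL, Val.denL, hv₁, hv₂]⟩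
end

/-! ### Satisfiable paths lead to evaluations -/

/-- The substituted variables have values of the types required by the contexts, and the
assignment gives them these values. -/
def Assn.Models (J : Fin n → Set ℝ → ℝ) (Γ : NVar → Option Ty) (Δ : ℕ → Option Ty)
    (σ : NVar → Option (Val n)) (δ : ℕ → Option (Val n)) (α : Assn n) : Prop :=
  (∀ x τ, Γ x = some τ → ∃ v, σ x = some v ∧ v.ty = τ ∧ α.nvar x = v.den J) ∧
    ∀ w τ, Δ w = some τ → ∃ v, δ w = some v ∧ v.ty = τ ∧ α.avar w = v.den J

theorem Assn.Models.left {J : Fin n → Set ℝ → ℝ} {Γ : NVar → Option Ty}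
    {Δ Δ₁ Δ₂ : ℕ → Option Ty} {σ : NVar → Option (Val n)} {δ : ℕ → Option (Val n)} {α : Assn n}
    (h : α.Models J Γ Δ σ δ) (hs : Splits Δ Δ₁ Δ₂) : α.Models J Γ Δ₁ σ δ :=
  ⟨h.1, fun w τ hw => h.2 w τ (hs.1 w τ hw)⟩

theorem Assn.Models.right {J : Fin n → Set ℝ → ℝ} {Γ : NVar → Option Ty}
    {Δ Δ₁ Δ₂ : ℕ → Option Ty} {σ : NVar → Option (Val n)} {δ : ℕ → Option (Val n)} {α : Assn n}
    (h : α.Models J Γ Δ σ δ) (hs : Splits Δ Δ₁ Δ₂) : α.Models J Γ Δ₂ σ δ :=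
  ⟨h.1, fun w τ hw => h.2 w τ (hs.2.1 w τ hw)⟩

theorem Val.exists_mkTup {v : Val n} {τs : List Ty} (h : v.ty = Ty.mkProd τs) :
    ∃ vs, v = Val.mkTup vs ∧ Val.tyL vs = τs := by
  rcases τs with _ | ⟨τ, _ | ⟨τ', τs⟩⟩
  · cases v <;> simp [Val.ty, Ty.mkProd] at h
    exact ⟨[], by rename_i vs; cases vs <;> simp_all [Val.tyL, Val.mkTup], rfl⟩
  · exact ⟨[v], rfl, by simpa [Val.tyL, Ty.mkProd] using h⟩
  · cases v <;> simp [Val.ty, Ty.mkProd] at h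
    rename_i vs
    rcases vs with _ | ⟨u, _ | ⟨w, vs⟩⟩
    · simp [Val.tyL] at h
    · simp [Val.tyL] at h
    · exact ⟨u :: w :: vs, rfl, h⟩

theorem Val.ty_mkTup (vs : List (Val n)) : (Val.mkTup vs).ty = Ty.mkProd (Val.tyL vs) := by
  rcases vs with _ | ⟨u, _ | ⟨w, vs⟩⟩ <;> rfl

theorem Val.eq_map_intvl {vs : List (Val n)} {k : ℕ}
    (h : Val.tyL vs = List.replicate k .intvl) : ∃ Is : List Intvl, vs = Is.map Val.intvl := by
  induction vs generalizing k with
  | nil => exact ⟨[], rfl⟩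
  | cons v vs ih =>
    cases k with
    | zero => simp [Val.tyL] at h
    | succ k =>
      simp only [Val.tyL, List.replicate_succ, List.cons.injEq] at h
      obtain ⟨Is, rfl⟩ := ih h.2
      cases v <;> simp [Val.ty] at h
      exact ⟨_ :: Is, rfl⟩

theorem extN_eq_none_of_not_binds {xs ws : List ℕ} {Γ : NVar → Option Ty} {τs : List Ty}
    {x : NVar} (h : bindsN xs ws x = false) : extN Γ xs ws τs x = Γ x := by
  cases x with
  | x i => simp [extN, bindX_eq_none (show i ∉ xs by simpa [bindsN] using h)]
  | rd w => simp [extN, bindW_eq_none (show w ∉ ws by simpa [bindsN] using h)]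

/-- Typed counterpart of `Assn.Agrees.split`. Here the length condition also guarantees that every
bound variable does receive a component. -/
theorem Assn.Models.split {J : Fin n → Set ℝ → ℝ} {Γ : NVar → Option Ty} {Δ : ℕ → Option Ty}
    {σ : NVar → Option (Val n)} {δ : ℕ → Option (Val n)} {α : Assn n} (h : α.Models J Γ Δ σ δ)
    {xs ws : List ℕ} {vs : List (Val n)} (hl : vs.length = xs.length + ws.length) {t : Term n}
    (ht : t.den J α = (Val.mkTup vs).den J) :
    (α.extend J (splitSubst xs ws t)).Models J (extN Γ xs ws (Val.tyL vs))
      (extA Δ xs ws (Val.tyL vs))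
      (fun x => (if bindsN xs ws x then none else σ x).or (bindN xs ws vs x))
      (fun w => (if ws.contains w then none else δ w).or (bindW xs ws vs w)) := by
  have hcomps := Term.den_comps J α ht
  rw [hl] at hcomps
  have hty : List.Forall₂ (fun τ v => Val.ty v = τ) (Val.tyL vs) vs := by
    rw [Val.tyL_eq_map, List.forall₂_map_left_iff]
    exact List.forall₂_same.2 fun _ _ => rfl
  have hden : List.Forall₂ (fun (v : Val n) u => Term.den J α u = Val.den J v) vs
      (Term.comps (xs.length + ws.length) t) := hcomps.flip
  constructor
  · rintro (i | w) τ hτ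
    · by_cases hi : i ∈ xs
      · obtain ⟨v, hv⟩ := exists_bindX (vs := vs) hi hl
        have h₁ := bindX_rel xs hty i
        have h₂ := bindX_rel xs hden i
        rw [hv] at h₁ h₂
        cases hb : bindX xs (Val.tyL vs) i with
        | none => rw [hb] at h₁; cases h₁
        | some τ' =>
        cases hc : bindX xs (Term.comps (xs.length + ws.length) t) i with
        | none => rw [hc] at h₂; cases h₂
        | some u =>
        rw [hb] at h₁; rw [hc] at h₂
        cases h₁ with | some h₁ => cases h₂ with | some h₂ =>
        rw [Term.comps] at hc
        simp only [extN, hb, Option.some_or, Option.some.injEq] at hτ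
        subst hτ
        exact ⟨v, by simp [bindsN, hi, bindN, hv], h₁, by simp [Assn.extend, splitSubst, hc, h₂]⟩
      · rw [extN_eq_none_of_not_binds (by simpa [bindsN] using hi)] at hτ
        obtain ⟨v, hv, hv', hv''⟩ := h.1 _ _ hτ
        exact ⟨v, by simp [bindsN, hi, hv], hv',
          by simpa [Assn.extend, splitSubst, bindX_eq_none hi] using hv''⟩
    · by_cases hi : w ∈ ws
      · obtain ⟨v, hv⟩ := exists_bindW (vs := vs) hi hl
        have h₁ := bindW_rel xs ws hty w
        have h₂ := bindW_rel xs ws hden w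
        rw [hv] at h₁ h₂
        cases hb : bindW xs ws (Val.tyL vs) w with
        | none => rw [hb] at h₁; cases h₁
        | some τ' =>
        cases hc : bindW xs ws (Term.comps (xs.length + ws.length) t) w with
        | none => rw [hc] at h₂; cases h₂
        | some u =>
        rw [hb] at h₁; rw [hc] at h₂
        cases h₁ with | some h₁ => cases h₂ with | some h₂ =>
        rw [Term.comps] at hc
        simp only [extN, hb, Option.map_some, Option.some_or, Option.some.injEq] at hτ
        subst hτ
        exact ⟨v.rd, by simp [bindsN, hi, bindN, hv], by rw [Val.ty_rd, h₁],
          by simp [Assn.extend, splitSubst, hc, h₂, Val.den_rd]⟩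
      · rw [extN_eq_none_of_not_binds (by simpa [bindsN] using hi)] at hτ
        obtain ⟨v, hv, hv', hv''⟩ := h.1 _ _ hτ
        exact ⟨v, by simp [bindsN, hi, hv], hv',
          by simpa [Assn.extend, splitSubst, bindW_eq_none hi] using hv''⟩
  · intro w τ hτ
    by_cases hi : w ∈ ws
    · obtain ⟨v, hv⟩ := exists_bindW (vs := vs) hi hl
      have h₁ := bindW_rel xs ws hty w
      have h₂ := bindW_rel xs ws hden w
      rw [hv] at h₁ h₂
      cases hb : bindW xs ws (Val.tyL vs) w with
      | none => rw [hb] at h₁; cases h₁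
      | some τ' =>
      cases hc : bindW xs ws (Term.comps (xs.length + ws.length) t) w with
      | none => rw [hc] at h₂; cases h₂
      | some u =>
      rw [hb] at h₁; rw [hc] at h₂
      cases h₁ with | some h₁ => cases h₂ with | some h₂ =>
      rw [Term.comps] at hc
      simp only [extA, hb, Option.some_or, Option.some.injEq] at hτ
      subst hτ
      exact ⟨v, by simp [hi, hv], h₁, by simp [Assn.extend, splitSubst, hc, h₂]⟩
    · rw [extA, bindW_eq_none hi, Option.none_or] at hτ
      obtain ⟨v, hv, hv', hv''⟩ := h.2 _ _ hτ
      exact ⟨v, by simp [hi, hv], hv',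
        by simpa [Assn.extend, splitSubst, bindW_eq_none hi] using hv''⟩

theorem Path.mem_pathsL_pair {e₁ e₂ : Expr n} {bs : List (Path n)} :
    bs ∈ Expr.pathsL [e₁, e₂] ↔ ∃ b₁ ∈ e₁.paths, ∃ b₂ ∈ e₂.paths, bs = [b₁, b₂] := by
  simp [Expr.pathsL, mem_combine, eq_comm]

theorem Term.den_union {J : Fin n → Set ℝ → ℝ} {α : Assn n} {ts : List (Term n)}
    {Is : List Intvl} (h : Term.denL J α ts = Val.denL J (Is.map Val.intvl)) :
    (Term.union ts).den J α = (Val.piece Is).den J := by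
  rw [Term.den, h]
  simp [Val.denL_eq_map, Val.den, Function.comp_def, Den.getIntvl]

mutual
-- Typing fixes the shape of each intermediate value, and the constraint supplies the remaining
-- premises of the evaluation rules: an assertion selects the branch, the inequalities allow the
-- division, and the equation of a mark justifies reporting y_s, which lies in the cake by
-- assumption.
theorem HasTy.exists_eval (V : Fin n → Valuation) : ∀ {Γ : NVar → Option Ty}
    {Δ : ℕ → Option Ty} {e : Expr n} {τ : Ty}, HasTy Γ Δ e τ →
    ∀ (σ : NVar → Option (Val n)) (δ : ℕ → Option (Val n)) (α : Assn n) (b : Path n),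
    b ∈ e.paths → α.Models (interp V) Γ Δ σ δ → (∀ s, α.y s ∈ Icc (0 : ℝ) 1) →
    b.constr.Holds (interp V) α →
    ∃ v, Eval V (e.subst σ δ) v ∧ v.ty = τ ∧ b.rho.den (interp V) α = v.den (interp V)
  | _, _, _, _, .val Γ Δ v, σ, δ, α, b, hb, hα, hy, hc => by
    simp only [Expr.paths, List.mem_singleton] at hb
    subst hb
    exact ⟨v, by rw [Expr.subst]; exact .val v, rfl, Val.den_toTerm _ _ _⟩
  | _, _, _, _, .nvar h, σ, δ, α, b, hb, hα, hy, hc => by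
    simp only [Expr.paths, List.mem_singleton] at hb
    subst hb
    obtain ⟨v, hv, hv', hv''⟩ := hα.1 _ _ h
    exact ⟨v, by simp only [Expr.subst, hv]; exact .val v, hv', hv''⟩
  | _, _, _, _, .avar h, σ, δ, α, b, hb, hα, hy, hc => by
    simp only [Expr.paths, List.mem_singleton] at hb
    subst hb
    obtain ⟨v, hv, hv', hv''⟩ := hα.2 _ _ h
    exact ⟨v, by simp only [Expr.subst, hv]; exact .val v, hv', hv''⟩
  | _, _, _, _, .tup h, σ, δ, α, b, hb, hα, hy, hc => by
    simp only [Expr.paths, List.mem_map] at hb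
    obtain ⟨bs, hbs, rfl⟩ := hb
    obtain ⟨vs, hvs, hty, hden⟩ := HasTys.exists_evals V h σ δ α bs hbs hα hy hc
    exact ⟨.mkTup vs, by rw [Expr.subst]; exact .tup hvs, by rw [Val.ty_mkTup, hty],
      Term.den_mkTup hden⟩
  | _, _, _, _, .split hs _ _ hl _ h₁ h₂, σ, δ, α, b, hb, hα, hy, hc => by
    simp only [Expr.paths, mem_combine] at hb
    obtain ⟨b₁, hb₁, b₂, hb₂, rfl⟩ := hb
    rw [Path.holds_constr_split] at hc
    obtain ⟨v, hv, hty, hden⟩ := HasTy.exists_eval V h₁ σ δ α b₁ hb₁ (hα.left hs) hy hc.1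
    obtain ⟨vs, rfl, hvs⟩ := Val.exists_mkTup hty
    -- The value has as many components as its product type, hence as many as there are binders.
    have hl' := (List.length_map Val.ty).symm.trans ((congrArg List.length
      ((Val.tyL_eq_map vs).symm.trans hvs)).trans hl)
    have hm := (hα.right hs).split hl' hden
    rw [hvs] at hm
    obtain ⟨v, hv₂, hty₂, hden₂⟩ := HasTy.exists_eval V h₂ _ _ _ b₂ hb₂ hm hy hc.2
    refine ⟨v, ?_, hty₂, by rw [Path.den_rho_split]; exact hden₂⟩
    rw [Expr.subst]
    exact .split hv hl' (by rw [Expr.subst_subst]; exact hv₂)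
  | _, _, _, _, .ite hs h₁ h₂ h₃, σ, δ, α, b, hb, hα, hy, hc => by
    simp only [Expr.paths, List.mem_append, mem_combine] at hb
    obtain ⟨b₁, hb₁, b₂, hb₂, rfl⟩ | ⟨b₁, hb₁, b₂, hb₂, rfl⟩ := hb
    · obtain ⟨hc₀, hc₁, hc₂⟩ := hc
      obtain ⟨v, hv, hty, hden⟩ := HasTy.exists_eval V h₁ σ δ α b₁ hb₁ (hα.left hs) hy hc₁
      obtain ⟨u, hu, hty', hden'⟩ := HasTy.exists_eval V h₂ σ δ α b₂ hb₂ (hα.right hs) hy hc₂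
      cases v <;> simp [Val.ty] at hty
      simp only [Formula.Holds, hden, Val.den, Den.bool.injEq] at hc₀
      subst hc₀
      exact ⟨u, by rw [Expr.subst]; exact .iteTrue hv hu, hty', hden'⟩
    · obtain ⟨hc₀, ⟨hc₁, -⟩, hc₂⟩ := hc
      obtain ⟨v, hv, hty, hden⟩ := HasTy.exists_eval V h₁ σ δ α b₁ hb₁ (hα.left hs) hy hc₁
      obtain ⟨u, hu, hty', hden'⟩ := HasTy.exists_eval V h₃ σ δ α b₂ hb₂ (hα.right hs) hy hc₂
      cases v <;> simp [Val.ty] at hty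
      simp only [Formula.Holds, Path.rho, Path.rhoL, Term.den, Term.denL, hden, Val.den, Op.den,
        Den.bool.injEq, Bool.not_eq_true'] at hc₀
      subst hc₀
      exact ⟨u, by rw [Expr.subst]; exact .iteFalse hv hu, hty', hden'⟩
  | _, _, _, _, .op h, σ, δ, α, b, hb, hα, hy, hc => by
    simp only [Expr.paths, List.mem_map] at hb
    obtain ⟨bs, hbs, rfl⟩ := hb
    obtain ⟨vs, hvs, hty, hden⟩ := HasTys.exists_evals V h σ δ α bs hbs hα hy hc
    obtain ⟨v, hv, hv'⟩ := Op.exists_run V hty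
    refine ⟨v, by rw [Expr.subst]; exact .op hvs hv, hv', ?_⟩
    rw [Path.rho, Term.den, hden]
    exact Op.den_of_run hv
  | _, _, _, _, .cake Γ Δ, σ, δ, α, b, hb, hα, hy, hc => by
    simp only [Expr.paths, List.mem_singleton] at hb
    subst hb
    exact ⟨_, by rw [Expr.subst]; exact .cake, rfl, rfl⟩
  | _, _, _, _, .div h, σ, δ, α, b, hb, hα, hy, hc => by
    simp only [Expr.paths, mem_combine] at hb
    obtain ⟨b₁, hb₁, b₂, hb₂, rfl⟩ := hb
    obtain ⟨hc₁, hc₂, hle, hle'⟩ := hc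
    obtain ⟨vs, hvs, hty, hden⟩ := HasTys.exists_evals V h σ δ α [b₁, b₂]
      (Path.mem_pathsL_pair.2 ⟨b₁, hb₁, b₂, hb₂, rfl⟩) hα hy ⟨hc₁, hc₂, trivial⟩
    rw [Expr.substL, Expr.substL, Expr.substL] at hvs
    cases hvs with | cons hv₁ hvs => cases hvs with | cons hv₂ hvs =>
    cases hvs
    rename_i v₁ v₂
    simp only [Val.tyL, List.cons.injEq, and_true] at hty
    obtain ⟨ht₁, ht₂⟩ := hty
    cases v₁ <;> simp [Val.ty] at ht₁
    cases v₂ <;> simp [Val.ty] at ht₂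
    simp only [Path.rhoL, Term.denL, Val.denL, List.cons.injEq, and_true] at hden
    obtain ⟨hd₁, hd₂⟩ := hden
    rename_i I r
    have hl : I.lo ≤ r := by simpa [Formula.Holds, Term.den, hd₁, hd₂, Val.den, Den.lft] using hle
    have hr : r ≤ I.hi := by simpa [Formula.Holds, Term.den, hd₁, hd₂, Val.den, Den.rgt] using hle'
    refine ⟨_, by rw [Expr.subst]; exact .div hv₁ hv₂ hl hr, rfl, ?_⟩
    simp [Path.rho, Term.den, Term.denL, hd₁, hd₂, Val.den, Val.denL, Den.lft, Den.rgt,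
      Den.mkIntvl]
  | _, _, _, _, .piece h, σ, δ, α, b, hb, hα, hy, hc => by
    simp only [Expr.paths, List.mem_map] at hb
    obtain ⟨bs, hbs, rfl⟩ := hb
    obtain ⟨vs, hvs, hty, hden⟩ := HasTys.exists_evals V h σ δ α bs hbs hα hy hc
    obtain ⟨Is, rfl⟩ := Val.eq_map_intvl hty
    exact ⟨.piece Is, by rw [Expr.subst]; exact .piece hvs, rfl, Term.den_union hden⟩
  | _, _, _, _, .mark (s := s) (a := a) h, σ, δ, α, b, hb, hα, hy, hc => by
    simp only [Expr.paths, mem_combine] at hb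
    obtain ⟨b₁, hb₁, b₂, hb₂, rfl⟩ := hb
    obtain ⟨hc₁, hc₂, heq⟩ := hc
    obtain ⟨vs, hvs, hty, hden⟩ := HasTys.exists_evals V h σ δ α [b₁, b₂]
      (Path.mem_pathsL_pair.2 ⟨b₁, hb₁, b₂, hb₂, rfl⟩) hα hy ⟨hc₁, hc₂, trivial⟩
    rw [Expr.substL, Expr.substL, Expr.substL] at hvs
    cases hvs with | cons hv₁ hvs => cases hvs with | cons hv₂ hvs =>
    cases hvs
    rename_i v₁ v₂
    simp only [Val.tyL, List.cons.injEq, and_true] at hty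
    obtain ⟨ht₁, ht₂⟩ := hty
    cases v₁ <;> simp [Val.ty] at ht₁
    cases v₂ <;> simp [Val.ty] at ht₂
    simp only [Path.rhoL, Term.denL, Val.denL, List.cons.injEq, and_true] at hden
    obtain ⟨hd₁, hd₂⟩ := hden
    rename_i I l
    simp only [Formula.Holds, Term.den, hd₁, hd₂, Val.den, Den.lft, Assn.get,
      Den.mkIntvl, Den.val, Den.num.injEq] at heq
    obtain ⟨_, _, rfl, rfl, heq⟩ := heq
    exact ⟨_, by rw [Expr.subst]; exact .mark hv₁ hv₂ (hy s) heq, rfl, rfl⟩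
  | _, _, _, _, .evalIntvl h, σ, δ, α, b, hb, hα, hy, hc => by
    simp only [Expr.paths, List.mem_map] at hb
    obtain ⟨b, hb, rfl⟩ := hb
    obtain ⟨v, hv, hty, hden⟩ := HasTy.exists_eval V h σ δ α b hb hα hy hc
    cases v <;> simp [Val.ty] at hty
    refine ⟨_, by rw [Expr.subst]; exact .evalIntvl hv, rfl, ?_⟩
    rw [Path.rho, Term.den, hden]
    simp [Val.den, Den.val, Region.toSet, Intvl.toSet]
  | _, _, _, _, .evalPiece h, σ, δ, α, b, hb, hα, hy, hc => by
    simp only [Expr.paths, List.mem_map] at hb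
    obtain ⟨b, hb, rfl⟩ := hb
    obtain ⟨v, hv, hty, hden⟩ := HasTy.exists_eval V h σ δ α b hb hα hy hc
    cases v <;> simp [Val.ty] at hty
    refine ⟨_, by rw [Expr.subst]; exact .evalPiece hv, rfl, ?_⟩
    rw [Path.rho, Term.den, hden]
    simp [Val.den, Den.val, Region.toSet, Intvl.toSet]
theorem HasTys.exists_evals (V : Fin n → Valuation) : ∀ {Γ : NVar → Option Ty}
    {Δ : ℕ → Option Ty} {es : List (Expr n)} {τs : List Ty}, HasTys Γ Δ es τs →
    ∀ (σ : NVar → Option (Val n)) (δ : ℕ → Option (Val n)) (α : Assn n) (bs : List (Path n)),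
    bs ∈ Expr.pathsL es → α.Models (interp V) Γ Δ σ δ → (∀ s, α.y s ∈ Icc (0 : ℝ) 1) →
    (Path.constrL bs).Holds (interp V) α →
    ∃ vs, Evals V (Expr.substL σ δ es) vs ∧ Val.tyL vs = τs ∧
      Term.denL (interp V) α (Path.rhoL bs) = Val.denL (interp V) vs
  | _, _, _, _, .nil Γ Δ, σ, δ, α, bs, hbs, hα, hy, hc => by
    simp only [Expr.pathsL, List.mem_singleton] at hbs
    subst hbs
    exact ⟨[], by rw [Expr.substL]; exact .nil, rfl, rfl⟩
  | _, _, _, _, .cons hs h₁ h₂, σ, δ, α, bs, hbs, hα, hy, hc => by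
    simp only [Expr.pathsL, mem_combine] at hbs
    obtain ⟨b, hb, bs, hbs, rfl⟩ := hbs
    obtain ⟨v, hv, hty, hden⟩ := HasTy.exists_eval V h₁ σ δ α b hb (hα.left hs) hy hc.1
    obtain ⟨vs, hvs, htys, hdens⟩ := HasTys.exists_evals V h₂ σ δ α bs hbs (hα.right hs) hy hc.2
    exact ⟨v :: vs, by rw [Expr.substL]; exact .cons hv hvs, by simp [Val.tyL, hty, htys],
      by simp [Path.rhoL, Term.denL, Val.denL, hden, hdens]⟩
end

-- Envy-freeness in terms of paths

theorem Term.den_comp_congr {J : Fin n → Set ℝ → ℝ} {α β : Assn n} {t u : Term n}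
    (h : t.den J α = u.den J β) (k i : ℕ) : (t.comp k i).den J α = (u.comp k i).den J β := by
  unfold Term.comp
  split_ifs
  · exact h
  · simp [Term.den, h]

theorem Formula.holds_conj {J : Fin n → Set ℝ → ℝ} {α : Assn n} {φs : List (Formula n)} :
    (Formula.conj φs).Holds J α ↔ ∀ φ ∈ φs, φ.Holds J α := by
  induction φs with
  | nil => simp [Formula.conj, Formula.Holds]
  | cons φ φs ih => simp [Formula.conj, Formula.Holds, ih]

theorem envyFormula_eq (t : Term n) : envyFormula t = .conj ((List.finRange n).flatMap fun a =>
    (List.finRange n).map fun a' : Fin n => .ge (.val a (t.comp n a)) (.val a (t.comp n a'.val))) := by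
  simp [envyFormula, List.map_flatMap]
  simp only [List.map_eq_flatMap]

theorem holds_envyFormula {J : Fin n → Set ℝ → ℝ} {α : Assn n} {t : Term n} :
    (envyFormula t).Holds J α ↔ ∀ a a' : Fin n,
      (Formula.ge (.val a (t.comp n a)) (.val a (t.comp n a'))).Holds J α := by
  simp only [envyFormula_eq, Formula.holds_conj, List.mem_flatMap, List.mem_map,
    List.mem_finRange, true_and]
  exact ⟨fun h a a' => h _ ⟨a, a', rfl⟩, by rintro h _ ⟨a, a', rfl⟩; exact h a a'⟩

/-- E(t) depends only on the denotation of `t`, so the result term of a path may be exchanged for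
the encoding of the value it describes. -/
theorem envyFormula_congr {J : Fin n → Set ℝ → ℝ} {α β : Assn n} {t u : Term n}
    (h : t.den J α = u.den J β) : (envyFormula t).Holds J α ↔ (envyFormula u).Holds J β := by
  simp only [holds_envyFormula, Formula.Holds, Term.den, Term.den_comp_congr h]

/-- Envy-free expressions have paths with envy-free results. -/
theorem Expr.EnvyFree.holds_envyFormula {e : Expr n} (he : e.EnvyFree) {τ : Ty}
    (hty : e.HasType τ) {b : Path n} (hb : b ∈ e.paths) {V : Fin n → Valuation} {α : Assn n}
    (hy : ∀ s, α.y s ∈ Icc (0 : ℝ) 1) (hc : b.constr.Holds (interp V) α) :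
    (envyFormula b.rho).Holds (interp V) α := by
  obtain ⟨v, hv, -, hden⟩ := HasTy.exists_eval V hty (fun _ => none) (fun _ => none) α b hb
    ⟨by simp, by simp⟩ hy hc
  rw [Expr.subst_none] at hv
  exact (envyFormula_congr (hden.trans (Val.den_toTerm _ α v).symm)).2 (he V v hv α)

/-- An expression is envy-free if its paths have envy-free results. -/
theorem Expr.envyFree_of_paths {e : Expr n} (hids : e.ids.Nodup)
    (h : ∀ b ∈ e.paths, ∀ (V : Fin n → Valuation) (y : ℕ → ℝ), (∀ s, y s ∈ Icc (0 : ℝ) 1) →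
      (∀ α : Assn n, α.y = y → b.constr.Holds (interp V) α) →
      ∃ α : Assn n, α.y = y ∧ (envyFormula b.rho).Holds (interp V) α) : e.EnvyFree := by
  intro V v hv α
  rw [← e.subst_none] at hv
  obtain ⟨b, hb, f, hf, hr⟩ := Expr.exists_path V e _ _ v hids hv
  -- A closed expression is evaluated under the empty substitution, with which every assignment
  -- agrees; only the marks `f` have to be prescribed.
  have hr' := fun (β : Assn n) (hβ : β.y = f) => hr f (fun _ _ => rfl) β hβ ⟨by simp, by simp⟩
  obtain ⟨β, hβ, he⟩ := h b hb V f hf fun β hβ => (hr' β hβ).1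
  exact (envyFormula_congr ((hr' β hβ).2.trans (Val.den_toTerm _ α v).symm)).1 he

/-! ### Normal forms -/

/-- The points `0` and `1` and the variables `y_s`. -/
inductive IsPointNf : Term n → Prop where
  | zero : IsPointNf (.pt 0)
  | one : IsPointNf (.pt 1)
  | y (s : ℕ) : IsPointNf (.var (.y s))

inductive IsIntvlNf : Term n → Prop where
  | mk {t u : Term n} : IsPointNf t → IsPointNf u → IsIntvlNf (.intvl t u)

inductive IsPieceNf : Term n → Prop where
  | mk {ts : List (Term n)} : (∀ t ∈ ts, IsIntvlNf t) → IsPieceNf (.union ts)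

def IsRegionNf (t : Term n) : Prop := IsIntvlNf t ∨ IsPieceNf t

/-- Linear combinations of the terms `val_a(t)`. -/
inductive IsVltnNf : Term n → Prop where
  | zero : IsVltnNf (.real 0)
  | val (a : Fin n) {t : Term n} : IsRegionNf t → IsVltnNf (.val a t)
  | add {t u : Term n} : IsVltnNf t → IsVltnNf u → IsVltnNf (.op .add [t, u])
  | smul (r : ℝ) {t : Term n} : IsVltnNf t → IsVltnNf (.op (.smul r) [t])

inductive IsBoolNf : Term n → Prop where
  | bool (b : Bool) : IsBoolNf (.bool b)
  | and {t u : Term n} : IsBoolNf t → IsBoolNf u → IsBoolNf (.op .and [t, u])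
  | or {t u : Term n} : IsBoolNf t → IsBoolNf u → IsBoolNf (.op .or [t, u])
  | not {t : Term n} : IsBoolNf t → IsBoolNf (.op .not [t])
  | ptGe {t u : Term n} : IsPointNf t → IsPointNf u → IsBoolNf (.op .ptGe [t, u])
  | vGe {t u : Term n} : IsVltnNf t → IsVltnNf u → IsBoolNf (.op .vGe [t, u])
  | vEq {t u : Term n} : IsVltnNf t → IsVltnNf u → IsBoolNf (.op .vEq [t, u])

/-- The normal forms of the terms that describe results of a given type. -/
inductive IsNf : Ty → Term n → Prop where
  | bool {t : Term n} : IsBoolNf t → IsNf .bool t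
  | point {t : Term n} : IsPointNf t → IsNf .point t
  | vltn {t : Term n} : IsVltnNf t → IsNf .vltn t
  | rdIntvl {t : Term n} : IsIntvlNf t → IsNf .rdIntvl t
  | rdPiece {t : Term n} : IsPieceNf t → IsNf .rdPiece t
  | intvl {t : Term n} : IsIntvlNf t → IsNf .intvl t
  | piece {t : Term n} : IsPieceNf t → IsNf .piece t
  | prod {τs : List Ty} {ts : List (Term n)} : List.Forall₂ IsNf τs ts → IsNf (.prod τs) (.tup ts)

/-- Quantifier-free formulas whose atoms compare points or valuation values. -/
inductive Formula.IsNf : Formula n → Prop where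
  | tru : IsNf .tru
  | fls : IsNf .fls
  | ptGe {t u : Term n} : IsPointNf t → IsPointNf u → IsNf (.ge t u)
  | vGe {t u : Term n} : IsVltnNf t → IsVltnNf u → IsNf (.ge t u)
  | vEq {t u : Term n} : IsVltnNf t → IsVltnNf u → IsNf (.eq t u)
  | not {φ : Formula n} : φ.IsNf → IsNf (.not φ)
  | and {φ χ : Formula n} : φ.IsNf → χ.IsNf → IsNf (.and φ χ)
  | or {φ χ : Formula n} : φ.IsNf → χ.IsNf → IsNf (.or φ χ)

theorem IsIntvlNf.exists_eq {t : Term n} (h : IsIntvlNf t) :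
    ∃ u v, IsPointNf u ∧ IsPointNf v ∧ t = .intvl u v := by
  cases h with | mk hu hv => exact ⟨_, _, hu, hv, rfl⟩

theorem isNf_bool {t : Term n} : IsNf .bool t ↔ IsBoolNf t := ⟨fun | .bool h => h, .bool⟩

theorem isNf_point {t : Term n} : IsNf .point t ↔ IsPointNf t := ⟨fun | .point h => h, .point⟩

theorem isNf_vltn {t : Term n} : IsNf .vltn t ↔ IsVltnNf t := ⟨fun | .vltn h => h, .vltn⟩

theorem isNf_rdIntvl {t : Term n} : IsNf .rdIntvl t ↔ IsIntvlNf t :=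
  ⟨fun | .rdIntvl h => h, .rdIntvl⟩

theorem isNf_rdPiece {t : Term n} : IsNf .rdPiece t ↔ IsPieceNf t :=
  ⟨fun | .rdPiece h => h, .rdPiece⟩

theorem isNf_intvl {t : Term n} : IsNf .intvl t ↔ IsIntvlNf t := ⟨fun | .intvl h => h, .intvl⟩

theorem IsPointNf.exists_den {t : Term n} (h : IsPointNf t) (J : Fin n → Set ℝ → ℝ)
    (α : Assn n) : ∃ r, t.den J α = .num r := by
  cases h
  exacts [⟨0, rfl⟩, ⟨1, rfl⟩, ⟨_, rfl⟩]

theorem IsRegionNf.exists_den {t : Term n} (h : IsRegionNf t) (J : Fin n → Set ℝ → ℝ)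
    (α : Assn n) (a : Fin n) : ∃ r, (Term.val a t).den J α = .num r := by
  rcases h with ⟨ht, hu⟩ | h
  · obtain ⟨r, hr⟩ := ht.exists_den J α
    obtain ⟨s, hs⟩ := hu.exists_den J α
    exact ⟨_, by rw [Term.den, Term.den, hr, hs, Den.mkIntvl, Den.val]⟩
  · cases h
    exact ⟨_, rfl⟩

/-- Needed because an atomic comparison holds only if both of its sides denote numbers. -/
theorem IsVltnNf.exists_den {t : Term n} (h : IsVltnNf t) (J : Fin n → Set ℝ → ℝ)
    (α : Assn n) : ∃ r, t.den J α = .num r := by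
  induction h with
  | zero => exact ⟨0, rfl⟩
  | val a h => exact h.exists_den J α a
  | add _ _ h₁ h₂ =>
    obtain ⟨r, hr⟩ := h₁
    obtain ⟨s, hs⟩ := h₂
    exact ⟨_, Term.den_add hr hs⟩
  | smul q _ h =>
    obtain ⟨r, hr⟩ := h
    exact ⟨_, Term.den_smul q hr⟩

/-- The truth value of a boolean normal form is that of the corresponding formula. -/
theorem IsBoolNf.toFormula {t : Term n} (h : IsBoolNf t) : t.toFormula.IsNf ∧
    ∀ (J : Fin n → Set ℝ → ℝ) (α : Assn n), ∃ b : Bool, t.den J α = .bool b ∧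
      (t.toFormula.Holds J α ↔ b = true) := by
  induction h with
  | bool b =>
    cases b
    · exact ⟨by simpa [Term.toFormula] using .fls, fun J α => ⟨false, rfl, by
        simp [Term.toFormula, Formula.Holds]⟩⟩
    · exact ⟨by simpa [Term.toFormula] using .tru, fun J α => ⟨true, rfl, by
        simp [Term.toFormula, Formula.Holds]⟩⟩
  | and _ _ h₁ h₂ =>
    refine ⟨by simpa [Term.toFormula] using .and h₁.1 h₂.1, fun J α => ?_⟩
    obtain ⟨p, hp, hp'⟩ := h₁.2 J α
    obtain ⟨q, hq, hq'⟩ := h₂.2 J α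
    exact ⟨p && q, by simp [Term.den, Term.denL, hp, hq, Op.den], by
      simp [Term.toFormula, Formula.Holds, hp', hq']⟩
  | or _ _ h₁ h₂ =>
    refine ⟨by simpa [Term.toFormula] using .or h₁.1 h₂.1, fun J α => ?_⟩
    obtain ⟨p, hp, hp'⟩ := h₁.2 J α
    obtain ⟨q, hq, hq'⟩ := h₂.2 J α
    exact ⟨p || q, by simp [Term.den, Term.denL, hp, hq, Op.den], by
      simp [Term.toFormula, Formula.Holds, hp', hq']⟩
  | not _ h =>
    refine ⟨by simpa [Term.toFormula] using .not h.1, fun J α => ?_⟩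
    obtain ⟨p, hp, hp'⟩ := h.2 J α
    exact ⟨!p, by simp [Term.den, Term.denL, hp, Op.den], by
      simp [Term.toFormula, Formula.Holds, hp']⟩
  | ptGe h₁ h₂ =>
    refine ⟨by simpa [Term.toFormula] using .ptGe h₁ h₂, fun J α => ?_⟩
    obtain ⟨p, hp⟩ := h₁.exists_den J α
    obtain ⟨q, hq⟩ := h₂.exists_den J α
    exact ⟨_, by rw [Term.den, Term.denL, Term.denL, Term.denL, hp, hq, Op.den], by
      simp [Term.toFormula, Formula.Holds, hp, hq]⟩
  | vGe h₁ h₂ =>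
    refine ⟨by simpa [Term.toFormula] using .vGe h₁ h₂, fun J α => ?_⟩
    obtain ⟨p, hp⟩ := h₁.exists_den J α
    obtain ⟨q, hq⟩ := h₂.exists_den J α
    exact ⟨_, by rw [Term.den, Term.denL, Term.denL, Term.denL, hp, hq, Op.den], by
      simp [Term.toFormula, Formula.Holds, hp, hq]⟩
  | vEq h₁ h₂ =>
    refine ⟨by simpa [Term.toFormula] using .vEq h₁ h₂, fun J α => ?_⟩
    obtain ⟨p, hp⟩ := h₁.exists_den J α
    obtain ⟨q, hq⟩ := h₂.exists_den J α
    exact ⟨_, by rw [Term.den, Term.denL, Term.denL, Term.denL, hp, hq, Op.den], by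
      simp [Term.toFormula, Formula.Holds, hp, hq, eq_comm]⟩

mutual
theorem IsNf.rd : ∀ {τ : Ty} {t : Term n}, IsNf τ t → IsNf τ.rd t
  | _, _, .bool h => .bool h
  | _, _, .point h => .point h
  | _, _, .vltn h => .vltn h
  | _, _, .rdIntvl h => .rdIntvl h
  | _, _, .rdPiece h => .rdPiece h
  | _, _, .intvl h => .rdIntvl h
  | _, _, .piece h => .rdPiece h
  | _, _, .prod h => by rw [Ty.rd]; exact .prod (IsNf.rdL h)
theorem IsNf.rdL : ∀ {τs : List Ty} {ts : List (Term n)}, List.Forall₂ IsNf τs ts →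
    List.Forall₂ IsNf (Ty.rdL τs) ts
  | _, _, .nil => by rw [Ty.rdL]; exact .nil
  | _, _, .cons h hs => by rw [Ty.rdL]; exact .cons h.rd (IsNf.rdL hs)
end

theorem Term.substL_eq_map (θ : LVar n → Option (Term n)) (ts : List (Term n)) :
    Term.substL θ ts = ts.map (Term.subst θ) := by
  induction ts with
  | nil => rfl
  | cons t ts ih => simp [Term.substL, ih]

/-! ### Simplification of terms -/

/-- The simplification of `t` is a normal form for `τ`, with the same denotation as `t`. -/
def Simplifies (τ : Ty) (t : Term n) : Prop :=
  IsNf τ t.simpl ∧ ∀ (J : Fin n → Set ℝ → ℝ) (α : Assn n), t.simpl.den J α = t.den J α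

/-- The simplification of `φ` is a normal form that is equivalent to `φ`. -/
def Formula.Simplifies (φ : Formula n) : Prop :=
  φ.simpl.IsNf ∧ ∀ (J : Fin n → Set ℝ → ℝ) (α : Assn n), φ.simpl.Holds J α ↔ φ.Holds J α

theorem Simplifies.rd {τ : Ty} {t : Term n} (h : Simplifies τ t) : Simplifies τ.rd t :=
  ⟨h.1.rd, h.2⟩

theorem Simplifies.y (s : ℕ) : Simplifies .point (.var (.y s) : Term n) :=
  ⟨.point (.y s), fun _ _ => rfl⟩

theorem Simplifies.intvl {t u : Term n} (ht : Simplifies .point t) (hu : Simplifies .point u) :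
    Simplifies .intvl (.intvl t u) := by
  obtain ⟨h₁, ht⟩ := ht
  obtain ⟨h₂, hu⟩ := hu
  exact ⟨.intvl ⟨isNf_point.1 h₁, isNf_point.1 h₂⟩, fun J α => by rw [Term.simpl, Term.den, ht, hu, Term.den]⟩

/-- The simplified term is literally an interval, so its endpoint is computed. For the denotations
to match, both endpoints must denote numbers; otherwise the interval would denote `err`. -/
theorem Simplifies.lft {t : Term n} (h : Simplifies .rdIntvl t) : Simplifies .point t.lft := by
  obtain ⟨h, hd⟩ := h
  obtain ⟨u, v, hu, hv, he⟩ := (isNf_rdIntvl.1 h).exists_eq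
  refine ⟨by simpa [Term.simpl, he] using .point hu, fun J α => ?_⟩
  obtain ⟨r, hr⟩ := hu.exists_den J α
  obtain ⟨s, hs⟩ := hv.exists_den J α
  simp [Term.simpl, he, Term.den, ← hd, hr, hs, Den.mkIntvl, Den.lft]

theorem Simplifies.rgt {t : Term n} (h : Simplifies .rdIntvl t) : Simplifies .point t.rgt := by
  obtain ⟨h, hd⟩ := h
  obtain ⟨u, v, hu, hv, he⟩ := (isNf_rdIntvl.1 h).exists_eq
  refine ⟨by simpa [Term.simpl, he] using .point hv, fun J α => ?_⟩
  obtain ⟨r, hr⟩ := hu.exists_den J α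
  obtain ⟨s, hs⟩ := hv.exists_den J α
  simp [Term.simpl, he, Term.den, ← hd, hr, hs, Den.mkIntvl, Den.rgt]

theorem Simplifies.den_simplL {J : Fin n → Set ℝ → ℝ} {α : Assn n} {τs : List Ty}
    {ts : List (Term n)} (h : List.Forall₂ Simplifies τs ts) :
    Term.denL J α (Term.simplL ts) = Term.denL J α ts := by
  induction h with
  | nil => rfl
  | cons h _ ih => simp [Term.simplL, Term.denL, h.2, ih]

theorem Simplifies.simplL {τs : List Ty} {ts : List (Term n)}
    (h : List.Forall₂ Simplifies τs ts) : List.Forall₂ IsNf τs (Term.simplL ts) := by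
  induction h with
  | nil => exact .nil
  | cons h _ ih => exact .cons h.1 ih

theorem Simplifies.tup {τs : List Ty} {ts : List (Term n)}
    (h : List.Forall₂ Simplifies τs ts) : Simplifies (.prod τs) (.tup ts) :=
  ⟨by rw [Term.simpl]; exact .prod (Simplifies.simplL h),
    fun J α => by rw [Term.simpl, Term.den, Term.den, Simplifies.den_simplL h]⟩

theorem Simplifies.mkTup {τs : List Ty} {ts : List (Term n)}
    (h : List.Forall₂ Simplifies τs ts) : Simplifies (Ty.mkProd τs) (Term.mkTup ts) := by
  cases h with
  | nil => exact Simplifies.tup .nil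
  | cons h hs =>
    cases hs with
    | nil => exact h
    | cons h' hs => exact Simplifies.tup (.cons h (.cons h' hs))

theorem Simplifies.union {ts : List (Term n)} {k : ℕ}
    (h : List.Forall₂ Simplifies (List.replicate k .intvl) ts) : Simplifies .piece (.union ts) := by
  refine ⟨?_, fun J α => by rw [Term.simpl, Term.den, Term.den, Simplifies.den_simplL h]⟩
  rw [Term.simpl]
  refine .piece ⟨?_⟩
  induction k generalizing ts with
  | zero => cases h; simp [Term.simplL]
  | succ k ih =>
    cases h with
    | cons h hs =>
      simpa [Term.simplL, isNf_intvl.1 h.1] using ih hs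

theorem Simplifies.val (a : Fin n) {t : Term n}
    (h : Simplifies .rdIntvl t ∨ Simplifies .rdPiece t) : Simplifies .vltn (.val a t) := by
  obtain ⟨h, hd⟩ | ⟨h, hd⟩ := h
  · exact ⟨.vltn (.val a (.inl (isNf_rdIntvl.1 h))), fun J α => by rw [Term.simpl, Term.den, hd, Term.den]⟩
  · exact ⟨.vltn (.val a (.inr (isNf_rdPiece.1 h))), fun J α => by rw [Term.simpl, Term.den, hd, Term.den]⟩

theorem Simplifies.op {o : Op} {ts : List (Term n)}
    (h : List.Forall₂ Simplifies o.dom ts) : Simplifies o.cod (.op o ts) := by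
  refine ⟨?_, fun J α => by rw [Term.simpl, Term.den, Term.den, Simplifies.den_simplL h]⟩
  rw [Term.simpl]
  have := Simplifies.simplL h
  generalize Term.simplL ts = us at this
  cases o <;> cases this with | cons h₁ h₂ => ?_
  case not => cases h₂; exact .bool (.not (isNf_bool.1 h₁))
  case smul => cases h₂; exact .vltn (.smul _ (isNf_vltn.1 h₁))
  all_goals rcases h₂ with _ | ⟨h₂, _ | _⟩
  · exact .bool (.and (isNf_bool.1 h₁) (isNf_bool.1 h₂))
  · exact .bool (.or (isNf_bool.1 h₁) (isNf_bool.1 h₂))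
  · exact .bool (.ptGe (isNf_point.1 h₁) (isNf_point.1 h₂))
  · exact .bool (.vGe (isNf_vltn.1 h₁) (isNf_vltn.1 h₂))
  · exact .bool (.vEq (isNf_vltn.1 h₁) (isNf_vltn.1 h₂))
  · exact .vltn (.add (isNf_vltn.1 h₁) (isNf_vltn.1 h₂))

/-- A normal form of a proper product type is literally a tuple, so every projection within range is
computed. For one component the product type is the component type and `comp` does nothing. -/
theorem Simplifies.comps {τs : List Ty} {t : Term n} (h : Simplifies (Ty.mkProd τs) t) :
    List.Forall₂ Simplifies τs (t.comps τs.length) := by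
  by_cases hk : τs.length = 1
  · obtain ⟨τ, rfl⟩ := List.length_eq_one_iff.1 hk
    simpa [Term.comps, Term.comp, Ty.mkProd] using h
  · have : Ty.mkProd τs = .prod τs := by
      unfold Ty.mkProd; split
      · simp at hk
      · rfl
    rw [this] at h
    obtain ⟨h, hd⟩ := h
    obtain ⟨ts, hts, he⟩ : ∃ ts, List.Forall₂ IsNf τs ts ∧ t.simpl = .tup ts := by
      cases he : t.simpl <;> rw [he] at h <;> cases h
      exact ⟨_, ‹_›, rfl⟩
    rw [List.forall₂_iff_get] at hts ⊢
    refine ⟨by simp [Term.comps], fun i h₁ h₂ => ?_⟩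
    have hi : i < ts.length := hts.1 ▸ h₁
    simp only [Term.comps, Term.comp, hk, if_false, List.get_eq_getElem, List.getElem_map,
      List.getElem_range]
    refine ⟨by simpa [Term.simpl, he, hi] using hts.2 i h₁ hi, fun J α => ?_⟩
    simp [Term.simpl, he, hi, Term.den, ← hd, Den.proj, Term.denL_eq_map]

theorem Formula.Simplifies.and {φ χ : Formula n} (h₁ : φ.Simplifies) (h₂ : χ.Simplifies) :
    (Formula.and φ χ).Simplifies :=
  ⟨.and h₁.1 h₂.1, fun J α => and_congr (h₁.2 J α) (h₂.2 J α)⟩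

theorem Formula.Simplifies.tru : (Formula.tru : Formula n).Simplifies :=
  ⟨.tru, fun _ _ => Iff.rfl⟩

theorem Formula.Simplifies.isTrue {t : Term n} (h : Slice.Simplifies .bool t) :
    (Formula.isTrue t).Simplifies := by
  obtain ⟨h, hd⟩ := h
  replace h := isNf_bool.1 h
  refine ⟨h.toFormula.1, fun J α => ?_⟩
  obtain ⟨b, hb, hb'⟩ := h.toFormula.2 J α
  rw [Formula.simpl, hb', Formula.Holds, ← hd, hb, Den.bool.injEq]

theorem Formula.Simplifies.ptGe {t u : Term n} (ht : Slice.Simplifies .point t)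
    (hu : Slice.Simplifies .point u) : (Formula.ge t u).Simplifies := by
  obtain ⟨h₁, ht⟩ := ht
  obtain ⟨h₂, hu⟩ := hu
  exact ⟨.ptGe (isNf_point.1 h₁) (isNf_point.1 h₂), fun J α => by rw [Formula.simpl, Formula.Holds, ht, hu, Formula.Holds]⟩

theorem Formula.Simplifies.vGe {t u : Term n} (ht : Slice.Simplifies .vltn t)
    (hu : Slice.Simplifies .vltn u) : (Formula.ge t u).Simplifies := by
  obtain ⟨h₁, ht⟩ := ht
  obtain ⟨h₂, hu⟩ := hu
  exact ⟨.vGe (isNf_vltn.1 h₁) (isNf_vltn.1 h₂), fun J α => by rw [Formula.simpl, Formula.Holds, ht, hu, Formula.Holds]⟩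

theorem Formula.Simplifies.vEq {t u : Term n} (ht : Slice.Simplifies .vltn t)
    (hu : Slice.Simplifies .vltn u) : (Formula.eq t u).Simplifies := by
  obtain ⟨h₁, ht⟩ := ht
  obtain ⟨h₂, hu⟩ := hu
  exact ⟨.vEq (isNf_vltn.1 h₁) (isNf_vltn.1 h₂), fun J α => by rw [Formula.simpl, Formula.Holds, ht, hu, Formula.Holds]⟩

theorem Formula.Simplifies.conj {φs : List (Formula n)} (h : ∀ φ ∈ φs, φ.Simplifies) :
    (Formula.conj φs).Simplifies := by
  induction φs with
  | nil => exact .tru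
  | cons φ φs ih => exact .and (h _ (by simp)) (ih fun χ hχ => h χ (by simp [hχ]))

theorem simplifies_envyFormula {t : Term n} (h : Simplifies (Ty.alloc n) t) :
    (envyFormula t).Simplifies := by
  have hc := Simplifies.comps h
  rw [List.length_replicate] at hc
  have hcomp (a : Fin n) : Simplifies .piece (t.comp n a) := by
    simpa [Term.comps] using (List.forall₂_iff_get.1 hc).2 a (by simp) (by simp [Term.comps])
  rw [envyFormula_eq]
  refine .conj fun φ hφ => ?_
  simp only [List.mem_flatMap, List.mem_map, List.mem_finRange, true_and] at hφ
  obtain ⟨a, a', rfl⟩ := hφ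
  exact .vGe (.val a (.inr (hcomp a).rd)) (.val a (.inr (hcomp a').rd))

/-! ### Simplification of values and paths -/

theorem isPointNf_pt {r : ℝ} (h : r = 0 ∨ r = 1) : IsPointNf (.pt r : Term n) := by
  rcases h with rfl | rfl
  exacts [.zero, .one]

theorem Simplifies.pt {r : ℝ} (h : r = 0 ∨ r = 1) : Simplifies .point (.pt r : Term n) :=
  ⟨.point (isPointNf_pt h), fun _ _ => rfl⟩

theorem Intvl.simplifies_toTerm {I : Intvl} (h : ∀ r ∈ I.ends, r = 0 ∨ r = 1) :
    Slice.Simplifies .intvl (I.toTerm : Term n) :=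
  .intvl (.pt (h _ (by simp [Intvl.ends]))) (.pt (h _ (by simp [Intvl.ends])))

theorem simplifies_union_toTerm {Is : List Intvl}
    (h : ∀ r ∈ Is.flatMap Intvl.ends, r = 0 ∨ r = 1) :
    Simplifies .piece (.union (Is.map Intvl.toTerm) : Term n) := by
  refine .union (k := Is.length) ?_
  induction Is with
  | nil => exact .nil
  | cons I Is ih =>
    exact .cons (I.simplifies_toTerm fun r hr => h r (by simp [hr]))
      (ih fun r hr => h r (by rw [List.flatMap_cons]; exact List.mem_append_right _ hr))

theorem Region.simplifies_val (a : Fin n) {P : Region}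
    (h : ∀ r ∈ P.intvls.flatMap Intvl.ends, r = 0 ∨ r = 1) :
    Slice.Simplifies .vltn (.val a P.toTerm : Term n) := by
  cases P with
  | intvl I => exact .val a (.inl (I.simplifies_toTerm (by simpa [Region.intvls] using h)).rd)
  | piece Is => exact .val a (.inr (simplifies_union_toTerm h).rd)

mutual
-- Here the restriction on points is used: an interval in a value has endpoints 0 or 1, which are
-- atoms that every replacement orders. An arbitrary constant would have no place in S.
theorem Val.simplifies_toTerm : ∀ v : Val n, (∀ r ∈ v.points, r = 0 ∨ r = 1) →
    Slice.Simplifies v.ty v.toTerm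
  | .bool b, _ => ⟨.bool (.bool b), fun _ _ => rfl⟩
  | .pt r, h => .pt (h r (by simp [Val.points]))
  | .intvl I, h => I.simplifies_toTerm h
  | .piece Is, h => simplifies_union_toTerm h
  | .rdIntvl I, h => (I.simplifies_toTerm h).rd
  | .rdPiece Is, h => (simplifies_union_toTerm h).rd
  | .vltn l, h => by
    rw [Val.points] at h
    rw [Val.toTerm, Val.ty]
    induction l with
    | nil => exact ⟨.vltn .zero, fun _ _ => rfl⟩
    | cons q l ih =>
      rw [List.flatMap_cons] at h
      exact Simplifies.op (o := .add) (.cons (Simplifies.op (o := .smul q.1)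
        (.cons (Region.simplifies_val _ fun r hr => h r (List.mem_append_left _ hr)) .nil))
        (.cons (ih fun r hr => h r (List.mem_append_right _ hr)) .nil))
  | .tup vs, h => by
    rw [Val.toTerm, Val.ty]
    exact .tup (Val.simplifies_toTermL vs h)
theorem Val.simplifies_toTermL : ∀ vs : List (Val n), (∀ r ∈ Val.pointsL vs, r = 0 ∨ r = 1) →
    List.Forall₂ Slice.Simplifies (Val.tyL vs) (Val.toTermL vs)
  | [], _ => .nil
  | v :: vs, h => by
    rw [Val.pointsL] at h
    exact .cons (Val.simplifies_toTerm v fun r hr => h r (List.mem_append_left _ hr))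
      (Val.simplifies_toTermL vs fun r hr => h r (List.mem_append_right _ hr))
end

-- Composition of substitutions in terms

theorem Intvl.substL_toTerm (θ : LVar n → Option (Term n)) (Is : List Intvl) :
    Term.substL θ (Is.map Intvl.toTerm) = Is.map Intvl.toTerm := by
  simp [Term.substL_eq_map, Intvl.toTerm, Term.subst]

mutual
theorem Val.subst_toTerm (θ : LVar n → Option (Term n)) : ∀ v : Val n,
    v.toTerm.subst θ = v.toTerm
  | .bool b => rfl
  | .pt r => rfl
  | .intvl I => rfl
  | .piece Is => by simp [Val.toTerm, Term.subst, Intvl.substL_toTerm]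
  | .rdIntvl I => rfl
  | .rdPiece Is => by simp [Val.toTerm, Term.subst, Intvl.substL_toTerm]
  | .vltn l => by
    rw [Val.toTerm]
    induction l with
    | nil => rfl
    | cons q l ih =>
      have hP : Term.subst θ q.2.2.toTerm = q.2.2.toTerm := by
        cases q.2.2 with
        | intvl I => rfl
        | piece Is => simp [Region.toTerm, Term.subst, Intvl.substL_toTerm]
      simp only [List.map_cons, Term.sum, Term.add, Term.smul, Term.subst, Term.substL, hP]
      simp only [Term.smul] at ih
      rw [ih]
  | .tup vs => by simp [Val.toTerm, Term.subst, Val.substL_toTermL θ vs]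
theorem Val.substL_toTermL (θ : LVar n → Option (Term n)) : ∀ vs : List (Val n),
    Term.substL θ (Val.toTermL vs) = Val.toTermL vs
  | [] => rfl
  | v :: vs => by simp [Val.toTermL, Term.substL, Val.subst_toTerm θ v, Val.substL_toTermL θ vs]
end

mutual
theorem Term.subst_subst (θ θ' : LVar n → Option (Term n)) : ∀ t : Term n,
    (t.subst θ).subst θ' = t.subst fun v => ((θ v).map (Term.subst θ')).or (θ' v)
  | .var v => by
    simp only [Term.subst]
    cases θ v <;> simp [Term.subst]
  | .bool _ => rfl
  | .pt _ => rfl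
  | .real _ => rfl
  | .op o ts => by simp [Term.subst, Term.substL_substL θ θ' ts]
  | .lft t => by simp [Term.subst, Term.subst_subst θ θ' t]
  | .rgt t => by simp [Term.subst, Term.subst_subst θ θ' t]
  | .intvl t u => by simp [Term.subst, Term.subst_subst θ θ' t, Term.subst_subst θ θ' u]
  | .union ts => by simp [Term.subst, Term.substL_substL θ θ' ts]
  | .val a t => by simp [Term.subst, Term.subst_subst θ θ' t]
  | .tup ts => by simp [Term.subst, Term.substL_substL θ θ' ts]
  | .proj k t => by simp [Term.subst, Term.subst_subst θ θ' t]
theorem Term.substL_substL (θ θ' : LVar n → Option (Term n)) : ∀ ts : List (Term n),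
    Term.substL θ' (Term.substL θ ts) =
      Term.substL (fun v => ((θ v).map (Term.subst θ')).or (θ' v)) ts
  | [] => rfl
  | t :: ts => by simp [Term.substL, Term.subst_subst θ θ' t, Term.substL_substL θ θ' ts]
end

mutual
theorem Term.subst_none : ∀ t : Term n, t.subst (fun _ => none) = t
  | .var v => rfl
  | .bool _ => rfl
  | .pt _ => rfl
  | .real _ => rfl
  | .op o ts => by simp [Term.subst, Term.substL_none ts]
  | .lft t => by simp [Term.subst, Term.subst_none t]
  | .rgt t => by simp [Term.subst, Term.subst_none t]
  | .intvl t u => by simp [Term.subst, Term.subst_none t, Term.subst_none u]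
  | .union ts => by simp [Term.subst, Term.substL_none ts]
  | .val a t => by simp [Term.subst, Term.subst_none t]
  | .tup ts => by simp [Term.subst, Term.substL_none ts]
  | .proj k t => by simp [Term.subst, Term.subst_none t]
theorem Term.substL_none : ∀ ts : List (Term n), Term.substL (fun _ => none) ts = ts
  | [] => rfl
  | t :: ts => by simp [Term.substL, Term.subst_none t, Term.substL_none ts]
end

theorem Formula.mapTerms_mapTerms (f g : Term n → Term n) (φ : Formula n) :
    (φ.mapTerms f).mapTerms g = φ.mapTerms fun t => g (f t) := by
  induction φ <;> simp_all [Formula.mapTerms]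

theorem Formula.mapTerms_id {f : Term n → Term n} (hf : ∀ t, f t = t) (φ : Formula n) :
    φ.mapTerms f = φ := by
  induction φ <;> simp_all [Formula.mapTerms]

theorem Term.subst_mkTup (θ : LVar n → Option (Term n)) (ts : List (Term n)) :
    (Term.mkTup ts).subst θ = Term.mkTup (ts.map (Term.subst θ)) := by
  rcases ts with _ | ⟨t, _ | ⟨u, ts⟩⟩ <;> simp [Term.mkTup, Term.subst, Term.substL_eq_map]

theorem lookup_zip_map {α β : Type} (f : α → β) (xs : List ℕ) (as : List α) (i : ℕ) :
    (xs.zip (as.map f)).lookup i = ((xs.zip as).lookup i).map f := by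
  induction xs generalizing as with
  | nil => rfl
  | cons x xs ih =>
    cases as with
    | nil => rfl
    | cons a as =>
      simp only [List.map_cons, List.zip_cons_cons, List.lookup_cons]
      split
      · rfl
      · exact ih as

theorem splitSubst_x (xs ws : List ℕ) (t : Term n) (i : ℕ) :
    splitSubst xs ws t (.nvar (.x i)) = bindX xs (t.comps (xs.length + ws.length)) i := rfl

theorem splitSubst_rd (xs ws : List ℕ) (t : Term n) (w : ℕ) :
    splitSubst xs ws t (.nvar (.rd w)) = bindW xs ws (t.comps (xs.length + ws.length)) w := rfl

theorem splitSubst_avar (xs ws : List ℕ) (t : Term n) (w : ℕ) :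
    splitSubst xs ws t (.avar w) = bindW xs ws (t.comps (xs.length + ws.length)) w := rfl

theorem map_splitSubst (θ : LVar n → Option (Term n)) (xs ws : List ℕ) (t : Term n) (v : LVar n) :
    (splitSubst xs ws t v).map (Term.subst θ) = splitSubst xs ws (t.subst θ) v := by
  have hc : (Term.comps (xs.length + ws.length) t).map (Term.subst θ) =
      Term.comps (xs.length + ws.length) (t.subst θ) := by
    simp only [Term.comps, List.map_map, List.map_inj_left, Function.comp_apply, Term.comp]
    intro i _
    split_ifs <;> rfl
  rcases v with (i | w) | w | s | ⟨a, p⟩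
  · rw [splitSubst_x, splitSubst_x, ← hc, bindX, bindX, lookup_zip_map]
  · rw [splitSubst_rd, splitSubst_rd, ← hc, bindW, bindW, ← List.map_drop, lookup_zip_map]
  · rw [splitSubst_avar, splitSubst_avar, ← hc, bindW, bindW, ← List.map_drop, lookup_zip_map]
  · rfl
  · rfl

/-- Both substitutions merge into one simultaneous substitution, in which the components of the
substituted `t` take precedence. In this form the induction hypothesis for the body of a `split`
applies. -/
theorem Term.subst_splitSubst (θ : LVar n → Option (Term n)) (xs ws : List ℕ) (t u : Term n) :
    (u.subst (splitSubst xs ws t)).subst θ =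
      u.subst fun v => (splitSubst xs ws (t.subst θ) v).or (θ v) := by
  rw [Term.subst_subst]
  simp only [map_splitSubst]

-- Typed paths simplify to normal forms

/-- The terms substituted for variables simplify to normal forms of the types in the contexts. -/
def SubstSimplifies (Γ : NVar → Option Ty) (Δ : ℕ → Option Ty)
    (θ : LVar n → Option (Term n)) : Prop :=
  (∀ x τ, Γ x = some τ → ∃ t, θ (.nvar x) = some t ∧ Simplifies τ t) ∧
    (∀ w τ, Δ w = some τ → ∃ t, θ (.avar w) = some t ∧ Simplifies τ t) ∧ ∀ s, θ (.y s) = none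

theorem SubstSimplifies.left {Γ : NVar → Option Ty} {Δ Δ₁ Δ₂ : ℕ → Option Ty}
    {θ : LVar n → Option (Term n)} (h : SubstSimplifies Γ Δ θ) (hs : Splits Δ Δ₁ Δ₂) :
    SubstSimplifies Γ Δ₁ θ :=
  ⟨h.1, fun w τ hw => h.2.1 w τ (hs.1 w τ hw), h.2.2⟩

theorem SubstSimplifies.right {Γ : NVar → Option Ty} {Δ Δ₁ Δ₂ : ℕ → Option Ty}
    {θ : LVar n → Option (Term n)} (h : SubstSimplifies Γ Δ θ) (hs : Splits Δ Δ₁ Δ₂) :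
    SubstSimplifies Γ Δ₂ θ :=
  ⟨h.1, fun w τ hw => h.2.1 w τ (hs.2.1 w τ hw), h.2.2⟩

/-- An affine variable and its read-only copy receive the same component; its normal form also
serves for the read-only type. -/
theorem SubstSimplifies.split {Γ : NVar → Option Ty} {Δ : ℕ → Option Ty}
    {θ : LVar n → Option (Term n)} (h : SubstSimplifies Γ Δ θ) {xs ws : List ℕ} {τs : List Ty}
    (hl : τs.length = xs.length + ws.length) {t : Term n} (ht : Simplifies (Ty.mkProd τs) t) :
    SubstSimplifies (extN Γ xs ws τs) (extA Δ xs ws τs)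
      fun v => (splitSubst xs ws t v).or (θ v) := by
  have hcomps := Simplifies.comps ht
  rw [hl] at hcomps
  refine ⟨?_, ?_, fun s => by simp [h.2.2]⟩
  · rintro (i | w) τ hτ
    · have hr := bindX_rel xs hcomps i
      simp only [splitSubst_x]
      simp only [extN] at hτ
      cases hb : bindX xs τs i with
      | none =>
        rw [hb] at hr hτ
        cases hc : bindX xs (Term.comps (xs.length + ws.length) t) i with
        | some _ => rw [hc] at hr; cases hr
        | none => simpa [hc] using h.1 _ _ hτ
      | some τ' =>
        rw [hb] at hr hτ
        obtain rfl : τ' = τ := by simpa using hτ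
        cases hc : bindX xs (Term.comps (xs.length + ws.length) t) i with
        | none => rw [hc] at hr; cases hr
        | some u => rw [hc] at hr; cases hr with | some hr => exact ⟨u, by simp, hr⟩
    · have hr := bindW_rel xs ws hcomps w
      simp only [splitSubst_rd]
      simp only [extN] at hτ
      cases hb : bindW xs ws τs w with
      | none =>
        rw [hb] at hr hτ
        cases hc : bindW xs ws (Term.comps (xs.length + ws.length) t) w with
        | some _ => rw [hc] at hr; cases hr
        | none => simpa [hc] using h.1 _ _ hτ
      | some τ' =>
        rw [hb] at hr hτ
        obtain rfl : τ'.rd = τ := by simpa using hτ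
        cases hc : bindW xs ws (Term.comps (xs.length + ws.length) t) w with
        | none => rw [hc] at hr; cases hr
        | some u => rw [hc] at hr; cases hr with | some hr => exact ⟨u, by simp, hr.rd⟩
  · intro w τ hτ
    have hr := bindW_rel xs ws hcomps w
    simp only [splitSubst_avar]
    simp only [extA] at hτ
    cases hb : bindW xs ws τs w with
    | none =>
      rw [hb] at hr hτ
      cases hc : bindW xs ws (Term.comps (xs.length + ws.length) t) w with
      | some _ => rw [hc] at hr; cases hr
      | none => simpa [hc] using h.2.1 _ _ hτ
    | some τ' =>
      rw [hb] at hr hτ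
      obtain rfl : τ' = τ := by simpa using hτ
      cases hc : bindW xs ws (Term.comps (xs.length + ws.length) t) w with
      | none => rw [hc] at hr; cases hr
      | some u => rw [hc] at hr; cases hr with | some hr => exact ⟨u, by simp, hr⟩

/-- The points occurring in values of a list of expressions. -/
def Expr.pointsL (es : List (Expr n)) : List ℝ :=
  Expr.collectL Val.points [] (fun _ => []) es

theorem simplifies_constrL {θ : LVar n → Option (Term n)} {bs : List (Path n)}
    (h : ∀ b ∈ bs, (b.constr.mapTerms (Term.subst θ)).Simplifies) :
    ((Path.constrL bs).mapTerms (Term.subst θ)).Simplifies := by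
  induction bs with
  | nil => exact .tru
  | cons b bs ih => exact .and (h b (by simp)) (ih fun c hc => h c (by simp [hc]))

mutual
-- ρ(b) alone need not simplify to a normal form: in the body of a `split`, projections and
-- endpoints may be applied to variables and cannot be computed before the components are
-- substituted. The induction is therefore about `b.rho.subst θ`, for any `θ` that supplies terms
-- simplifying to normal forms of the right types.
theorem HasTy.simplifies : ∀ {Γ : NVar → Option Ty} {Δ : ℕ → Option Ty} {e : Expr n} {τ : Ty},
    HasTy Γ Δ e τ → ∀ (θ : LVar n → Option (Term n)) (b : Path n), b ∈ e.paths →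
    (∀ r ∈ e.points, r = 0 ∨ r = 1) → SubstSimplifies Γ Δ θ →
    Simplifies τ (b.rho.subst θ) ∧ (b.constr.mapTerms (Term.subst θ)).Simplifies
  | _, _, _, _, .val Γ Δ v, θ, b, hb, hp, hθ => by
    simp only [Expr.paths, List.mem_singleton] at hb
    subst hb
    rw [Path.rho, Val.subst_toTerm]
    exact ⟨v.simplifies_toTerm hp, .tru⟩
  | _, _, _, _, .nvar h, θ, b, hb, hp, hθ => by
    simp only [Expr.paths, List.mem_singleton] at hb
    subst hb
    obtain ⟨t, ht, ht'⟩ := hθ.1 _ _ h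
    exact ⟨by simpa [Path.rho, Term.subst, ht] using ht', .tru⟩
  | _, _, _, _, .avar h, θ, b, hb, hp, hθ => by
    simp only [Expr.paths, List.mem_singleton] at hb
    subst hb
    obtain ⟨t, ht, ht'⟩ := hθ.2.1 _ _ h
    exact ⟨by simpa [Path.rho, Term.subst, ht] using ht', .tru⟩
  | _, _, _, _, .tup h, θ, b, hb, hp, hθ => by
    simp only [Expr.paths, List.mem_map] at hb
    obtain ⟨bs, hbs, rfl⟩ := hb
    obtain ⟨hr, hc⟩ := HasTys.simplifies h θ bs hbs hp hθ
    exact ⟨by rw [Path.rho, Term.subst_mkTup]; exact .mkTup hr,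
      simplifies_constrL hc⟩
  | _, _, _, _, .split hs _ _ hl _ h₁ h₂, θ, b, hb, hp, hθ => by
    simp only [Expr.paths, mem_combine] at hb
    obtain ⟨b₁, hb₁, b₂, hb₂, rfl⟩ := hb
    have hp' := List.forall_mem_append.1 hp
    obtain ⟨hr₁, hc₁⟩ := HasTy.simplifies h₁ θ b₁ hb₁ hp'.1 (hθ.left hs)
    obtain ⟨hr₂, hc₂⟩ := HasTy.simplifies h₂ _ b₂ hb₂ hp'.2 ((hθ.right hs).split hl hr₁)
    refine ⟨by rw [Path.rho, Term.subst_splitSubst]; exact hr₂, .and hc₁ ?_⟩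
    rw [Formula.mapTerms_mapTerms]
    simp only [Term.subst_splitSubst]
    exact hc₂
  | _, _, _, _, .ite hs h₁ h₂ h₃, θ, b, hb, hp, hθ => by
    simp only [Expr.paths, List.mem_append, mem_combine] at hb
    have hp₁₂ := List.forall_mem_append.1 hp
    have hp' := List.forall_mem_append.1 hp₁₂.1
    obtain ⟨b₁, hb₁, b₂, hb₂, rfl⟩ | ⟨b₁, hb₁, b₂, hb₂, rfl⟩ := hb
    · obtain ⟨hr₁, hc₁⟩ := HasTy.simplifies h₁ θ b₁ hb₁ hp'.1 (hθ.left hs)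
      obtain ⟨hr₂, hc₂⟩ := HasTy.simplifies h₂ θ b₂ hb₂ hp'.2 (hθ.right hs)
      exact ⟨hr₂, .and (.isTrue hr₁) (.and hc₁ hc₂)⟩
    · obtain ⟨hr₁, hc₁⟩ := HasTy.simplifies h₁ θ b₁ hb₁ hp'.1 (hθ.left hs)
      obtain ⟨hr₂, hc₂⟩ := HasTy.simplifies h₃ θ b₂ hb₂ hp₁₂.2 (hθ.right hs)
      exact ⟨hr₂, .and (.isTrue (Simplifies.op (o := .not) (.cons hr₁ .nil)))
        (.and (.and hc₁ .tru) hc₂)⟩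
  | _, _, _, _, .op h, θ, b, hb, hp, hθ => by
    simp only [Expr.paths, List.mem_map] at hb
    obtain ⟨bs, hbs, rfl⟩ := hb
    obtain ⟨hr, hc⟩ := HasTys.simplifies h θ bs hbs hp hθ
    exact ⟨by rw [Path.rho, Term.subst, Term.substL_eq_map]; exact .op hr,
      simplifies_constrL hc⟩
  | _, _, _, _, .cake Γ Δ, θ, b, hb, hp, hθ => by
    simp only [Expr.paths, List.mem_singleton] at hb
    subst hb
    exact ⟨.intvl (.pt (.inl rfl)) (.pt (.inr rfl)), .tru⟩
  | _, _, _, _, .div h, θ, b, hb, hp, hθ => by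
    simp only [Expr.paths, mem_combine] at hb
    obtain ⟨b₁, hb₁, b₂, hb₂, rfl⟩ := hb
    obtain ⟨hr, hc⟩ := HasTys.simplifies h θ [b₁, b₂]
      (Path.mem_pathsL_pair.2 ⟨b₁, hb₁, b₂, hb₂, rfl⟩)
      (by simpa [Expr.pointsL, Expr.collectL, Expr.points, Expr.collect] using hp) hθ
    rcases hr with _ | ⟨hr₁, _ | ⟨hr₂, -⟩⟩
    have hc₁ := hc b₁ (by simp)
    have hc₂ := hc b₂ (by simp)
    refine ⟨Simplifies.tup (.cons (.intvl hr₁.rd.lft hr₂) (.cons (.intvl hr₂ hr₁.rd.rgt) .nil)),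
      .and hc₁ (.and hc₂ (.and (.ptGe hr₂ hr₁.rd.lft) (.ptGe hr₁.rd.rgt hr₂)))⟩
  | _, _, _, _, .piece h, θ, b, hb, hp, hθ => by
    simp only [Expr.paths, List.mem_map] at hb
    obtain ⟨bs, hbs, rfl⟩ := hb
    obtain ⟨hr, hc⟩ := HasTys.simplifies h θ bs hbs hp hθ
    exact ⟨by rw [Path.rho, Term.subst, Term.substL_eq_map]; exact .union hr,
      simplifies_constrL hc⟩
  | _, _, _, _, .mark (s := s) (a := a) h, θ, b, hb, hp, hθ => by
    simp only [Expr.paths, mem_combine] at hb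
    obtain ⟨b₁, hb₁, b₂, hb₂, rfl⟩ := hb
    obtain ⟨hr, hc⟩ := HasTys.simplifies h θ [b₁, b₂]
      (Path.mem_pathsL_pair.2 ⟨b₁, hb₁, b₂, hb₂, rfl⟩)
      (by simpa [Expr.pointsL, Expr.collectL, Expr.points, Expr.collect] using hp) hθ
    rcases hr with _ | ⟨hr₁, _ | ⟨hr₂, -⟩⟩
    have hc₁ := hc b₁ (by simp)
    have hc₂ := hc b₂ (by simp)
    have hs : Term.subst θ (.var (.y s)) = .var (.y s) := by simp [Term.subst, hθ.2.2]
    refine ⟨by rw [Path.rho, hs]; exact .y s, .and hc₁ (.and hc₂ (.vEq ?_ hr₂))⟩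
    rw [Term.subst, Term.subst, hs]
    exact .val a (.inl (Simplifies.intvl hr₁.lft (.y s)).rd)
  | _, _, _, _, .evalIntvl h, θ, b, hb, hp, hθ => by
    simp only [Expr.paths, List.mem_map] at hb
    obtain ⟨b, hb, rfl⟩ := hb
    obtain ⟨hr, hc⟩ := HasTy.simplifies h θ b hb hp hθ
    exact ⟨.val _ (.inl hr), hc⟩
  | _, _, _, _, .evalPiece h, θ, b, hb, hp, hθ => by
    simp only [Expr.paths, List.mem_map] at hb
    obtain ⟨b, hb, rfl⟩ := hb
    obtain ⟨hr, hc⟩ := HasTy.simplifies h θ b hb hp hθ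
    exact ⟨.val _ (.inr hr), hc⟩
theorem HasTys.simplifies : ∀ {Γ : NVar → Option Ty} {Δ : ℕ → Option Ty} {es : List (Expr n)}
    {τs : List Ty}, HasTys Γ Δ es τs → ∀ (θ : LVar n → Option (Term n)) (bs : List (Path n)),
    bs ∈ Expr.pathsL es → (∀ r ∈ Expr.pointsL es, r = 0 ∨ r = 1) → SubstSimplifies Γ Δ θ →
    List.Forall₂ Simplifies τs ((Path.rhoL bs).map (Term.subst θ)) ∧
      ∀ b ∈ bs, (b.constr.mapTerms (Term.subst θ)).Simplifies
  | _, _, _, _, .nil Γ Δ, θ, bs, hbs, hp, hθ => by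
    simp only [Expr.pathsL, List.mem_singleton] at hbs
    subst hbs
    exact ⟨.nil, by simp⟩
  | _, _, _, _, .cons hs h₁ h₂, θ, bs, hbs, hp, hθ => by
    simp only [Expr.pathsL, mem_combine] at hbs
    obtain ⟨b, hb, bs, hbs, rfl⟩ := hbs
    have hp' := List.forall_mem_append.1 hp
    obtain ⟨hr₁, hc₁⟩ := HasTy.simplifies h₁ θ b hb hp'.1 (hθ.left hs)
    obtain ⟨hr₂, hc₂⟩ := HasTys.simplifies h₂ θ bs hbs hp'.2 (hθ.right hs)
    exact ⟨.cons hr₁ hr₂, List.forall_mem_cons.2 ⟨hc₁, hc₂⟩⟩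
end

/-- The result and the constraint of a path of a closed expression simplify to normal forms. -/
theorem Path.simplifies {e : Expr n} {τ : Ty} (hty : e.HasType τ)
    (hp : ∀ r ∈ e.points, r = 0 ∨ r = 1) {b : Path n} (hb : b ∈ e.paths) :
    Slice.Simplifies τ b.rho ∧ b.constr.Simplifies := by
  have := HasTy.simplifies hty (fun _ => none) b hb hp ⟨by simp, by simp, fun _ => rfl⟩
  rwa [Term.subst_none, Formula.mapTerms_id Term.subst_none] at this

/-! ### Free variables -/

theorem Term.ysL_subset {ts : List (Term n)} {Y : Finset ℕ} :
    Term.ysL ts ⊆ Y ↔ ∀ t ∈ ts, t.ys ⊆ Y := by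
  induction ts with
  | nil => simp [Term.ysL]
  | cons t ts ih => simp [Term.ysL, Finset.union_subset_iff, ih]

mutual
theorem Term.ys_simpl : ∀ t : Term n, t.simpl.ys ⊆ t.ys
  | .var v => by rw [Term.simpl]
  | .bool _ => by rw [Term.simpl]
  | .pt _ => by rw [Term.simpl]
  | .real _ => by rw [Term.simpl]
  | .op _ ts => by simpa [Term.simpl, Term.ys] using Term.ysL_simplL ts
  | .lft t => by
    have h := Term.ys_simpl t
    rw [Term.simpl, Term.ys]
    split
    · rename_i he
      rw [he, Term.ys] at h
      exact Finset.union_subset_left h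
    · rwa [Term.ys]
  | .rgt t => by
    have h := Term.ys_simpl t
    rw [Term.simpl, Term.ys]
    split
    · rename_i he
      rw [he, Term.ys] at h
      exact Finset.union_subset_right h
    · rwa [Term.ys]
  | .intvl t u => by
    simpa [Term.simpl, Term.ys] using Finset.union_subset_union (Term.ys_simpl t) (Term.ys_simpl u)
  | .union ts => by simpa [Term.simpl, Term.ys] using Term.ysL_simplL ts
  | .val _ t => by simpa [Term.simpl, Term.ys] using Term.ys_simpl t
  | .tup ts => by simpa [Term.simpl, Term.ys] using Term.ysL_simplL ts
  | .proj k t => by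
    have h := Term.ys_simpl t
    rw [Term.simpl, Term.ys]
    split
    · rename_i us he
      rw [he, Term.ys] at h
      by_cases hk : k < us.length
      · rw [List.getD_eq_getElem _ _ hk]
        exact Term.ysL_subset.1 h _ (List.getElem_mem hk)
      -- An index out of range leaves the projection uncomputed, with the same variables.
      · rw [List.getD_eq_default _ _ (by omega)]
        simpa [Term.ys] using h
    · rwa [Term.ys]
theorem Term.ysL_simplL : ∀ ts : List (Term n), Term.ysL (Term.simplL ts) ⊆ Term.ysL ts
  | [] => by rw [Term.simplL]
  | t :: ts => by
    simpa [Term.simplL, Term.ysL] using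
      Finset.union_subset_union (Term.ys_simpl t) (Term.ysL_simplL ts)
end

theorem Term.ys_toFormula (t : Term n) : t.toFormula.ys ⊆ t.ys := by
  induction t using Term.toFormula.induct <;>
    simp_all [Term.toFormula, Formula.ys, Term.ys, Term.ysL, Finset.union_subset_union]

theorem Formula.ys_simpl (φ : Formula n) : φ.simpl.ys ⊆ φ.ys := by
  induction φ with
  | tru => simp [Formula.simpl]
  | fls => simp [Formula.simpl]
  | isTrue t => exact (Term.ys_toFormula _).trans (Term.ys_simpl t)
  | ge t u => exact Finset.union_subset_union (Term.ys_simpl t) (Term.ys_simpl u)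
  | eq t u => exact Finset.union_subset_union (Term.ys_simpl t) (Term.ys_simpl u)
  | not φ ih => exact ih
  | and φ χ h₁ h₂ => exact Finset.union_subset_union h₁ h₂
  | or φ χ h₁ h₂ => exact Finset.union_subset_union h₁ h₂
  | imp φ χ h₁ h₂ => exact Finset.union_subset_union h₁ h₂
  | all s φ ih => exact Finset.erase_subset_erase s ih

/-- `Y` collects the marks that `f` may introduce. For a replacement these are the elements of S,
which can be missing from the term being replaced. -/
theorem Formula.ys_mapTerms {f : Term n → Term n} {Y : Finset ℕ}
    (hf : ∀ t, (f t).ys ⊆ t.ys ∪ Y) (φ : Formula n) : (φ.mapTerms f).ys ⊆ φ.ys ∪ Y := by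
  have hu {A B A' B' : Finset ℕ} (hA : A ⊆ A' ∪ Y) (hB : B ⊆ B' ∪ Y) : A ∪ B ⊆ A' ∪ B' ∪ Y := by
    rw [Finset.union_union_distrib_right]
    exact Finset.union_subset_union hA hB
  induction φ with
  | tru => simp [Formula.mapTerms, Formula.ys]
  | fls => simp [Formula.mapTerms, Formula.ys]
  | isTrue t => exact hf t
  | ge t u => exact hu (hf t) (hf u)
  | eq t u => exact hu (hf t) (hf u)
  | not φ ih => exact ih
  | and φ χ h₁ h₂ => exact hu h₁ h₂
  | or φ χ h₁ h₂ => exact hu h₁ h₂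
  | imp φ χ h₁ h₂ => exact hu h₁ h₂
  | all s φ ih =>
    intro x hx
    rw [Formula.mapTerms, Formula.ys, Finset.mem_erase] at hx
    have := ih hx.2
    simp only [Finset.mem_union, Formula.ys, Finset.mem_erase] at this ⊢
    tauto

theorem Term.ys_sum {ts : List (Term n)} {Y : Finset ℕ} (h : ∀ t ∈ ts, t.ys ⊆ Y) :
    (Term.sum ts).ys ⊆ Y := by
  induction ts with
  | nil => simp [Term.sum, Term.ys]
  | cons t ts ih =>
    simp only [List.mem_cons, forall_eq_or_imp] at h
    simp only [Term.sum, Term.add, Term.ys, Term.ysL, Finset.union_empty]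
    exact Finset.union_subset h.1 (ih h.2)

/-- The variables `y_s` in an ordered list of atoms are in `Y`. -/
def AtomsIn (S : List PtAtom) (Y : Finset ℕ) : Prop := ∀ s, PtAtom.y s ∈ S → s ∈ Y

theorem AtomsIn.ys_toTerm {S : List PtAtom} {Y : Finset ℕ} (h : AtomsIn S Y) {p : PtAtom}
    (hp : p ∈ S) : (p.toTerm : Term n).ys ⊆ Y := by
  cases p with
  | zero => simp [PtAtom.toTerm, Term.ys]
  | one => simp [PtAtom.toTerm, Term.ys]
  | y s => simpa [PtAtom.toTerm, Term.ys] using h s hp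

theorem AtomsIn.ys_gap {S : List PtAtom} {Y : Finset ℕ} (h : AtomsIn S Y) (a : Fin n)
    {p : PtAtom} (hp : p ∈ S) : (gap a p).ys ⊆ Y := by
  simpa [gap, Term.add, Term.smul, Term.ys, Term.ysL] using h.ys_toTerm hp

theorem restrict_subset (S : List PtAtom) (t : Term n) : restrict S t ⊆ S := by
  cases t <;> exact fun _ => List.mem_of_mem_filter

mutual
theorem Term.ys_repl {S : List PtAtom} {Y : Finset ℕ} (hS : AtomsIn S Y) :
    ∀ t : Term n, (t.repl S).ys ⊆ t.ys ∪ Y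
  | .val a t => by
    rw [Term.repl]
    refine (Term.ys_sum fun u hu => ?_).trans Finset.subset_union_right
    obtain ⟨p, hp, rfl⟩ := List.mem_map.1 hu
    exact hS.ys_gap a (restrict_subset S t hp)
  | .op o ts => by simpa [Term.repl, Term.ys] using Term.ysL_replL hS ts
  | .var _ => by rw [Term.repl]; exacts [Finset.subset_union_left, by simp, by simp]
  | .bool _ => by simp [Term.repl]
  | .pt _ => by simp [Term.repl]
  | .real _ => by simp [Term.repl]
  | .lft _ => by simp [Term.repl]
  | .rgt _ => by simp [Term.repl]
  | .intvl _ _ => by simp [Term.repl]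
  | .union _ => by simp [Term.repl]
  | .tup _ => by simp [Term.repl]
  | .proj _ _ => by simp [Term.repl]
theorem Term.ysL_replL {S : List PtAtom} {Y : Finset ℕ} (hS : AtomsIn S Y) :
    ∀ ts : List (Term n), Term.ysL (Term.replL S ts) ⊆ Term.ysL ts ∪ Y
  | [] => by simp [Term.replL, Term.ysL]
  | t :: ts => by
    rw [Term.replL, Term.ysL, Term.ysL, Finset.union_union_distrib_right]
    exact Finset.union_subset_union (Term.ys_repl hS t) (Term.ysL_replL hS ts)
end

theorem Formula.ys_conj {φs : List (Formula n)} {Y : Finset ℕ} :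
    (Formula.conj φs).ys ⊆ Y ↔ ∀ φ ∈ φs, φ.ys ⊆ Y := by
  induction φs with
  | nil => simp [Formula.conj, Formula.ys]
  | cons φ φs ih => simp [Formula.conj, Formula.ys, Finset.union_subset_iff, ih]

theorem ys_chain {ts : List (Term n)} {Y : Finset ℕ} (h : ∀ t ∈ ts, t.ys ⊆ Y) :
    (chain ts).ys ⊆ Y := by
  induction ts with
  | nil => simp [chain, Formula.ys]
  | cons t ts ih =>
    cases ts with
    | nil => simp [chain, Formula.ys]
    | cons u ts =>
      simp only [chain, Formula.ys]
      exact Finset.union_subset (Finset.union_subset (h u (by simp)) (h t (by simp)))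
        (ih fun v hv => h v (List.mem_cons_of_mem _ hv))

/-- The elements of `S` other than `0`. -/
abbrev nonzero (S : List PtAtom) : List PtAtom := S.filter fun p => p ≠ .zero

/-- The ordering part of `ψ(S)` for the agent `a`. -/
abbrev chainFormula (S : List PtAtom) (a : Fin n) : Formula n :=
  chain (.pt 0 :: ((nonzero S).flatMap fun p => [.var (.z a p), p.toTerm]) ++ [.pt 1])

theorem psi_eq (S : List PtAtom) : psi n S =
    .conj ((List.finRange n).flatMap fun a => (List.finRange n).map fun a' =>
      .and (chainFormula S a) (.eq (Term.sum ((nonzero S).map (gap a)))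
        (Term.sum ((nonzero S).map (gap a'))))) := rfl

theorem mem_psi_conjuncts {S : List PtAtom} {φ : Formula n} :
    φ ∈ ((List.finRange n).flatMap fun a => (List.finRange n).map fun a' =>
      Formula.and (chainFormula S a) (.eq (Term.sum ((nonzero S).map (gap a)))
        (Term.sum ((nonzero S).map (gap a'))))) ↔
    ∃ a a' : Fin n, Formula.and (chainFormula S a) (.eq (Term.sum ((nonzero S).map (gap a)))
        (Term.sum ((nonzero S).map (gap a')))) = φ := by
  simp

theorem ys_psi {S : List PtAtom} {Y : Finset ℕ} (hS : AtomsIn S Y) : (psi n S).ys ⊆ Y := by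
  rw [psi_eq, Formula.ys_conj]
  intro φ hφ
  obtain ⟨a, a', rfl⟩ := mem_psi_conjuncts.1 hφ
  have hsum (a : Fin n) : (Term.sum ((nonzero S).map (gap a))).ys ⊆ Y := by
    refine Term.ys_sum fun t ht => ?_
    obtain ⟨p, hp, rfl⟩ := List.mem_map.1 ht
    exact hS.ys_gap a (List.mem_of_mem_filter hp)
  refine Finset.union_subset (ys_chain fun t ht => ?_)
    (Finset.union_subset (hsum a) (hsum a'))
  simp only [List.cons_append, List.mem_cons, List.mem_append, List.mem_flatMap,
    List.not_mem_nil, or_false] at ht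
  obtain rfl | ⟨p, hp, rfl | rfl⟩ | rfl := ht
  · simp [Term.ys]
  · simp [Term.ys]
  · exact hS.ys_toTerm (List.mem_of_mem_filter hp)
  · simp [Term.ys]

theorem ys_envyFormula (t : Term n) : (envyFormula t).ys ⊆ t.ys := by
  rw [envyFormula_eq, Formula.ys_conj]
  intro φ hφ
  simp only [List.mem_flatMap, List.mem_map, List.mem_finRange, true_and] at hφ
  obtain ⟨a, a', rfl⟩ := hφ
  have hc (i : ℕ) : (t.comp n i).ys ⊆ t.ys := by
    unfold Term.comp; split_ifs <;> simp [Term.ys]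
  exact Finset.union_subset (hc _) (hc _)

theorem Formula.ys_allOver (Y : Finset ℕ) (φ : Formula n) : (φ.allOver Y).ys = φ.ys \ Y := by
  have h (l : List ℕ) : (l.foldr Formula.all φ).ys = φ.ys \ l.toFinset := by
    induction l with
    | nil => simp
    | cons s l ih =>
      rw [List.foldr_cons, Formula.ys, ih, List.toFinset_cons, Finset.sdiff_insert]
  rw [Formula.allOver, h, Finset.sort_toFinset]

theorem mem_replacements {Y : Finset ℕ} {S : List PtAtom} : S ∈ replacements Y ↔
    ∃ l : List ℕ, l.Perm (Y.sort (· ≤ ·)) ∧ S = .zero :: l.map .y ++ [.one] := by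
  simp [replacements, List.mem_permutations, eq_comm]

theorem atomsIn_of_mem_replacements {Y : Finset ℕ} {S : List PtAtom} (h : S ∈ replacements Y) :
    AtomsIn S Y := by
  obtain ⟨l, hl, rfl⟩ := mem_replacements.1 h
  intro s hs
  simpa [hl.mem_iff] using hs

/-! ### The reduced formula is closed and linear -/

/-- The conjunct of the reduced formula for a path and a replacement, without its quantifiers. -/
noncomputable abbrev Path.matrix (b : Path n) (S : List PtAtom) : Formula n :=
  Formula.repl S (Formula.simpl (.imp (.and b.constr (psi n S)) (envyFormula b.rho)))

theorem Path.ys_matrix {b : Path n} {S : List PtAtom} (hS : S ∈ replacements b.ys) :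
    (b.matrix S).ys ⊆ b.ys := by
  have hA := atomsIn_of_mem_replacements hS
  refine (Formula.ys_mapTerms (Term.ys_repl hA) _).trans (Finset.union_subset ?_ subset_rfl)
  refine (Formula.ys_simpl _).trans (Finset.union_subset (Finset.union_subset ?_ (ys_psi hA)) ?_)
  · exact Finset.subset_union_left
  · exact (ys_envyFormula _).trans Finset.subset_union_right

theorem Expr.mem_reduced_conjuncts {e : Expr n} {φ : Formula n} :
    (φ ∈ e.paths.flatMap fun b => (replacements b.ys).map fun S =>
      Formula.allOver b.ys (b.matrix S)) ↔
    ∃ b ∈ e.paths, ∃ S ∈ replacements b.ys, (b.matrix S).allOver b.ys = φ := by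
  simp

theorem Expr.reduced_eq (e : Expr n) : e.reduced =
    .conj (e.paths.flatMap fun b => (replacements b.ys).map fun S =>
      Formula.allOver b.ys (b.matrix S)) := rfl

theorem Expr.ys_reduced (e : Expr n) : e.reduced.ys = ∅ := by
  rw [← Finset.subset_empty, Expr.reduced_eq, Formula.ys_conj]
  intro φ hφ
  obtain ⟨b, hb, S, hS, rfl⟩ := Expr.mem_reduced_conjuncts.1 hφ
  rw [Formula.ys_allOver, Finset.sdiff_eq_empty_iff_subset.2 (Path.ys_matrix hS)]

theorem Formula.isLRA_conj {φs : List (Formula n)} :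
    (Formula.conj φs).IsLRA ↔ ∀ φ ∈ φs, φ.IsLRA := by
  induction φs with
  | nil => simp [Formula.conj, Formula.IsLRA]
  | cons φ φs ih => simp [Formula.conj, Formula.IsLRA, ih]

theorem Formula.isLRA_allOver (Y : Finset ℕ) (φ : Formula n) :
    (φ.allOver Y).IsLRA ↔ φ.IsLRA := by
  unfold Formula.allOver
  induction Y.sort (· ≤ ·) with
  | nil => simp
  | cons s l ih => simpa [Formula.IsLRA] using ih

theorem isLinear_gap (a : Fin n) (p : PtAtom) : (gap a p).IsLinear := by
  refine .add ?_ (.smul _ (.z a p))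
  cases p
  exacts [.pt 0, .pt 1, .y _]

theorem Term.isLinear_sum {ts : List (Term n)} (h : ∀ t ∈ ts, t.IsLinear) :
    (Term.sum ts).IsLinear := by
  induction ts with
  | nil => exact .real 0
  | cons t ts ih => exact .add (h t (by simp)) (ih fun u hu => h u (by simp [hu]))

theorem isLinear_sum_gap (a : Fin n) (ps : List PtAtom) :
    (Term.sum (ps.map (gap a))).IsLinear :=
  Term.isLinear_sum fun t ht => by
    obtain ⟨p, -, rfl⟩ := List.mem_map.1 ht
    exact isLinear_gap a p

theorem isLRA_chain {ts : List (Term n)} (h : ∀ t ∈ ts, t.IsLinear) : (chain ts).IsLRA := by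
  induction ts with
  | nil => simp [chain, Formula.IsLRA]
  | cons t ts ih =>
    cases ts with
    | nil => simp [chain, Formula.IsLRA]
    | cons u ts =>
      exact ⟨⟨h u (by simp), h t (by simp)⟩, ih fun v hv => h v (List.mem_cons_of_mem _ hv)⟩

theorem isLRA_psi (S : List PtAtom) : (psi n S).IsLRA := by
  rw [psi_eq, Formula.isLRA_conj]
  intro φ hφ
  obtain ⟨a, a', rfl⟩ := mem_psi_conjuncts.1 hφ
  refine ⟨isLRA_chain fun t ht => ?_, isLinear_sum_gap _ _, isLinear_sum_gap _ _⟩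
  simp only [List.cons_append, List.mem_cons, List.mem_append, List.mem_flatMap,
    List.not_mem_nil, or_false] at ht
  obtain rfl | ⟨p, hp, rfl | rfl⟩ | rfl := ht
  · exact .pt 0
  · exact .z a p
  · cases p
    exacts [.pt 0, .pt 1, .y _]
  · exact .pt 1

theorem IsPointNf.repl {t : Term n} (h : IsPointNf t) (S : List PtAtom) : t.repl S = t := by
  cases h <;> simp [Term.repl]

theorem IsPointNf.isLinear {t : Term n} (h : IsPointNf t) : t.IsLinear := by
  cases h
  exacts [.pt 0, .pt 1, .y _]

theorem IsVltnNf.isLinear_repl {t : Term n} (h : IsVltnNf t) (S : List PtAtom) :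
    (t.repl S).IsLinear := by
  induction h with
  | zero => simpa [Term.repl] using .real 0
  | val a _ => simpa [Term.repl] using isLinear_sum_gap a _
  | add _ _ h₁ h₂ => simpa [Term.repl, Term.replL] using .add h₁ h₂
  | smul r _ h => simpa [Term.repl, Term.replL] using .smul r h

theorem Formula.IsNf.isLRA_repl {φ : Formula n} (h : φ.IsNf) (S : List PtAtom) :
    (φ.repl S).IsLRA := by
  induction h with
  | tru => trivial
  | fls => trivial
  | ptGe h₁ h₂ =>
    exact ⟨by rw [h₁.repl]; exact h₁.isLinear, by rw [h₂.repl]; exact h₂.isLinear⟩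
  | vGe h₁ h₂ => exact ⟨h₁.isLinear_repl S, h₂.isLinear_repl S⟩
  | vEq h₁ h₂ => exact ⟨h₁.isLinear_repl S, h₂.isLinear_repl S⟩
  | not _ h => exact h
  | and _ _ h₁ h₂ => exact ⟨h₁, h₂⟩
  | or _ _ h₁ h₂ => exact ⟨h₁, h₂⟩

/-- A linear formula offers nothing to simplify and nothing to replace. For ψ(S) this means that it
survives R and S unchanged. -/
theorem Formula.IsLRA.simpl_repl {φ : Formula n} (h : φ.IsLRA) (S : List PtAtom) :
    φ.simpl.repl S = φ := by
  have ht {t : Term n} (h : t.IsLinear) : t.simpl.repl S = t := by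
    induction h <;> simp_all [Term.simpl, Term.simplL, Term.repl, Term.replL]
  induction φ <;>
    simp_all [Formula.IsLRA, Formula.simpl, Formula.repl, Formula.mapTerms]

theorem Path.matrix_eq (b : Path n) (S : List PtAtom) : b.matrix S =
    .imp (.and (b.constr.simpl.repl S) (psi n S)) ((envyFormula b.rho).simpl.repl S) := by
  rw [← (isLRA_psi (n := n) S).simpl_repl S]
  rfl

theorem Expr.isLRA_reduced {e : Expr n} (hwf : e.WellFormed) (hty : e.HasType (Ty.alloc n)) :
    e.reduced.IsLRA := by
  rw [Expr.reduced_eq, Formula.isLRA_conj]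
  intro φ hφ
  obtain ⟨b, hb, S, hS, rfl⟩ := Expr.mem_reduced_conjuncts.1 hφ
  obtain ⟨hr, hc⟩ := Path.simplifies hty hwf.points hb
  rw [Formula.isLRA_allOver, Path.matrix_eq]
  exact ⟨⟨hc.1.isLRA_repl S, isLRA_psi S⟩, (simplifies_envyFormula hr).1.isLRA_repl S⟩

/-! ### Validity of the reduced formula -/

/-- The block of quantifiers acts as one quantifier over all mark assignments that agree with the
given one outside `Y`. -/
theorem Formula.holds_allOver {J : Fin n → Set ℝ → ℝ} {α : Assn n} {Y : Finset ℕ}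
    {φ : Formula n} : (φ.allOver Y).Holds J α ↔
      ∀ y : ℕ → ℝ, (∀ s ∉ Y, y s = α.y s) → φ.Holds J { α with y := y } := by
  have h (l : List ℕ) (α : Assn n) : (l.foldr Formula.all φ).Holds J α ↔
      ∀ y : ℕ → ℝ, (∀ s ∉ l, y s = α.y s) → φ.Holds J { α with y := y } := by
    induction l generalizing α with
    | nil =>
      refine ⟨fun h y hy => ?_, fun h => h α.y fun _ _ => rfl⟩
      obtain rfl : y = α.y := funext fun s => hy s (by simp)
      exact h
    | cons s l ih =>
      simp only [List.foldr_cons, Formula.Holds, ih]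
      refine ⟨fun h y hy => h (y s) y fun t ht => ?_, fun h r y hy => h y fun t ht => ?_⟩
      · by_cases hts : t = s
        · simp [hts]
        · rw [Function.update_of_ne hts, hy t (by simp [hts, ht])]
      · rw [List.mem_cons, not_or] at ht
        rw [hy t ht.2, Function.update_of_ne ht.1]
  rw [Formula.allOver, h]
  simp

mutual
theorem Term.den_congr {J : Fin n → Set ℝ → ℝ} {α : Assn n} {y : ℕ → ℝ} : ∀ t : Term n,
    (∀ s ∈ t.ys, y s = α.y s) → t.den J { α with y := y } = t.den J α
  | .var (.nvar _), _ => rfl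
  | .var (.avar _), _ => rfl
  | .var (.y s), h => by simpa [Term.den, Assn.get] using h s (by simp [Term.ys])
  | .var (.z _ _), _ => rfl
  | .bool _, _ => rfl
  | .pt _, _ => rfl
  | .real _, _ => rfl
  | .op _ ts, h => by simp [Term.den, Term.denL_congr ts h]
  | .lft t, h => by simp [Term.den, Term.den_congr t h]
  | .rgt t, h => by simp [Term.den, Term.den_congr t h]
  | .intvl t u, h => by
    rw [Term.ys, Finset.forall_mem_union] at h
    simp [Term.den, Term.den_congr t h.1, Term.den_congr u h.2]
  | .union ts, h => by simp [Term.den, Term.denL_congr ts h]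
  | .val _ t, h => by simp [Term.den, Term.den_congr t h]
  | .tup ts, h => by simp [Term.den, Term.denL_congr ts h]
  | .proj _ t, h => by simp [Term.den, Term.den_congr t h]
theorem Term.denL_congr {J : Fin n → Set ℝ → ℝ} {α : Assn n} {y : ℕ → ℝ} :
    ∀ ts : List (Term n), (∀ s ∈ Term.ysL ts, y s = α.y s) →
    Term.denL J { α with y := y } ts = Term.denL J α ts
  | [], _ => rfl
  | t :: ts, h => by
    rw [Term.ysL, Finset.forall_mem_union] at h
    simp [Term.denL, Term.den_congr t h.1, Term.denL_congr ts h.2]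
end

theorem Formula.holds_congr {J : Fin n → Set ℝ → ℝ} {α : Assn n} {y : ℕ → ℝ} {φ : Formula n}
    (h : ∀ s ∈ φ.ys, y s = α.y s) : φ.Holds J { α with y := y } ↔ φ.Holds J α := by
  induction φ generalizing α y with
  | tru => rfl
  | fls => rfl
  | isTrue t => rw [Formula.Holds, Formula.Holds, Term.den_congr t h]
  | ge t u =>
    rw [Formula.ys, Finset.forall_mem_union] at h
    rw [Formula.Holds, Formula.Holds, Term.den_congr t h.1, Term.den_congr u h.2]
  | eq t u =>
    rw [Formula.ys, Finset.forall_mem_union] at h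
    rw [Formula.Holds, Formula.Holds, Term.den_congr t h.1, Term.den_congr u h.2]
  | not φ ih => exact not_congr (ih h)
  | and φ χ h₁ h₂ =>
    rw [Formula.ys, Finset.forall_mem_union] at h
    exact and_congr (h₁ h.1) (h₂ h.2)
  | or φ χ h₁ h₂ =>
    rw [Formula.ys, Finset.forall_mem_union] at h
    exact or_congr (h₁ h.1) (h₂ h.2)
  | imp φ χ h₁ h₂ =>
    rw [Formula.ys, Finset.forall_mem_union] at h
    exact imp_congr (h₁ h.1) (h₂ h.2)
  | all s φ ih =>
    refine forall_congr' fun r => ih (α := { α with y := Function.update α.y s r })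
      (y := Function.update y s r) fun t ht => ?_
    by_cases hts : t = s
    · simp [hts]
    · simpa [hts] using h t (by simp [Formula.ys, hts, ht])

theorem Expr.holds_matrix_of_valid {e : Expr n} (h : e.reduced.Valid) {b : Path n}
    (hb : b ∈ e.paths) {S : List PtAtom} (hS : S ∈ replacements b.ys) (J : Fin n → Set ℝ → ℝ)
    (α : Assn n) : (b.matrix S).Holds J α := by
  have := h J α
  rw [Expr.reduced_eq, Formula.holds_conj] at this
  exact Formula.holds_allOver.1
    (this _ (Expr.mem_reduced_conjuncts.2 ⟨b, hb, S, hS, rfl⟩)) α.y fun _ _ => rfl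

/-- The marks that do not occur in a path may be taken to be `0`. -/
theorem Expr.valid_of_holds_matrix {e : Expr n} (h : ∀ b ∈ e.paths, ∀ S ∈ replacements b.ys,
    ∀ (J : Fin n → Set ℝ → ℝ) (α : Assn n), (∀ s ∉ b.ys, α.y s = 0) → (b.matrix S).Holds J α) :
    e.reduced.Valid := by
  intro J α
  rw [Expr.reduced_eq, Formula.holds_conj]
  intro φ hφ
  obtain ⟨b, hb, S, hS, rfl⟩ := Expr.mem_reduced_conjuncts.1 hφ
  rw [Formula.holds_allOver]
  intro y hy
  -- Marks absent from the path are reset to 0, so that all marks lie in the cake, as the passage to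
  -- evaluations requires.
  rw [← Formula.holds_congr (y := fun s => if s ∈ b.ys then y s else 0)
    fun s hs => if_pos (Path.ys_matrix hS hs)]
  exact h b hb S hS J _ fun s hs => if_neg hs

open MeasureTheory

/-! ### Pieces -/

theorem isPiece_empty : IsPiece ∅ := ⟨[], by simp, by simp⟩

theorem IsPiece.union {P Q : Set ℝ} (hP : IsPiece P) (hQ : IsPiece Q) : IsPiece (P ∪ Q) := by
  obtain ⟨l, hl, rfl⟩ := hP
  obtain ⟨l', hl', rfl⟩ := hQ
  refine ⟨l ++ l', fun p hp => (List.mem_append.1 hp).elim (hl p) (hl' p), ?_⟩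
  ext x
  simp only [mem_union, mem_iUnion, List.mem_append, exists_prop, or_and_right, exists_or]

theorem isPiece_Icc {l r : ℝ} (hl : 0 ≤ l) (hr : r ≤ 1) : IsPiece (Icc l r) := by
  by_cases h : l ≤ r
  · exact ⟨[(l, r)], by simp [hl, hr, h], by simp⟩
  · rw [Icc_eq_empty h]
    exact isPiece_empty

theorem isPiece_biUnion_list {ι : Type} {f : ι → Set ℝ} {l : List ι}
    (h : ∀ i ∈ l, IsPiece (f i)) : IsPiece (⋃ i ∈ l, f i) := by
  induction l with
  | nil => simpa using isPiece_empty
  | cons i l ih =>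
    have : (⋃ j ∈ i :: l, f j) = f i ∪ ⋃ j ∈ l, f j := by
      ext x; simp
    rw [this]
    exact (h i (by simp)).union (ih fun j hj => h j (by simp [hj]))

theorem isPiece_biUnion_finset {ι : Type} {f : ι → Set ℝ} {T : Finset ι}
    (h : ∀ i ∈ T, IsPiece (f i)) : IsPiece (⋃ i ∈ T, f i) := by
  simpa using isPiece_biUnion_list (l := T.toList) (f := f) (by simpa using h)

theorem IsPiece.isClosed {P : Set ℝ} (hP : IsPiece P) : IsClosed P := by
  obtain ⟨l, -, rfl⟩ := hP
  exact (List.finite_toSet l).isClosed_biUnion fun _ _ => isClosed_Icc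

theorem IsPiece.finite_frontier {P : Set ℝ} (hP : IsPiece P) : (frontier P).Finite := by
  obtain ⟨l, hl, rfl⟩ := hP
  induction l with
  | nil => simp
  | cons p l ih =>
    have : (⋃ q ∈ p :: l, Icc q.1 q.2) = Icc p.1 p.2 ∪ ⋃ q ∈ l, Icc q.1 q.2 := by
      ext x; simp
    rw [this]
    refine Finite.subset (.union (s := {p.1, p.2}) (by simp) (ih fun q hq => hl q (by simp [hq])))
      ((frontier_union_subset _ _).trans (union_subset_union ?_ inter_subset_right))
    rw [frontier_Icc (hl p (by simp)).2.1]
    exact inter_subset_left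

/-- Pieces are closed, and a common point is interior to at most one of them. It therefore lies on
the frontier of the other, and frontiers of pieces are finite. -/
theorem IsPiece.finite_inter {P Q : Set ℝ} (hP : IsPiece P) (hQ : IsPiece Q)
    (h : Disjoint (interior P) (interior Q)) : (P ∩ Q).Finite := by
  refine (hP.finite_frontier.union hQ.finite_frontier).subset fun x hx => ?_
  rw [hP.isClosed.frontier_eq, hQ.isClosed.frontier_eq]
  by_cases hxP : x ∈ interior P
  · exact .inr ⟨hx.2, disjoint_left.1 h hxP⟩
  · exact .inl ⟨hx.1, hxP⟩

/-- A finite set of reals has dense complement, hence empty interior. Additivity may thus be applied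
whenever the overlap is finite, which is easier to check than disjointness of interiors. -/
theorem disjoint_interior_of_finite {P Q : Set ℝ} (h : (P ∩ Q).Finite) :
    Disjoint (interior P) (interior Q) := by
  rw [disjoint_iff_inter_eq_empty, ← interior_inter, interior_eq_empty_iff_dense_compl]
  exact h.countable.dense_compl ℝ

-- Valuations and finite overlaps

theorem Valuation.union (V : Valuation) {P Q : Set ℝ} (hP : IsPiece P) (hQ : IsPiece Q)
    (h : (P ∩ Q).Finite) : V.toFun (P ∪ Q) = V.toFun P + V.toFun Q :=
  V.additive P Q hP hQ (disjoint_interior_of_finite h)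

/-- A finite `P` meets itself in a finite set, so additivity applied to `P ∪ P` gives V(P) = 2 V(P).
-/
theorem Valuation.finite (V : Valuation) {P : Set ℝ} (hP : IsPiece P) (h : P.Finite) :
    V.toFun P = 0 := by
  have := V.union hP hP (by simpa using h)
  rw [union_self] at this
  linarith

theorem Valuation.biUnion (V : Valuation) {ι : Type} {T : Finset ι} {f : ι → Set ℝ}
    (hf : ∀ i ∈ T, IsPiece (f i)) (h : ∀ i ∈ T, ∀ j ∈ T, i ≠ j → (f i ∩ f j).Finite) :
    V.toFun (⋃ i ∈ T, f i) = ∑ i ∈ T, V.toFun (f i) := by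
  classical
  induction T using Finset.induction_on with
  | empty => simpa using V.finite isPiece_empty finite_empty
  | insert i T hi ih =>
    rw [Finset.sum_insert hi, Finset.set_biUnion_insert, V.union (hf i (by simp))
      (isPiece_biUnion_finset fun j hj => hf j (by simp [hj])), ih]
    · exact fun j hj => hf j (by simp [hj])
    · exact fun j hj k hk => h j (by simp [hj]) k (by simp [hk])
    · rw [inter_iUnion₂]
      refine T.finite_toSet.biUnion fun j hj => h i (by simp) j (by simp_all) ?_
      rintro rfl
      exact hi hj

/-! ### Grids -/

/-- The real value of an atom. -/
def PtAtom.value (y : ℕ → ℝ) : PtAtom → ℝ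
  | .zero => 0
  | .one => 1
  | .y s => y s

/-- The predecessor of `p` in `S`. -/
def pred (S : List PtAtom) (p : PtAtom) : PtAtom := S.getD (S.idxOf p - 1) .zero

/-- The interval between the predecessor of `p` and `p`. -/
def cell (S : List PtAtom) (y : ℕ → ℝ) (p : PtAtom) : Set ℝ :=
  Icc ((pred S p).value y) (p.value y)

/-- The order `S` is compatible with the values of the atoms. -/
structure IsGrid (S : List PtAtom) (y : ℕ → ℝ) : Prop where
  nodup : S.Nodup
  head : S.idxOf .zero = 0
  zero_mem : .zero ∈ S
  one_mem : .one ∈ S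
  sorted : S.Pairwise fun p q => p.value y ≤ q.value y
  le_one : ∀ p ∈ S, p.value y ≤ 1

theorem pairwise_iff_idxOf {S : List PtAtom} (hS : S.Nodup) {R : PtAtom → PtAtom → Prop} :
    S.Pairwise R ↔ ∀ p ∈ S, ∀ q ∈ S, S.idxOf p < S.idxOf q → R p q := by
  rw [List.pairwise_iff_getElem]
  constructor
  · intro h p hp q hq hpq
    simpa using h _ _ (List.idxOf_lt_length_of_mem hp) (List.idxOf_lt_length_of_mem hq) hpq
  · intro h i j hi hj hij
    exact h _ (List.getElem_mem hi) _ (List.getElem_mem hj)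
      (by rwa [hS.idxOf_getElem, hS.idxOf_getElem])

theorem pred_mem {S : List PtAtom} {p : PtAtom} (hp : p ∈ S) : pred S p ∈ S := by
  have := List.idxOf_lt_length_of_mem hp
  rw [pred, List.getD_eq_getElem _ _ (by omega)]
  exact List.getElem_mem _

/-- The subtraction is truncated: the first element is its own predecessor. In a grid the first
element is 0, so the cell of 0 is the single point 0. -/
theorem idxOf_pred {S : List PtAtom} (hS : S.Nodup) {p : PtAtom} (hp : p ∈ S) :
    S.idxOf (pred S p) = S.idxOf p - 1 := by
  have := List.idxOf_lt_length_of_mem hp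
  rw [pred, List.getD_eq_getElem _ _ (by omega), hS.idxOf_getElem]

namespace IsGrid

variable {S : List PtAtom} {y : ℕ → ℝ}

theorem mono (h : IsGrid S y) {p q : PtAtom} (hp : p ∈ S) (hq : q ∈ S) (hpq : S.idxOf p ≤ S.idxOf q) :
    p.value y ≤ q.value y := by
  rcases hpq.lt_or_eq with hlt | heq
  · exact (pairwise_iff_idxOf h.nodup).1 h.sorted p hp q hq hlt
  · rw [(List.idxOf_inj hp).1 heq]

theorem nonneg (h : IsGrid S y) {p : PtAtom} (hp : p ∈ S) : 0 ≤ p.value y :=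
  h.mono h.zero_mem hp (by simp [h.head])

theorem pred_le (h : IsGrid S y) {p : PtAtom} (hp : p ∈ S) : (pred S p).value y ≤ p.value y :=
  h.mono (pred_mem hp) hp (by rw [idxOf_pred h.nodup hp]; omega)

theorem isPiece_cell (h : IsGrid S y) {p : PtAtom} (hp : p ∈ S) : IsPiece (cell S y p) :=
  isPiece_Icc (h.nonneg (pred_mem hp)) (h.le_one p hp)

theorem le_pred (h : IsGrid S y) {p q : PtAtom} (hp : p ∈ S) (hq : q ∈ S) (hpq : S.idxOf p < S.idxOf q) :
    p.value y ≤ (pred S q).value y :=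
  h.mono hp (pred_mem hq) (by rw [idxOf_pred h.nodup hq]; omega)

theorem finite_cell_inter (h : IsGrid S y) {p q : PtAtom} (hp : p ∈ S) (hq : q ∈ S) (hpq : p ≠ q) :
    (cell S y p ∩ cell S y q).Finite := by
  rcases Nat.lt_or_gt_of_ne (mt (List.idxOf_inj hp).1 hpq) with hlt | hlt
  · refine (finite_singleton (p.value y)).subset fun x hx => ?_
    exact le_antisymm hx.1.2 ((h.le_pred hp hq hlt).trans hx.2.1)
  · refine (finite_singleton (q.value y)).subset fun x hx => ?_
    exact le_antisymm hx.2.2 ((h.le_pred hq hp hlt).trans hx.1.1)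

/-- A point `x` lies in the cell of the atom of least index that is not below `x`. -/
theorem Icc_subset_cells (h : IsGrid S y) : Icc (0 : ℝ) 1 ⊆ ⋃ p ∈ S.toFinset, cell S y p := by
  intro x hx
  obtain ⟨p, hp, hmin⟩ := Finset.exists_min_image (S.toFinset.filter fun p => x ≤ p.value y)
    S.idxOf ⟨.one, Finset.mem_filter.2 ⟨List.mem_toFinset.2 h.one_mem, hx.2⟩⟩
  simp only [Finset.mem_filter, List.mem_toFinset] at hp hmin
  simp only [mem_iUnion, List.mem_toFinset]
  refine ⟨p, hp.1, ?_, hp.2⟩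
  by_contra hlt
  have := hmin (pred S p) ⟨pred_mem hp.1, (not_le.1 hlt).le⟩
  rw [idxOf_pred h.nodup hp.1] at this
  -- By minimality the index of `p` is at most its truncated predecessor, which is possible only for
  -- the first atom.
  have hp0 : p = .zero := (List.idxOf_inj hp.1).1 (by rw [h.head]; omega)
  subst hp0
  refine hlt (le_trans ?_ hx.1)
  exact (h.mono (pred_mem hp.1) hp.1 (by rw [idxOf_pred h.nodup hp.1]; omega)).trans_eq rfl

/-- The value of a piece that is, up to finitely many points, a union of cells. -/
theorem value_eq_sum (h : IsGrid S y) (V : Valuation) {P : Set ℝ} (hP : IsPiece P) {T : Finset PtAtom}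
    (hT : T ⊆ S.toFinset) (hsub : ∀ p ∈ T, cell S y p ⊆ P)
    (hfin : ∀ p ∈ S, p ∉ T → (P ∩ cell S y p).Finite) :
    V.toFun P = ∑ p ∈ T, V.toFun (cell S y p) := by
  have hcell : ∀ p ∈ S.toFinset, IsPiece (cell S y p) := fun p hp =>
    h.isPiece_cell (List.mem_toFinset.1 hp)
  have hsum {U : Finset PtAtom} (hU : U ⊆ S.toFinset) :
      V.toFun (⋃ p ∈ U, cell S y p) = ∑ p ∈ U, V.toFun (cell S y p) :=
    V.biUnion (fun p hp => hcell p (hU hp)) fun p hp q hq =>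
      h.finite_cell_inter (List.mem_toFinset.1 (hU hp)) (List.mem_toFinset.1 (hU hq))
  have hU : IsPiece (⋃ p ∈ S.toFinset \ T, cell S y p) :=
    isPiece_biUnion_finset fun p hp => hcell p (Finset.sdiff_subset hp)
  -- For the upper bound, add to `P` the cells outside `T`: they meet `P` in finitely many points,
  -- and the enlarged piece is still covered by all cells. Monotonicity bounds its value by the full
  -- sum, and the cells outside `T` cancel.
  apply le_antisymm
  · have h₁ := V.union hP hU (by
      rw [inter_iUnion₂]
      refine (S.toFinset \ T).finite_toSet.biUnion fun p hp => ?_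
      simp only [Finset.coe_sdiff, mem_sdiff, Finset.mem_coe, List.mem_toFinset] at hp
      exact hfin p hp.1 hp.2)
    have hP1 : P ∪ ⋃ p ∈ S.toFinset \ T, cell S y p ⊆ ⋃ p ∈ S.toFinset, cell S y p := by
      refine union_subset ?_ (biUnion_subset_biUnion_left Finset.sdiff_subset)
      refine Subset.trans ?_ h.Icc_subset_cells
      obtain ⟨l, hl, rfl⟩ := hP
      exact iUnion₂_subset fun p hp => Icc_subset_Icc (hl p hp).1 (hl p hp).2.2
    have h₂ := V.mono _ _ (isPiece_biUnion_finset hcell) (hP.union hU) hP1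
    rw [h₁, hsum Finset.sdiff_subset, hsum subset_rfl, ← Finset.sum_sdiff hT] at h₂
    linarith
  · rw [← hsum hT]
    exact V.mono _ _ hP (isPiece_biUnion_finset fun p hp => hcell p (hT hp)) (iUnion₂_subset hsub)

/-- The value of a union of intervals between atoms. -/
theorem value_biUnion (h : IsGrid S y) (V : Valuation) {L : List (PtAtom × PtAtom)}
    (hL : ∀ r ∈ L, r.1 ∈ S ∧ r.2 ∈ S) :
    V.toFun (⋃ r ∈ L, Icc (r.1.value y) (r.2.value y)) =
      ((S.filter fun p => L.any fun r => decide (S.idxOf r.1 < S.idxOf p) &&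
        decide (S.idxOf p ≤ S.idxOf r.2)).map fun p => V.toFun (cell S y p)).sum := by
  rw [← List.sum_toFinset _ (h.nodup.filter _)]
  refine h.value_eq_sum V (isPiece_biUnion_list fun r hr =>
    isPiece_Icc (h.nonneg (hL r hr).1) (h.le_one _ (hL r hr).2)) ?_ ?_ ?_
  · intro p hp
    simp only [List.mem_toFinset, List.mem_filter] at hp ⊢
    exact hp.1
  · intro p hp
    simp only [List.mem_toFinset, List.mem_filter, List.any_eq_true, Bool.and_eq_true,
      decide_eq_true_eq] at hp
    obtain ⟨hp, r, hr, h₁, h₂⟩ := hp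
    refine Subset.trans ?_ (subset_biUnion_of_mem (u := fun r : PtAtom × PtAtom =>
      Icc (r.1.value y) (r.2.value y)) hr)
    exact Icc_subset_Icc (h.le_pred (hL r hr).1 hp h₁) (h.mono hp (hL r hr).2 h₂)
  · intro p hp hpT
    rw [iUnion₂_inter]
    refine (List.finite_toSet L).biUnion fun r hr => ?_
    have hr' := hL r hr
    simp only [List.mem_toFinset, List.mem_filter, List.any_eq_true, Bool.and_eq_true,
      decide_eq_true_eq, not_and, not_exists, not_le, hp, true_implies] at hpT
    -- An unselected cell lies after the right end or before the left end of the interval, so they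
    -- share at most one point. This also covers reversed intervals, which select no cell and
    -- contain at most one point.
    by_cases hlt : S.idxOf r.1 < S.idxOf p
    · refine (finite_singleton (r.2.value y)).subset fun x hx => ?_
      exact le_antisymm hx.1.2 ((h.le_pred hr'.2 hp (hpT r hr hlt)).trans hx.2.1)
    · refine (finite_singleton (r.1.value y)).subset fun x hx => ?_
      exact le_antisymm (hx.2.2.trans (h.mono hp hr'.1 (not_lt.1 hlt))) hx.1.1

/-- The cells other than that of `0` have total value `1`. -/
theorem sum_value_cell (h : IsGrid S y) (V : Valuation) :
    ((nonzero S).map fun p => V.toFun (cell S y p)).sum = 1 := by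
  have hcell : ∀ p ∈ S.toFinset, IsPiece (cell S y p) := fun p hp =>
    h.isPiece_cell (List.mem_toFinset.1 hp)
  rw [← List.sum_toFinset _ (h.nodup.filter _), ← V.normalized]
  refine (h.value_eq_sum V (isPiece_Icc le_rfl le_rfl) ?_ ?_ ?_).symm
  · intro p hp
    simp only [List.mem_toFinset, List.mem_filter] at hp ⊢
    exact hp.1
  · intro p hp
    simp only [List.mem_toFinset, List.mem_filter] at hp
    exact Icc_subset_Icc (h.nonneg (pred_mem hp.1)) (h.le_one p hp.1)
  · intro p hp hpT
    obtain rfl : p = .zero := by simpa [hp] using hpT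
    refine (finite_singleton (0 : ℝ)).subset fun x hx => ?_
    exact le_antisymm hx.2.2 hx.1.1

end IsGrid

/-! ### Replacements scale the values of regions -/

theorem IsPointNf.exists_atom {t : Term n} (h : IsPointNf t) : ∃ p : PtAtom, t = p.toTerm := by
  cases h
  exacts [⟨.zero, rfl⟩, ⟨.one, rfl⟩, ⟨.y _, rfl⟩]

theorem PtAtom.atom?_toTerm (p : PtAtom) : (p.toTerm : Term n).atom? = some p := by
  cases p <;> simp [PtAtom.toTerm, Term.atom?]

theorem PtAtom.den_toTerm (p : PtAtom) (J : Fin n → Set ℝ → ℝ) (α : Assn n) :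
    (p.toTerm : Term n).den J α = .num (p.value α.y) := by
  cases p <;> rfl

/-- The interval terms with endpoints given by a pair of atoms. -/
def atomIntvl (r : PtAtom × PtAtom) : Term n := .intvl r.1.toTerm r.2.toTerm

theorem IsIntvlNf.exists_atoms {t : Term n} (h : IsIntvlNf t) : ∃ r, t = atomIntvl r := by
  obtain ⟨hu, hv⟩ := h
  obtain ⟨p, rfl⟩ := hu.exists_atom
  obtain ⟨q, rfl⟩ := hv.exists_atom
  exact ⟨(p, q), rfl⟩

theorem IsPieceNf.exists_atoms {t : Term n} (h : IsPieceNf t) :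
    ∃ L : List (PtAtom × PtAtom), t = .union (L.map atomIntvl) := by
  obtain ⟨h⟩ := h
  rename_i ts
  induction ts with
  | nil => exact ⟨[], rfl⟩
  | cons t ts ih =>
    obtain ⟨L, hL⟩ := ih fun u hu => h u (by simp [hu])
    obtain ⟨r, rfl⟩ := (h t (by simp)).exists_atoms
    simp only [Term.union.injEq] at hL
    exact ⟨r :: L, by rw [List.map_cons, hL]⟩

theorem inSub_atomIntvl (S : List PtAtom) (p : PtAtom) (r : PtAtom × PtAtom) :
    inSub S p (atomIntvl r : Term n) =
      (decide (S.idxOf r.1 < S.idxOf p) && decide (S.idxOf p ≤ S.idxOf r.2)) := by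
  simp [atomIntvl, inSub, PtAtom.atom?_toTerm]

/-- A region in normal form is a union of intervals between atoms. -/
theorem IsRegionNf.exists_atoms {t : Term n} (h : IsRegionNf t) : ∃ L : List (PtAtom × PtAtom),
    (∀ S, restrict S t = S.filter fun p => L.any fun r =>
      decide (S.idxOf r.1 < S.idxOf p) && decide (S.idxOf p ≤ S.idxOf r.2)) ∧
    (∀ J α a, (Term.val a t).den J α =
      .num (J a (⋃ r ∈ L, Icc (r.1.value α.y) (r.2.value α.y)))) ∧
    ∀ r ∈ L, (r.1.toTerm : Term n).ys ⊆ t.ys ∧ (r.2.toTerm : Term n).ys ⊆ t.ys := by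
  rcases h with h | h
  · obtain ⟨r, rfl⟩ := h.exists_atoms
    refine ⟨[r], fun S => ?_, fun J α a => ?_, ?_⟩
    · simp [← inSub_atomIntvl (n := n), restrict, atomIntvl]
    · simp [Term.den, atomIntvl, PtAtom.den_toTerm, Den.mkIntvl, Den.val]
    · simp [atomIntvl, Term.ys]
  · obtain ⟨L, rfl⟩ := h.exists_atoms
    refine ⟨L, fun S => ?_, fun J α a => ?_, fun r hr => ?_⟩
    · simp [restrict, List.any_map, Function.comp_def, inSub_atomIntvl]
    · have : (Term.denL J α (L.map atomIntvl)).map Den.getIntvl =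
          L.map fun r => (r.1.value α.y, r.2.value α.y) := by
        simp [Term.denL_eq_map, atomIntvl, Term.den, PtAtom.den_toTerm, Den.mkIntvl,
          Den.getIntvl]
      rw [Term.den, Term.den, this, Den.val]
      congr 2
      ext x
      simp only [mem_iUnion, List.mem_map, exists_prop]
      exact ⟨by rintro ⟨_, ⟨r, hr, rfl⟩, hx⟩; exact ⟨r, hr, hx⟩, fun ⟨r, hr, hx⟩ =>
        ⟨_, ⟨r, hr, rfl⟩, hx⟩⟩
    · have := Term.ysL_subset.1 (subset_refl (Term.ysL (L.map (atomIntvl (n := n)))))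
        (atomIntvl r) (List.mem_map_of_mem hr)
      rw [atomIntvl, Term.ys] at this
      exact Finset.union_subset_iff.1 this

theorem den_gap (J : Fin n → Set ℝ → ℝ) (α : Assn n) (a : Fin n) (p : PtAtom) :
    (gap a p).den J α = .num (p.value α.y - α.z a p) := by
  rw [sub_eq_add_neg, ← neg_one_mul]
  exact Term.den_add (p.den_toTerm J α) (Term.den_smul _ rfl)

theorem den_sum_gap (J : Fin n → Set ℝ → ℝ) (α : Assn n) (a : Fin n) (ps : List PtAtom) :
    (Term.sum (ps.map (gap a))).den J α =
      .num (ps.map fun p => p.value α.y - α.z a p).sum := by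
  induction ps with
  | nil => rfl
  | cons p ps ih => exact Term.den_add (den_gap J α a p) ih

/-- Replacing the values of regions by sums of gaps multiplies them by `c`. -/
def Scales (J : Fin n → Set ℝ → ℝ) (α : Assn n) (S : List PtAtom) (Y : Finset ℕ) (c : ℝ) : Prop :=
  ∀ (a : Fin n) (t : Term n), IsRegionNf t → t.ys ⊆ Y → ∃ r, (Term.val a t).den J α = .num r ∧
    ((restrict S t).map fun p => p.value α.y - α.z a p).sum = c * r

section Scales

variable {J : Fin n → Set ℝ → ℝ} {α : Assn n} {S : List PtAtom} {Y : Finset ℕ} {c : ℝ}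

/-- The only constant in a normal form is 0, so the terms are homogeneous and scale with the values
of regions. The replaced term contains no symbol `val_a`, which is why its interpretation `J'` is
arbitrary. -/
theorem Scales.den_repl (h : Scales J α S Y c) (J' : Fin n → Set ℝ → ℝ) {t : Term n}
    (ht : IsVltnNf t) (hY : t.ys ⊆ Y) :
    ∃ r, t.den J α = .num r ∧ (t.repl S).den J' α = .num (c * r) := by
  induction ht with
  | zero => exact ⟨0, rfl, by simp [Term.repl, Term.den]⟩
  | val a ht =>
    obtain ⟨r, hr, hr'⟩ := h a _ ht hY
    exact ⟨r, hr, by rw [Term.repl, den_sum_gap, hr']⟩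
  | add _ _ h₁ h₂ =>
    simp only [Term.ys, Term.ysL, Finset.union_empty, Finset.union_subset_iff] at hY
    obtain ⟨r, hr, hr'⟩ := h₁ hY.1
    obtain ⟨s, hs, hs'⟩ := h₂ hY.2
    refine ⟨_, Term.den_add hr hs, ?_⟩
    rw [mul_add]
    simp only [Term.repl, Term.replL]
    exact Term.den_add hr' hs'
  | smul q _ h₁ =>
    simp only [Term.ys, Term.ysL, Finset.union_empty] at hY
    obtain ⟨r, hr, hr'⟩ := h₁ hY
    refine ⟨_, Term.den_smul q hr, ?_⟩
    rw [mul_left_comm]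
    simp only [Term.repl, Term.replL]
    exact Term.den_smul q hr'

/-- Replacements preserve the truth of formulas in normal form. -/
theorem Scales.holds_repl (h : Scales J α S Y c) (hc : 0 < c) (J' : Fin n → Set ℝ → ℝ)
    {φ : Formula n} (hφ : φ.IsNf) (hY : φ.ys ⊆ Y) :
    (φ.repl S).Holds J' α ↔ φ.Holds J α := by
  induction hφ with
  | tru => rfl
  | fls => rfl
  | ptGe h₁ h₂ =>
    obtain ⟨p, rfl⟩ := h₁.exists_atom
    obtain ⟨q, rfl⟩ := h₂.exists_atom
    simp [Formula.repl, Formula.mapTerms, h₁.repl, h₂.repl, Formula.Holds, PtAtom.den_toTerm]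
  | vGe h₁ h₂ =>
    rw [Formula.ys, Finset.union_subset_iff] at hY
    obtain ⟨r, hr, hr'⟩ := h.den_repl J' h₁ hY.1
    obtain ⟨s, hs, hs'⟩ := h.den_repl J' h₂ hY.2
    simp [Formula.repl, Formula.mapTerms, Formula.Holds, hr, hr', hs, hs',
      mul_le_mul_iff_right₀ hc]
  | vEq h₁ h₂ =>
    rw [Formula.ys, Finset.union_subset_iff] at hY
    obtain ⟨r, hr, hr'⟩ := h.den_repl J' h₁ hY.1
    obtain ⟨s, hs, hs'⟩ := h.den_repl J' h₂ hY.2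
    simp [Formula.repl, Formula.mapTerms, Formula.Holds, hr, hr', hs, hs', hc.ne']
  | not _ ih => exact not_congr (ih hY)
  | and _ _ ih₁ ih₂ =>
    rw [Formula.ys, Finset.union_subset_iff] at hY
    exact and_congr (ih₁ hY.1) (ih₂ hY.2)
  | or _ _ ih₁ ih₂ =>
    rw [Formula.ys, Finset.union_subset_iff] at hY
    exact or_congr (ih₁ hY.1) (ih₂ hY.2)

theorem Formula.Simplifies.holds_repl {φ : Formula n} (hφ : φ.Simplifies)
    (h : Scales J α S Y c) (hc : 0 < c) (J' : Fin n → Set ℝ → ℝ) (hY : φ.ys ⊆ Y) :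
    (φ.simpl.repl S).Holds J' α ↔ φ.Holds J α :=
  (h.holds_repl hc J' hφ.1 ((Formula.ys_simpl φ).trans hY)).trans (hφ.2 J α)

theorem mem_of_ys_subset (hz : .zero ∈ S) (ho : .one ∈ S) (hS : ∀ s ∈ Y, .y s ∈ S) {p : PtAtom}
    (hp : (p.toTerm : Term n).ys ⊆ Y) : p ∈ S := by
  cases p with
  | zero => exact hz
  | one => exact ho
  | y s => exact hS s (hp (by simp [PtAtom.toTerm, Term.ys]))

/-- The gaps are proportional to the values of the cells. -/
theorem scales_of_gap_eq {V : Fin n → Valuation} (h : IsGrid S α.y) (hS : ∀ s ∈ Y, .y s ∈ S)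
    (hc : ∀ a, ∀ p ∈ nonzero S, p.value α.y - α.z a p = c * (V a).toFun (cell S α.y p)) :
    Scales (interp V) α S Y c := by
  intro a t ht hY
  obtain ⟨L, hL, hd, hys⟩ := ht.exists_atoms
  refine ⟨_, hd _ α a, ?_⟩
  rw [interp, h.value_biUnion (V a) fun r hr =>
    ⟨mem_of_ys_subset h.zero_mem h.one_mem hS ((hys r hr).1.trans hY),
      mem_of_ys_subset h.zero_mem h.one_mem hS ((hys r hr).2.trans hY)⟩, ← hL, ← List.sum_map_mul_left]
  congr 1
  refine List.map_congr_left fun p hp => hc a p ?_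
  rw [hL] at hp
  simp only [List.mem_filter, List.any_eq_true, Bool.and_eq_true, decide_eq_true_eq] at hp
  obtain ⟨hp, r, hr, hlt, -⟩ := hp
  refine List.mem_filter.2 ⟨hp, ?_⟩
  simp only [ne_eq, decide_not, Bool.not_eq_eq_eq_not, Bool.not_true, decide_eq_false_iff_not]
  -- The atom 0 has index 0, so it is never strictly after a left endpoint and belongs to no
  -- restriction.
  rintro rfl
  rw [h.head] at hlt
  omega

/-- If all gaps vanish, they are proportional to the zero interpretation. -/
theorem scales_zero (h : ∀ a, ∀ p ∈ S, p ≠ .zero → p.value α.y = α.z a p)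
    (hhead : S.idxOf .zero = 0) : Scales (fun _ _ => 0) α S Y 1 := by
  intro a t ht hY
  obtain ⟨L, hL, hd, hys⟩ := ht.exists_atoms
  refine ⟨_, hd _ α a, ?_⟩
  rw [mul_zero]
  refine List.sum_eq_zero fun x hx => ?_
  obtain ⟨p, hp, rfl⟩ := List.mem_map.1 hx
  rw [hL] at hp
  simp only [List.mem_filter, List.any_eq_true, Bool.and_eq_true, decide_eq_true_eq] at hp
  obtain ⟨hp, r, hr, hlt, -⟩ := hp
  rw [sub_eq_zero]
  refine h a p hp ?_
  rintro rfl
  omega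

end Scales

open Filter Topology

/-! ### The formula `ψ(S)` -/

/-- By transitivity, comparing neighbours is the same as comparing all pairs. -/
theorem holds_chain {J : Fin n → Set ℝ → ℝ} {α : Assn n} {ts : List (Term n)} {rs : List ℝ}
    (h : List.Forall₂ (fun t r => Term.den J α t = .num r) ts rs) :
    (chain ts).Holds J α ↔ rs.Pairwise (· ≤ ·) := by
  rw [← List.isChain_iff_pairwise]
  induction h with
  | nil => simp [chain, Formula.Holds]
  | cons h hs ih =>
    cases hs with
    | nil => simp [chain, Formula.Holds]
    | cons h' hs =>
      rw [List.isChain_cons_cons, ← ih]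
      simp [chain, Formula.Holds, h, h']

theorem holds_chainFormula {J : Fin n → Set ℝ → ℝ} {α : Assn n} {S : List PtAtom} {a : Fin n} :
    (chainFormula S a).Holds J α ↔
      (0 :: ((nonzero S).flatMap fun p => [α.z a p, p.value α.y]) ++ [1]).Pairwise (· ≤ ·) := by
  refine holds_chain ?_
  refine .cons rfl (List.rel_append ?_ (.cons rfl .nil))
  induction nonzero S with
  | nil => exact .nil
  | cons p ps ih => exact .cons rfl (.cons (p.den_toTerm J α) ih)

section Replacements

variable {Y : Finset ℕ} {S : List PtAtom}

theorem eq_cons_nonzero (hS : S ∈ replacements Y) : S = .zero :: nonzero S := by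
  obtain ⟨l, -, rfl⟩ := mem_replacements.1 hS
  simp [nonzero, List.filter_map, Function.comp_def]

theorem nodup_of_mem_replacements (hS : S ∈ replacements Y) : S.Nodup := by
  obtain ⟨l, hl, rfl⟩ := mem_replacements.1 hS
  have hn : l.Nodup := hl.nodup_iff.2 (Finset.sort_nodup Y _)
  simp [List.nodup_append, List.nodup_map_iff (fun _ _ h => PtAtom.y.inj h), hn]

theorem idxOf_zero (hS : S ∈ replacements Y) : S.idxOf .zero = 0 := by
  rw [eq_cons_nonzero hS, List.idxOf_cons_self]

theorem zero_mem (hS : S ∈ replacements Y) : .zero ∈ S := by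
  rw [eq_cons_nonzero hS]; simp

theorem one_mem (hS : S ∈ replacements Y) : .one ∈ S := by
  obtain ⟨l, -, rfl⟩ := mem_replacements.1 hS
  simp

theorem y_mem (hS : S ∈ replacements Y) {s : ℕ} (hs : s ∈ Y) : .y s ∈ S := by
  obtain ⟨l, hl, rfl⟩ := mem_replacements.1 hS
  simp [hl.mem_iff, hs]

theorem mem_nonzero {p : PtAtom} : p ∈ nonzero S ↔ p ∈ S ∧ p ≠ .zero := by
  simp [nonzero]

/-- The chain of inequalities says that the atoms form a grid and the variables `z` lie in its
cells. -/
theorem holds_chainFormula_iff (hS : S ∈ replacements Y) {J : Fin n → Set ℝ → ℝ} {α : Assn n}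
    {a : Fin n} : (chainFormula S a).Holds J α ↔ IsGrid S α.y ∧ ∀ p ∈ nonzero S,
      (pred S p).value α.y ≤ α.z a p ∧ α.z a p ≤ p.value α.y := by
  have hn := nodup_of_mem_replacements hS
  rw [holds_chainFormula, List.pairwise_append, List.pairwise_cons, List.pairwise_flatMap]
  simp only [List.mem_flatMap, List.mem_cons, List.not_mem_nil, or_false, List.pairwise_cons,
    List.Pairwise.nil, forall_exists_index, and_imp, forall_eq_or_imp, forall_eq, IsEmpty.forall_iff,
    implies_true, and_true, true_and]
  constructor
  · rintro ⟨⟨h₀, hz, hp⟩, -, h₁⟩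
    -- In the chain z_q stands immediately before q, hence after every atom that precedes q, in
    -- particular after its predecessor.
    have hS' : S.Pairwise fun p q => p.value α.y ≤ α.z a q := by
      rw [eq_cons_nonzero hS, List.pairwise_cons]
      exact ⟨fun q hq => h₀ _ q hq (.inl rfl), hp.imp fun h => h.2.1⟩
    refine ⟨⟨hn, idxOf_zero hS, zero_mem hS, one_mem hS, ?_, fun p hp => ?_⟩, fun p hp =>
      ⟨?_, hz p hp⟩⟩
    · rw [eq_cons_nonzero hS, List.pairwise_cons]
      exact ⟨fun q hq => h₀ _ q hq (.inr rfl), hp.imp fun h => h.2.2⟩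
    · by_cases hp0 : p = .zero
      · subst hp0
        exact zero_le_one
      · exact h₁ _ p (mem_nonzero.2 ⟨hp, hp0⟩) (.inr rfl)
    · obtain ⟨hpS, hp0⟩ := mem_nonzero.1 hp
      refine (pairwise_iff_idxOf hn).1 hS' _ (pred_mem hpS) _ hpS ?_
      rw [idxOf_pred hn hpS]
      have : S.idxOf p ≠ 0 := fun h => hp0 ((List.idxOf_inj hpS).1 (h.trans (idxOf_zero hS).symm))
      omega
  · rintro ⟨hg, hz⟩
    have h₀ : ∀ p ∈ nonzero S, 0 ≤ α.z a p := fun p hp =>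
      (hg.nonneg (pred_mem (mem_nonzero.1 hp).1)).trans (hz p hp).1
    have hS' : S.Pairwise fun p q => q ≠ .zero → p.value α.y ≤ α.z a q :=
      (pairwise_iff_idxOf hn).2 fun p hp q hq hpq hq0 =>
        (hg.le_pred hp hq hpq).trans (hz q (mem_nonzero.2 ⟨hq, hq0⟩)).1
    refine ⟨⟨?_, fun p hp => (hz p hp).2, ?_⟩, zero_le_one, ?_⟩
    · rintro x p hp (rfl | rfl)
      exacts [h₀ p hp, (h₀ p hp).trans (hz p hp).2]
    · refine (hS'.filter fun p => p ≠ .zero).imp_of_mem fun {p q} hp hq h => ?_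
      have hpq := h (mem_nonzero.1 hq).2
      have hzp := (hz p hp).2
      have hzq := (hz q hq).2
      exact ⟨⟨hzp.trans hpq, (hzp.trans hpq).trans hzq⟩, hpq, hpq.trans hzq⟩
    · have h₁ : ∀ p ∈ nonzero S, p.value α.y ≤ 1 := fun p hp => hg.le_one p (mem_nonzero.1 hp).1
      rintro x p hp (rfl | rfl)
      exacts [(hz p hp).2.trans (h₁ p hp), h₁ p hp]

theorem holds_psi (hS : S ∈ replacements Y) {J : Fin n → Set ℝ → ℝ} {α : Assn n} :
    (psi n S).Holds J α ↔ ∀ a a' : Fin n, (IsGrid S α.y ∧ ∀ p ∈ nonzero S,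
      (pred S p).value α.y ≤ α.z a p ∧ α.z a p ≤ p.value α.y) ∧
      ((nonzero S).map fun p => p.value α.y - α.z a p).sum =
        ((nonzero S).map fun p => p.value α.y - α.z a' p).sum := by
  rw [psi_eq, Formula.holds_conj]
  simp only [mem_psi_conjuncts, forall_exists_index]
  constructor
  · intro h a a'
    obtain ⟨h₁, h₂⟩ := h _ a a' rfl
    exact ⟨(holds_chainFormula_iff hS).1 h₁, by simpa [Formula.Holds, den_sum_gap, eq_comm] using h₂⟩
  · rintro h _ a a' rfl
    exact ⟨(holds_chainFormula_iff hS).2 (h a a').1,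
      by simpa [Formula.Holds, den_sum_gap, eq_comm] using (h a a').2⟩

end Replacements

/-! ### Piecewise uniform valuations -/

/-- The overlap is finite, hence a null set. -/
theorem real_volume_union_inter {P Q I : Set ℝ} (hP : IsPiece P) (hQ : IsPiece Q)
    (h : Disjoint (interior P) (interior Q)) (hI : volume I ≠ ⊤) (hm : MeasurableSet I) :
    volume.real ((P ∪ Q) ∩ I) = volume.real (P ∩ I) + volume.real (Q ∩ I) := by
  rw [union_inter_distrib_right]
  refine measureReal_union₀ (hQ.isClosed.measurableSet.inter hm).nullMeasurableSet ?_
    (measure_ne_top_of_subset inter_subset_right hI)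
    (measure_ne_top_of_subset inter_subset_right hI)
  exact measure_mono_null
    (fun x (hx : x ∈ (P ∩ I) ∩ (Q ∩ I)) => (⟨hx.1.1, hx.2.1⟩ : x ∈ P ∩ Q))
    ((hP.finite_inter hQ h).measure_zero volume)

theorem real_volume_Icc_inter_Icc (l r a b : ℝ) :
    volume.real (Icc l r ∩ Icc a b) = max (min r b - max l a) 0 := by
  rw [Icc_inter_Icc, Real.volume_real_Icc]

/-- The valuation with constant density on the union of given intervals. -/
noncomputable def uniformValuation {ι : Type} (T : Finset ι) (l r : ι → ℝ)
    (hl : ∀ i ∈ T, 0 ≤ l i) (hlr : ∀ i ∈ T, l i ≤ r i) (hr : ∀ i ∈ T, r i ≤ 1)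
    (hpos : 0 < ∑ i ∈ T, (r i - l i)) : Valuation where
  toFun P := (∑ i ∈ T, volume.real (P ∩ Icc (l i) (r i))) / ∑ i ∈ T, (r i - l i)
  additive P Q hP hQ h := by
    rw [← add_div, ← Finset.sum_add_distrib]
    congr 1
    exact Finset.sum_congr rfl fun i _ =>
      real_volume_union_inter hP hQ h measure_Icc_lt_top.ne measurableSet_Icc
  nonneg P _ := div_nonneg (Finset.sum_nonneg fun _ _ => measureReal_nonneg) hpos.le
  -- The overlap of two intervals has an explicit length, built from minima and maxima of the
  -- endpoints.
  continuous := by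
    simp only [real_volume_Icc_inter_Icc]
    fun_prop
  mono P Q _ _ h := by
    refine div_le_div_of_nonneg_right (Finset.sum_le_sum fun i _ => ?_) hpos.le
    exact measureReal_mono (inter_subset_inter_left _ h)
      (measure_ne_top_of_subset inter_subset_right measure_Icc_lt_top.ne)
  normalized := by
    rw [div_eq_one_iff_eq hpos.ne']
    refine Finset.sum_congr rfl fun i hi => ?_
    rw [real_volume_Icc_inter_Icc, min_eq_right (hr i hi), max_eq_right (hl i hi),
      max_eq_left (sub_nonneg.2 (hlr i hi))]

/-- Where `d i` is positive every sufficiently small `c` works, and where it vanishes so does `v i`.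
As `T` is finite, one `c` serves for all indices. -/
theorem exists_pos_mul_le {ι : Type} (T : Finset ι) (v d : ι → ℝ) (hd : ∀ i ∈ T, 0 ≤ d i)
    (h : ∀ i ∈ T, d i = 0 → v i = 0) : ∃ c : ℝ, 0 < c ∧ ∀ i ∈ T, c * v i ≤ d i := by
  have : ∀ᶠ c in 𝓝[>] (0 : ℝ), ∀ i ∈ T, c * v i ≤ d i := by
    rw [Filter.eventually_all_finset]
    intro i hi
    rcases (hd i hi).eq_or_lt with h0 | hpos
    · simp [← h0, h i hi h0.symm]
    · have ht : Tendsto (fun c : ℝ => c * v i) (𝓝[>] 0) (𝓝 (0 * v i)) :=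
        (Continuous.tendsto (by fun_prop) 0).mono_left nhdsWithin_le_nhds
      rw [zero_mul] at ht
      exact (ht.eventually_lt_const hpos).mono fun _ h => h.le
  exact (eventually_mem_nhdsWithin.and this).exists

/-! ### From replacements to valuation sets and back -/

/-- All comparisons read 0 ≥ 0, but they hold only between terms that denote numbers. The normal
form of the components ensures this. -/
theorem holds_envyFormula_zero {α : Assn n} {t : Term n} (h : Simplifies (Ty.alloc n) t) :
    (envyFormula t).Holds (fun _ _ => 0) α := by
  have hc := Simplifies.comps h
  rw [List.length_replicate] at hc
  have hcomp (a a' : Fin n) : (Term.val a (t.comp n a')).den (fun _ _ => 0) α = .num 0 := by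
    have hs : Simplifies .piece (t.comp n a') := by
      simpa [Term.comps] using (List.forall₂_iff_get.1 hc).2 a' (by simp) (by simp [Term.comps])
    obtain ⟨L, -, hd, -⟩ := IsRegionNf.exists_atoms (.inr (isNf_rdPiece.1 hs.rd.1))
    simpa only [Term.den, hs.2] using hd (fun _ _ => 0) α a
  rw [holds_envyFormula]
  intro a a'
  simp [Formula.Holds, hcomp]

/-- The support [l q, q] lies in the cell of q. The cell of p thus contains its own part of the
support and meets the others in at most a point each. -/
theorem IsGrid.value_uniformValuation {S : List PtAtom} {y : ℕ → ℝ} (h : IsGrid S y)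
    {l : PtAtom → ℝ} (hz : ∀ p ∈ nonzero S, (pred S p).value y ≤ l p ∧ l p ≤ p.value y)
    (hl hlr hr hpos) {p : PtAtom} (hp : p ∈ nonzero S) :
    p.value y - l p = (∑ q ∈ (nonzero S).toFinset, (q.value y - l q)) *
      (uniformValuation (nonzero S).toFinset l (fun q => q.value y) hl hlr hr hpos).toFun
        (cell S y p) := by
  rw [uniformValuation, mul_div_cancel₀ _ hpos.ne']
  simp only [cell, real_volume_Icc_inter_Icc]
  rw [Finset.sum_eq_single_of_mem p (by simpa using hp)]
  · rw [min_self, max_eq_right (hz p hp).1, max_eq_left (sub_nonneg.2 (hz p hp).2)]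
  · intro q hq hqp
    rw [List.mem_toFinset] at hq
    have hpS := (mem_nonzero.1 hp).1
    have hqS := (mem_nonzero.1 hq).1
    refine max_eq_right (sub_nonpos.2 ?_)
    rcases Nat.lt_or_gt_of_ne (mt (List.idxOf_inj hpS).1 hqp.symm) with hlt | hlt
    · exact (min_le_left _ _).trans (((h.le_pred hpS hqS hlt).trans (hz q hq).1).trans
        (le_max_right _ _))
    · exact (min_le_right _ _).trans ((h.le_pred hqS hpS hlt).trans (le_max_left _ _))

/-- A path with envy-free results for all valuation sets satisfies its reduced formulas. -/
theorem Path.holds_matrix {b : Path n} (hr : Simplifies (Ty.alloc n) b.rho)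
    (hc : b.constr.Simplifies)
    (h : ∀ (V : Fin n → Valuation) (α : Assn n), (∀ s, α.y s ∈ Icc (0 : ℝ) 1) →
      b.constr.Holds (interp V) α → (envyFormula b.rho).Holds (interp V) α)
    {S : List PtAtom} (hS : S ∈ replacements b.ys) (J : Fin n → Set ℝ → ℝ) (α : Assn n)
    (hα : ∀ s ∉ b.ys, α.y s = 0) : (b.matrix S).Holds J α := by
  have he := simplifies_envyFormula hr
  have hYc : b.constr.ys ⊆ b.ys := Finset.subset_union_left
  have hYe : (envyFormula b.rho).ys ⊆ b.ys := (ys_envyFormula _).trans Finset.subset_union_right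
  rw [Path.matrix_eq]
  rintro ⟨hconstr, hpsi⟩
  rw [holds_psi hS] at hpsi
  -- Without agents ψ(S) is an empty conjunction and yields no grid, but then every scaling
  -- condition holds vacuously and nobody can be envious.
  rcases isEmpty_or_nonempty (Fin n) with hn | ⟨⟨a₀⟩⟩
  · exact (he.holds_repl (c := 1) (J := fun _ _ => 0) (Y := b.ys) (fun a => hn.elim a) one_pos J
      hYe).2 (holds_envyFormula_zero hr)
  have hg := (hpsi a₀ a₀).1.1
  have hz := fun a => (hpsi a a).1.2
  have hnd := hg.nodup.filter fun p => p ≠ .zero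
  set c := ∑ p ∈ (nonzero S).toFinset, (p.value α.y - α.z a₀ p) with hcdef
  have hsum (a : Fin n) : ∑ p ∈ (nonzero S).toFinset, (p.value α.y - α.z a p) = c := by
    rw [hcdef, List.sum_toFinset _ hnd, List.sum_toFinset _ hnd]
    exact (hpsi a a₀).2
  have hnonneg (a : Fin n) : ∀ p ∈ (nonzero S).toFinset, 0 ≤ p.value α.y - α.z a p :=
    fun p hp => sub_nonneg.2 (hz a p (List.mem_toFinset.1 hp)).2
  -- The common total length is the scaling factor. If it is 0, all gaps vanish for all agents and
  -- the zero interpretation takes the place of a valuation set.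
  rcases (Finset.sum_nonneg (hnonneg a₀)).eq_or_lt with hc0 | hpos
  · refine (he.holds_repl (scales_zero (fun a p hp hp0 => ?_) hg.head) one_pos J hYe).2
      (holds_envyFormula_zero hr)
    have h0 := (Finset.sum_eq_zero_iff_of_nonneg (hnonneg a)).1 ((hsum a).trans hc0.symm) p
      (List.mem_toFinset.2 (mem_nonzero.2 ⟨hp, hp0⟩))
    linarith
  · have hl (a : Fin n) : ∀ p ∈ (nonzero S).toFinset, 0 ≤ α.z a p := fun p hp => by
      rw [List.mem_toFinset] at hp
      exact (hg.nonneg (pred_mem (mem_nonzero.1 hp).1)).trans (hz a p hp).1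
    -- Agent a spreads its value uniformly over the intervals [z_{a,p}, p].
    let V (a : Fin n) : Valuation := uniformValuation (nonzero S).toFinset (α.z a)
      (fun p => p.value α.y) (hl a) (fun p hp => (hz a p (List.mem_toFinset.1 hp)).2)
      (fun p hp => hg.le_one p (mem_nonzero.1 (List.mem_toFinset.1 hp)).1)
      (by rw [hsum a]; exact hpos)
    have hsc : Scales (interp V) α S b.ys c := scales_of_gap_eq hg (fun s => y_mem hS)
      fun a p hp => by rw [hg.value_uniformValuation (hz a) _ _ _ _ hp, hsum a]
    refine (he.holds_repl hsc hpos J hYe).2 (h V α (fun s => ?_)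
      ((hc.holds_repl hsc hpos J hYc).1 hconstr))
    by_cases hs : s ∈ b.ys
    · exact ⟨hg.nonneg (y_mem hS hs), hg.le_one _ (y_mem hS hs)⟩
    · simp [hα s hs]

/-- Sort the marks by their values; ties may be broken in any way, since a grid requires only weak
inequalities. -/
theorem exists_replacement (Y : Finset ℕ) {y : ℕ → ℝ} (hy : ∀ s, y s ∈ Icc (0 : ℝ) 1) :
    ∃ S ∈ replacements Y, IsGrid S y := by
  let l := (Y.sort (· ≤ ·)).insertionSort fun s t => y s ≤ y t
  have : Std.Total fun s t : ℕ => y s ≤ y t := ⟨fun _ _ => le_total _ _⟩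
  have : IsTrans ℕ fun s t : ℕ => y s ≤ y t := ⟨fun _ _ _ => le_trans⟩
  have hS : .zero :: l.map .y ++ [.one] ∈ replacements Y :=
    mem_replacements.2 ⟨l, List.perm_insertionSort _ _, rfl⟩
  refine ⟨_, hS, nodup_of_mem_replacements hS, idxOf_zero hS, zero_mem hS, one_mem hS, ?_, ?_⟩
  · have hl : l.Pairwise fun s t => y s ≤ y t := List.pairwise_insertionSort _ _
    simp only [List.pairwise_append, List.pairwise_cons, List.pairwise_map]
    refine ⟨⟨?_, hl⟩, by simp, ?_⟩
    · intro p hp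
      obtain ⟨s, -, rfl⟩ := List.mem_map.1 hp
      exact (hy s).1
    · intro p hp q hq
      obtain rfl : q = .one := by simpa using hq
      rcases List.mem_cons.1 hp with rfl | hp
      · exact zero_le_one
      · obtain ⟨s, -, rfl⟩ := List.mem_map.1 hp
        exact (hy s).2
  · rintro (_ | _ | s) -
    exacts [zero_le_one, le_rfl, (hy s).2]

/-- A path that satisfies its reduced formulas has envy-free results. -/
theorem Path.exists_holds_envyFormula {b : Path n} (hr : Simplifies (Ty.alloc n) b.rho)
    (hc : b.constr.Simplifies)
    (h : ∀ S ∈ replacements b.ys, ∀ (J : Fin n → Set ℝ → ℝ) (α : Assn n), (b.matrix S).Holds J α)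
    (V : Fin n → Valuation) {y : ℕ → ℝ} (hy : ∀ s, y s ∈ Icc (0 : ℝ) 1)
    (hconstr : ∀ α : Assn n, α.y = y → b.constr.Holds (interp V) α) :
    ∃ α : Assn n, α.y = y ∧ (envyFormula b.rho).Holds (interp V) α := by
  have he := simplifies_envyFormula hr
  have hYc : b.constr.ys ⊆ b.ys := Finset.subset_union_left
  have hYe : (envyFormula b.rho).ys ⊆ b.ys := (ys_envyFormula _).trans Finset.subset_union_right
  obtain ⟨S, hS, hg⟩ := exists_replacement b.ys hy
  -- One factor for all agents and cells, small enough for c V_a(cell) to fit into the length of the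
  -- cell. A cell of length 0 is a single point and has value 0, as the choice of c requires.
  obtain ⟨c, hpos, hle⟩ := exists_pos_mul_le (Finset.univ ×ˢ S.toFinset)
    (fun i : Fin n × PtAtom => (V i.1).toFun (cell S y i.2))
    (fun i => i.2.value y - (pred S i.2).value y)
    (fun i hi => sub_nonneg.2 (hg.pred_le (by simpa using hi)))
    (fun i hi h0 => by
      refine (V i.1).finite (hg.isPiece_cell (by simpa using hi)) ?_
      rw [cell, sub_eq_zero.1 h0]
      simp)
  have hle' (a : Fin n) {p : PtAtom} (hp : p ∈ S) :
      c * (V a).toFun (cell S y p) ≤ p.value y - (pred S p).value y :=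
    hle (a, p) (by simpa using hp)
  -- The gap of p becomes exactly c times the value of its cell. The program variables may denote
  -- anything, because the constraint holds under every assignment with marks `y`.
  let α : Assn n := ⟨fun _ => .err, fun _ => .err, y,
    fun a p => p.value y - c * (V a).toFun (cell S y p)⟩
  have hsc : Scales (interp V) α S b.ys c :=
    scales_of_gap_eq hg (fun s => y_mem hS) fun a p _ => by simp [α]
  have hpsi : (psi n S).Holds (interp V) α := by
    refine (holds_psi hS).2 fun a a' => ⟨⟨hg, fun p hp => ⟨?_, ?_⟩⟩, ?_⟩
    · have := hle' a (mem_nonzero.1 hp).1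
      simp only [α]
      linarith
    · have := (V a).nonneg _ (hg.isPiece_cell (mem_nonzero.1 hp).1)
      simp only [α]
      nlinarith
    -- Both sums equal c, since the cells of the nonzero atoms have total value 1 for each agent.
    · simp only [α, sub_sub_cancel, List.sum_map_mul_left, hg.sum_value_cell]
  have hm := h S hS (interp V) α
  rw [Path.matrix_eq] at hm
  exact ⟨α, rfl, (he.holds_repl hsc hpos _ hYe).1
    (hm ⟨(hc.holds_repl hsc hpos _ hYc).2 (hconstr α rfl), hpsi⟩)⟩

/-- Envy-freeness is validity of the reduced formula. -/
theorem Expr.envyFree_iff_valid {e : Expr n} (hwf : e.WellFormed)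
    (hty : e.HasType (Ty.alloc n)) : e.EnvyFree ↔ e.reduced.Valid := by
  constructor
  · intro he
    refine Expr.valid_of_holds_matrix fun b hb S hS J α hα => ?_
    obtain ⟨hr, hc⟩ := Path.simplifies hty hwf.points hb
    exact Path.holds_matrix hr hc (fun V α => he.holds_envyFormula hty hb) hS J α hα
  · intro hv
    refine Expr.envyFree_of_paths hwf.ids fun b hb V y hy hconstr => ?_
    obtain ⟨hr, hc⟩ := Path.simplifies hty hwf.points hb
    exact Path.exists_holds_envyFormula hr hc
      (fun S hS => Expr.holds_matrix_of_valid hv hb hS) V hy hconstr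

end Slice

theorem mainTheorem1 {n : ℕ} (e : Slice.Expr n) (hwf : e.WellFormed)
    (hty : e.HasType (Slice.Ty.alloc n)) :
    (e.EnvyFree ↔ e.reduced.Valid) ∧ e.reduced.IsLRA ∧ e.reduced.ys = ∅ :=
  ⟨Slice.Expr.envyFree_iff_valid hwf hty, Slice.Expr.isLRA_reduced hwf hty, e.ys_reduced⟩
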